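/- **Setting.** Let $\mathcal O,\mathcal A,\mathcal S$ be finite non-empty sets, $H,m\ge 1$, $r=|\mathcal S|$. A model $\theta$ is a POMDP with horizon $H$, given by an initial state distribution, transition distributions $\mathbf T_{h,a}(\cdot\mid s)$ and emission distributions $\mathbf O_h(\cdot\mid s)$. Write $\tau_h=(o_1,a_1,\dots,o_h,a_h)$, $\mathbb P_\theta(\tau_h)=\mathbb P_\theta(o_1,\dots,o_h\mid a_1,\dots,a_h)$, $\pi(\tau_h)=\prod_{t\le h}\pi(a_t\mid\tau_{t-1},o_t)$, $\mathbb P^\pi_\theta(\tau_h)=\mathbb P_\theta(\tau_h)\pi(\tau_h)$, and $V^\pi_{\theta,f}=\sum_{\tau_H}\mathbb P^\pi_\theta(\tau_H)f(\tau_H)$. The $m$-step emission-action matrices of $\theta$ are $$[\mathbf G_h]_{(\mathbf a,\mathbf o),s}=\mathbb P_\theta\big(o_h,\dots,o_{\min\{h+m-1,H\}}=\mathbf o\mid s_h=s,\ a_h,\dots,a_{\min\{h+m-2,H\}}=\mathbf a\big),\qquad 1\le h\le H.$$ The rows of $\mathbf G_{h+1}$ are the core tests after $\tau_h$; $\psi(\tau_h)$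 is the vector of joint probabilities of $\tau_h$ and the core tests given the actions, and $\bar\psi(\tau_h)=\psi(\tau_h)/\mathbb P_\theta(\tau_h)$ is the prediction feature. Let $\mathcal Q_h^A=\mathcal A^{\min\{m-1,H-h\}}$, $Q_A=\max_{0\le h<H}|\mathcal Q^A_h|$ and $\mathcal Q^{\exp}_h=(\mathcal A\times\mathcal Q^A_{h+1})\cup\mathcal Q^A_h$. Let $\Theta$ be a set of models such that, for some $a>0$, $\min_{h\le H}\sigma_{|\mathcal S|}(\mathbf G_h)\ge a$ for every $\theta\in\Theta$; put $\gamma=a/(r+Q_A)$. The true model $\theta^*$ lies in $\Theta$, and all models in $\Theta$ have the same (known) initial feature $\psi_0$. A finite set $\bar\Theta$ of functions on trajectories is an $\varepsilon$-optimistic net of $\Theta$ if for each $\theta\in\Theta$ some $f\in\bar\Theta$ satisfies $f\ge\mathbb P_\theta$ and $\sum_{\tau_H}|f(\tau_H)-\mathbb P_\theta(\tau_H)|\,\pi(\tau_H)\le\varepsilon$ for every policy $\pi$. **Algorithm (PSR-UCB with reduced features).** Inputs $p_{\min},\beta,\lambda,\alpha,\epsilon$ and an iteration limit $K$; the initial policy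 $\pi^0$ is arbitrary. In iteration $k=1,\dots,K$, for each $h=0,\dots,H-1$ play one episode: follow $\pi^{k-1}$ for the first $h$ steps, then play an action sequence drawn uniformly from $\mathcal Q_h^{\exp}$, then complete the episode by an arbitrary fixed policy; add the trajectory, with the policy used, to the data set $\mathcal D_h^k$. Let $\Theta^k_{\min}$ be the set of $\theta\in\Theta$ with $\mathbb P_\theta^\pi(\tau_h)\ge p_{\min}$ for all $h$ and $(\tau_h,\pi)\in\mathcal D_h^k$, and choose any $\hat\theta^k\in\Theta_{\min}^k$ whose log-likelihood on all data is within $\beta$ of the supremum over $\Theta_{\min}^k$. Let $\hat{\mathbf G}_h^k$ be the emission-action matrices of $\hat\theta^k$ and $x^k(\tau_h)=(\hat{\mathbf G}^k_{h+1})^\dagger\bar{\hat\psi}^k(\tau_h)\in\mathbb R^r$, where $\bar{\hat\psi}^k$ is the prediction feature of $\hat\theta^k$. Put $$\hat U^k_h=\lambda I+\sum_{\tau_h\in\mathcal D^k_h}x^k(\tau_h)x^k(\tau_h)^\top,\qquad \hat b^k(\tau_H)=\min\Big\{\alpha\sqrt{\textstyle\sum_{h=0}^{H-1}\|x^k(\tau_h)\|^2_{(\hat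 U_h^k)^{-1}}},\,1\Big\},\qquad \pi^k\in\arg\max_\pi V^\pi_{\hat\theta^k,\hat b^k}.$$ If $V^{\pi^k}_{\hat\theta^k,\hat b^k}\le\epsilon/2$, terminate with the model $\theta^\epsilon=\hat\theta^k$; for a reward $R$ return $\bar\pi\in\arg\max_\pi V^\pi_{\theta^\epsilon,R}$. **Claim.** For every $\eta>0$ there are a constant $c\ge1$ and a polynomial $P$ in six variables, depending only on $\eta$, such that the following holds for all POMDP classes as above, all $0<\epsilon\le1$, $0<\delta<1$, $K$, and all executions of the algorithm. Suppose $0<p_{\min}\le\frac{\delta}{cKH|\mathcal O|^H|\mathcal A|^H}$, $0<\varepsilon\le\frac{p_{\min}}{cKH}$, $\beta\ge c\log\frac{K|\bar\Theta_\varepsilon|}{\delta}$ for some $\varepsilon$-optimistic net $\bar\Theta_\varepsilon$ of $\Theta$, $$\lambda=\frac{\gamma|\mathcal A|^2Q_A\beta\max\{\sqrt r,Q_A\sqrt H/\gamma\}}{\sqrt{rH}},\qquad \alpha=c\Big(\frac{Q_A\sqrt{Hr}}{\gamma^2}\sqrt\lambda+\frac{|\mathcal A|Q_A\sqrt\beta}{\gamma}\Big),$$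 and $K\ge P(r,1/\gamma,Q_A,H,|\mathcal A|,\beta)/\epsilon^2$. Then, with probability at least $1-\delta$, the algorithm terminates after at most $$\frac{P(r,1/\gamma,Q_A,H,|\mathcal A|,\beta)}{\epsilon^2}$$ episodes, and its output satisfies $\sum_{\tau_H}|\mathbb P^\pi_{\theta^\epsilon}(\tau_H)-\mathbb P^\pi_{\theta^*}(\tau_H)|\le(1+\eta)\epsilon$ for all policies $\pi$ and $\max_\pi V^\pi_{\theta^*,R}-V^{\bar\pi}_{\theta^*,R}\le(1+\eta)\epsilon$ for every reward $R$ with values in $[0,1]$. The bound does not depend on the number $d$ of core tests. -/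

import Mathlib

open scoped BigOperators Matrix

namespace PSRUCB

noncomputable section

/-- A finite-horizon POMDP with finite observation, action and state sets, i.e. a model `θ`.
Time steps are counted from `0`: at step `t` the latent state `s` emits `o` with probability
`emit t s o`, the agent plays `a`, and the state moves to `s'` with probability `trans t a s s'`.
Only the steps `t < H` matter for an episode of length `H`. -/
structure POMDP (O A S : Type*) [Fintype O] [Fintype S] where
  init : S → ℝ
  trans : ℕ → A → S → S → ℝ
  emit : ℕ → S → O → ℝ
  init_nonneg : ∀ s, 0 ≤ init s
  init_sum : ∑ s, init s = 1
  trans_nonneg : ∀ t a s s', 0 ≤ trans t a s s'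
  trans_sum : ∀ t a s, ∑ s', trans t a s s' = 1
  emit_nonneg : ∀ t s o, 0 ≤ emit t s o
  emit_sum : ∀ t s, ∑ o, emit t s o = 1

/-- A history-dependent randomized policy: `prob t τ o a` is the probability of playing `a` at
step `t` after the history `τ` of length `t` and the current observation `o`. -/
structure Policy (O A : Type*) [Fintype A] where
  prob : (t : ℕ) → (Fin t → O × A) → O → A → ℝ
  prob_nonneg : ∀ t τ o a, 0 ≤ prob t τ o a
  prob_sum : ∀ t τ o, ∑ a, prob t τ o a = 1

/-- Full trajectories `τ_H = (o_1, a_1, …, o_H, a_H)` of one episode. -/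
abbrev Traj (O A : Type*) (H : ℕ) := Fin H → O × A

/-- The data of the first `k` iterations: `D i h` is the trajectory that iteration `i` adds to the
data set with index `h`, for `h = 0, …, H - 1`. -/
abbrev Data (O A : Type*) (H k : ℕ) := Fin k → Fin H → Traj O A H

/-- The first `k` entries of a tuple. -/
def initial {X : Type*} {n : ℕ} (k : ℕ) (hk : k ≤ n) (x : Fin n → X) : Fin k → X :=
  fun i => x (Fin.castLE hk i)

/-- The entries strictly before index `t`; for a trajectory this is the history of length `t`. -/
def past {X : Type*} {n : ℕ} (x : Fin n → X) (t : Fin n) : Fin t.val → X :=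
  initial t.val t.isLt.le x

section Model

variable {O A S : Type*} [Fintype O] [Fintype A] [Fintype S]

/-- The joint probability of the observations of a history and of the latent state that follows
it, given the actions of the history. -/
def POMDP.forward (θ : POMDP O A S) : (n : ℕ) → (Fin n → O × A) → S → ℝ
  | 0, _ => θ.init
  | n + 1, τ => fun s' => ∑ s, θ.forward n (fun i => τ i.castSucc) s *
      θ.emit n s (τ (Fin.last n)).1 * θ.trans n (τ (Fin.last n)).2 s s'

/-- `ℙ_θ(o_1, …, o_n | a_1, …, a_n)`, the probability of the observations of a history given its
actions. -/
def POMDP.prob (θ : POMDP O A S) {n : ℕ} (τ : Fin n → O × A) : ℝ := ∑ s, θ.forward n τ s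

/-- The probability of observing the listed observations from step `t` on, when the state at step
`t` is `s` and the listed actions are played in between. An action that comes after the last
observation has no influence. -/
def POMDP.obsProb (θ : POMDP O A S) : ℕ → List O → List A → S → ℝ
  | _, [], _, _ => 1
  | t, [o], _, s => θ.emit t s o
  | t, o :: o' :: os, a :: as, s =>
      θ.emit t s o * ∑ s', θ.trans t a s s' * θ.obsProb (t + 1) (o' :: os) as s'
  | _, _ :: _ :: _, [], _ => 0

/-- The core tests after a history of length `t`: the next `m` observations and the `m - 1` actions
in between, cut off at the end of the episode. -/
abbrev CoreTest (O A : Type*) (m H t : ℕ) :=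
  (Fin (min m (H - t)) → O) × (Fin (min (m - 1) (H - t)) → A)

/-- The `m`-step emission-action matrix of step `t`. -/
def POMDP.emissionAction (θ : POMDP O A S) (m H t : ℕ) : Matrix (CoreTest O A m H t) S ℝ :=
  Matrix.of fun q s => θ.obsProb t (List.ofFn q.1) (List.ofFn q.2) s

/-- The smallest of the `|S|` singular values of a matrix with `|S|` columns (Mathlib counts
singular values from `0`, in decreasing order). -/
def sigmaMin {I : Type*} [Fintype I] [DecidableEq S] (G : Matrix I S ℝ) : ℝ :=
  (Matrix.toEuclideanLin G).singularValues (Fintype.card S - 1)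

/-- `m`-step decodability with constant `a`: `σ_{|S|}(G_h) ≥ a` for all steps of the episode. -/
def POMDP.IsDecodable [DecidableEq S] (θ : POMDP O A S) (m H : ℕ) (a : ℝ) : Prop :=
  ∀ t : Fin H, a ≤ sigmaMin (θ.emissionAction m H t)

/-- The feature `ψ(τ_h)`: its coordinate at a core test is the joint probability of the observations
of `τ_h` and of the core test, given the actions of both. -/
def POMDP.psi (θ : POMDP O A S) (m H h : ℕ) (τ : Fin h → O × A) : CoreTest O A m H h → ℝ :=
  fun q => ∑ s, θ.forward h τ s * θ.emissionAction m H h q s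

/-- The prediction feature: its coordinate at a core test is the conditional probability of the
core test given `τ_h`. -/
def POMDP.psiBar (θ : POMDP O A S) (m H h : ℕ) (τ : Fin h → O × A) : CoreTest O A m H h → ℝ :=
  fun q => θ.psi m H h τ q / θ.prob τ

/-- The Moore-Penrose inverse of a matrix of full column rank. -/
def pinv {I : Type*} [Fintype I] [DecidableEq S] (G : Matrix I S ℝ) : Matrix S I ℝ :=
  (Gᵀ * G)⁻¹ * Gᵀ

/-- The probability that a policy plays the actions of `τ` at the steps `t` with `i ≤ t < j`, given
the observations; for `i = 0` this is `π(τ_j)`. -/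
def Policy.weight {H : ℕ} (π : Policy O A) (i j : ℕ) (τ : Traj O A H) : ℝ :=
  ∏ t : Fin H with i ≤ t.val ∧ t.val < j, π.prob t (past τ t) (τ t).1 (τ t).2

/-- The value `V_{θ,f}^π`, the expectation of `f(τ_H)` under the model `θ` and the policy `π`. -/
def POMDP.value (θ : POMDP O A S) {H : ℕ} (π : Policy O A) (f : Traj O A H → ℝ) : ℝ :=
  ∑ τ : Traj O A H, θ.prob τ * π.weight 0 H τ * f τ

/-- `π` maximizes `V_{θ,f}` over all policies. -/
def POMDP.IsGreedy (θ : POMDP O A S) {H : ℕ} (f : Traj O A H → ℝ) (π : Policy O A) : Prop :=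
  ∀ π' : Policy O A, θ.value π' f ≤ θ.value π f

/-- The distance `∑_{τ_H} |ℙ_θ^π(τ_H) - ℙ_θ'^π(τ_H)|` (without the factor `1/2`). -/
def tvDist (H : ℕ) (θ θ' : POMDP O A S) (π : Policy O A) : ℝ :=
  ∑ τ : Traj O A H, |θ.prob τ * π.weight 0 H τ - θ'.prob τ * π.weight 0 H τ|

/-- A finite set of functions on trajectories is an `ε`-optimistic net of `Θ` if every `ℙ_θ` with
`θ ∈ Θ` lies pointwise below one of them whose distance to it is at most `ε` under every policy. -/
def IsOptimisticNet {H : ℕ} (Θ : Set (POMDP O A S)) (ε : ℝ) (N : Finset (Traj O A H → ℝ)) : Prop :=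
  ∀ θ ∈ Θ, ∃ f ∈ N, (∀ τ, θ.prob τ ≤ f τ) ∧
    ∀ π : Policy O A, ∑ τ, |f τ - θ.prob τ| * π.weight 0 H τ ≤ ε

end Model

section Exploration

variable {O : Type*} (A : Type*) [Fintype A] [DecidableEq A]

/-- The core action sequences `Q_h^A`. -/
def coreActs (m H h : ℕ) : Finset (List A) :=
  Finset.univ.image fun a : Fin (min (m - 1) (H - h)) → A => List.ofFn a

/-- The exploration action sequences `Q_h^exp = (A × Q_{h+1}^A) ∪ Q_h^A`. -/
def exploreActs (m H h : ℕ) : Finset (List A) :=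
  (Finset.univ ×ˢ coreActs A m H (h + 1)).image (fun p => p.1 :: p.2) ∪ coreActs A m H h

/-- `Q_A`, the largest number of core action sequences. -/
def coreActsMax (m H : ℕ) : ℕ := (Finset.range H).sup fun h => (coreActs A m H h).card

variable {A}

/-- The probability of the actions of `τ`, given the observations, under the exploration policy
`ν(π, u_{Q_h^exp})`: follow `π` during the first `h` steps, draw an action sequence uniformly from
`Q_h^exp` and play it, and complete the episode by `ρ` when the sequence is exhausted. -/
def exploreWeight {H : ℕ} (m : ℕ) (ρ π : Policy O A) (h : Fin H) (τ : Traj O A H) : ℝ :=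
  π.weight 0 h τ *
    ((∑ q ∈ exploreActs A m H h,
        if q <+: (List.ofFn fun t => (τ t).2).drop h then ρ.weight (h + q.length) H τ else 0) /
      (exploreActs A m H h).card)

end Exploration

/-- The choices that an execution of the algorithm makes, as functions of the data collected so
far: the estimated model and the policy after `k` iterations (for `k = 0` the policy is the initial
policy), and the policy that completes an episode after an exploration sequence. -/
structure Learner (O A S : Type*) [Fintype O] [Fintype A] [Fintype S] (H : ℕ) where
  model : (k : ℕ) → Data O A H k → POMDP O A S
  policy : (k : ℕ) → Data O A H k → Policy O A
  completion : Policy O A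

section Algorithm

variable {O A S : Type*} [Fintype O] [Fintype A] [Fintype S] [DecidableEq A] [DecidableEq S]
  {H : ℕ}

/-- The probability of the actions of the trajectory `D i h` under the policy that collected it. -/
def Learner.dataWeight (L : Learner O A S H) (m : ℕ) {k : ℕ} (D : Data O A H k) (i : Fin k)
    (h : Fin H) : ℝ :=
  exploreWeight m L.completion (L.policy i (past D i)) h (D i h)

/-- The likelihood of the data under the model `θ`. With `θ` the true model this is the law of the
data of the first `k` iterations. -/
def Learner.likelihood (L : Learner O A S H) (m : ℕ) (θ : POMDP O A S) {k : ℕ}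
    (D : Data O A H k) : ℝ :=
  ∏ i, ∏ h, θ.prob (D i h) * L.dataWeight m D i h

/-- `Θ_min^k`: the models under which every sampled history `τ_h` in the data set with index `h`
has probability at least `pmin`. -/
def Learner.stableModels (L : Learner O A S H) (Θ : Set (POMDP O A S)) (pmin : ℝ) {k : ℕ}
    (D : Data O A H k) : Set (POMDP O A S) :=
  {θ ∈ Θ | ∀ (i : Fin k) (h : Fin H),
    pmin ≤ θ.prob (past (D i h) h) * (L.policy i (past D i)).weight 0 h (D i h)}

/-- `B^k`: the models of `Θ_min^k` whose log-likelihood is within `β` of the supremum over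
`Θ_min^k`; written without logarithms, so that a vanishing likelihood counts as `-∞`. -/
def Learner.confidenceSet (L : Learner O A S H) (m : ℕ) (Θ : Set (POMDP O A S)) (pmin β : ℝ)
    {k : ℕ} (D : Data O A H k) : Set (POMDP O A S) :=
  {θ ∈ L.stableModels Θ pmin D | ∀ θ' ∈ L.stableModels Θ pmin D,
    Real.exp (-β) * L.likelihood m θ' D ≤ L.likelihood m θ D}

/-- The reduced feature `(G_{h+1})^† ψ̄(τ_h)` of the model `θ`, where `G` is its emission-action
matrix (steps are counted from `0` here). -/
def reducedFeature (m : ℕ) (θ : POMDP O A S) (h : Fin H) (τ : Traj O A H) : S → ℝ :=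
  pinv (θ.emissionAction m H h) *ᵥ θ.psiBar m H h (past τ h)

/-- The matrix `Û_h^k`, with the prediction features replaced by the reduced features. -/
def gram (m : ℕ) (lam : ℝ) (θ : POMDP O A S) {k : ℕ} (D : Data O A H k) (h : Fin H) :
    Matrix S S ℝ :=
  lam • (1 : Matrix S S ℝ) + ∑ i,
    Matrix.vecMulVec (reducedFeature m θ h (D i h)) (reducedFeature m θ h (D i h))

/-- The bonus `b̂^k(τ_H)`, with the prediction features replaced by the reduced features. -/
def bonus (m : ℕ) (lam α : ℝ) (θ : POMDP O A S) {k : ℕ} (D : Data O A H k)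
    (τ : Traj O A H) : ℝ :=
  min (α * √(∑ h : Fin H, reducedFeature m θ h τ ⬝ᵥ
    ((gram m lam θ D h)⁻¹ *ᵥ reducedFeature m θ h τ))) 1

/-- `L` makes its choices by the rules of PSR-UCB with reduced features, whatever the data: after
`k ≥ 1` iterations the estimated model is an element of `B^k` (an arbitrary element of `Θ` if `B^k`
is empty), and the policy maximizes the value of the bonus under the estimated model. -/
def Learner.IsPSRUCB (L : Learner O A S H) (m : ℕ) (Θ : Set (POMDP O A S))
    (pmin β lam α : ℝ) : Prop :=
  ∀ (k : ℕ) (D : Data O A H k), 1 ≤ k →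
    L.model k D ∈ Θ ∧
    ((L.confidenceSet m Θ pmin β D).Nonempty → L.model k D ∈ L.confidenceSet m Θ pmin β D) ∧
    (L.model k D).IsGreedy (bonus m lam α (L.model k D) D) (L.policy k D)

/-- The termination test of PSR-UCB after the `k`-th iteration. -/
def Learner.TestPasses (L : Learner O A S H) (m : ℕ) (lam α ε : ℝ) {k : ℕ}
    (D : Data O A H k) : Prop :=
  (L.model k D).value (L.policy k D) (bonus m lam α (L.model k D) D) ≤ ε / 2

/-- PSR-UCB terminates at iteration `k`, the first iteration whose test passes. -/
def Learner.TerminatesAt (L : Learner O A S H) (m : ℕ) (lam α ε : ℝ) {K : ℕ}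
    (D : Data O A H K) (k : ℕ) (hk : k ≤ K) : Prop :=
  1 ≤ k ∧ L.TestPasses m lam α ε (initial k hk D) ∧
    ∀ (j : ℕ) (hj : j < k), 1 ≤ j →
      ¬ L.TestPasses m lam α ε (initial j (hj.le.trans hk) D)

/-- The probability of an event about the data of `K` iterations when the true model is `θ`. (The
choice rules are run on after a termination; this does not change the law of what comes before.) -/
def Learner.runProb (L : Learner O A S H) (m : ℕ) (θ : POMDP O A S) {K : ℕ}
    (E : Set (Data O A H K)) : ℝ :=
  ∑ D : Data O A H K, E.indicator (L.likelihood m θ) D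

end Algorithm

end

end PSRUCB

open PSRUCB

/-!
# PSR-UCB with reduced features

After a history the latent state has a conditional law, the belief. Since the emission-action
matrix has full column rank, its Moore-Penrose inverse recovers the belief from the prediction
feature, so that the reduced features of a model are its beliefs: vectors of dimension `|S|` and
norm at most `1`, whatever the number of core tests. All norms `‖·‖_{U⁻¹}` below are those of
regularized second-moment matrices of beliefs.

*Accuracy.* Let `θ₁`, `θ₂` be two models. The matrix `transfer`, which is `pinv G₂ * G₁`, reads the
latent states of `θ₁` as latent states of `θ₂`. Telescoping over the steps bounds the distance of
the two laws of the trajectories by expected one-step errors, taken along the law of `θ₁`. A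
one-step error is a seminorm of the belief of `θ₁`. It is bounded by a multiple of the Euclidean
norm, and at the sampled histories by the distance `condTV` of the conditional laws that the two
models give to the exploration. Duality (`Supported.le_sqrt_mul_sqrt`) then bounds it by
`‖·‖_{U⁻¹}`, and this is the bonus. The bonus is clipped at `1`; correspondingly the telescoping
is stopped on the histories whose accumulated bonus has reached `1`, where the distance of the laws
is at most twice their mass (`tvDist_le_value_bonus`). The constant is `2 + 64 / c`, which makes the
accuracy at termination `(1 + η) ε` when `c` is large.

*Concentration.* The estimated model is close to the true one on the data
(`Learner.sum_sq_condTV_le`): for each member `f` of the net, square roots of likelihood ratios of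
`f` and the true model, divided by their conditional means, form a nonnegative supermartingale. The
conditional means are affinities of conditional laws, and these control squared distances. Only the
exploration parts of the trajectories enter, and the lower bound `pmin` on the probabilities of the
sampled histories makes the net fine enough after conditioning on them. A second supermartingale
(`Learner.sum_likelihood_mul_exp_le`) compares the sampled squared norms of the beliefs of the true
model with their conditional means. By the elliptical potential argument (`sum_invNormSq_le`) the
sampled squared norms have a sum that is logarithmic in the number of iterations, and the logarithm
is dominated by `β`.

*Termination.* Comparing the beliefs of the estimated model with those of the true one, again
through `transfer`, bounds the value of the bonus in an iteration by the conditional mean norms of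
the beliefs of the true model (`value_bonus_le`). By the Cauchy-Schwarz inequality the sum of these
values over `n` iterations is at most `√n` times a polynomial, so that one of the first
`poly / ε ^ 2` values is at most `ε / 2` (`Learner.exists_testPasses`).
-/

namespace PSRUCB

noncomputable section

set_option linter.unusedSectionVars false

/-! ### Norms, the smallest singular value and the pseudo-inverse -/

section LinearAlgebra

variable {S I : Type*} [Fintype S] [Fintype I]

lemma dotProduct_self_nonneg' (v : S → ℝ) : 0 ≤ v ⬝ᵥ v :=
  Finset.sum_nonneg fun _ _ => mul_self_nonneg _

lemma sq_dotProduct_le (v w : S → ℝ) : (v ⬝ᵥ w) ^ 2 ≤ (v ⬝ᵥ v) * (w ⬝ᵥ w) := by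
  have h := Finset.sum_mul_sq_le_sq_mul_sq Finset.univ v w
  simpa [dotProduct, sq] using h

lemma dotProduct_self_le_sq_sum_abs (v : S → ℝ) : v ⬝ᵥ v ≤ (∑ s, |v s|) ^ 2 := by
  have h : v ⬝ᵥ v = ∑ s, |v s| ^ 2 := by simp [dotProduct, sq]
  rw [h]
  exact Finset.sum_sq_le_sq_sum_of_nonneg fun s _ => abs_nonneg _

lemma sum_abs_le_sqrt (v : S → ℝ) : ∑ s, |v s| ≤ √(Fintype.card S) * √(v ⬝ᵥ v) := by
  rw [← Real.sqrt_mul (by positivity)]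
  apply Real.le_sqrt_of_sq_le
  have h := sq_sum_le_card_mul_sum_sq (s := (Finset.univ : Finset S)) (f := fun s => |v s|)
  simpa [dotProduct, sq] using h

/-- The quadratic form of `λ I + ∑ xᵢ xᵢᵀ`. -/
def quadForm {ι : Type*} (lam : ℝ) (s : Finset ι) (x : ι → S → ℝ) (w : S → ℝ) : ℝ :=
  lam * (w ⬝ᵥ w) + ∑ i ∈ s, (w ⬝ᵥ x i) ^ 2

lemma quadForm_nonneg {ι : Type*} {lam : ℝ} {s : Finset ι} {x : ι → S → ℝ}
    (hlam : 0 < lam) (w : S → ℝ) : 0 ≤ quadForm lam s x w := by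
  have := dotProduct_self_nonneg' w
  have h2 : 0 ≤ ∑ i ∈ s, (w ⬝ᵥ x i) ^ 2 := Finset.sum_nonneg fun _ _ => sq_nonneg _
  rw [quadForm]
  positivity

variable [DecidableEq S]

open Module in
/-- A lower bound on the smallest singular value bounds the matrix from below. -/
lemma sq_mul_dotProduct_le_of_sigmaMin [Nonempty S] {G : Matrix I S ℝ} {a : ℝ} (ha : 0 ≤ a)
    (h : a ≤ sigmaMin G) (x : S → ℝ) : a ^ 2 * (x ⬝ᵥ x) ≤ (G *ᵥ x) ⬝ᵥ (G *ᵥ x) := by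
  classical
  set T := Matrix.toEuclideanLin G with hT
  have hn : finrank ℝ (EuclideanSpace ℝ S) = Fintype.card S := by simp
  set y : EuclideanSpace ℝ S := WithLp.toLp 2 x with hy
  have hsym := T.isSymmetric_adjoint_comp_self
  set b := hsym.eigenvectorBasis hn with hb
  have h1 : inner ℝ ((LinearMap.adjoint T ∘ₗ T) y) y = (G *ᵥ x) ⬝ᵥ (G *ᵥ x) := by
    rw [LinearMap.comp_apply, LinearMap.adjoint_inner_left]
    simp [hT, hy, dotProduct, EuclideanSpace.norm_sq_eq, ← sq]
  have h2 : inner ℝ y y = x ⬝ᵥ x := by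
    simp [hy, dotProduct, EuclideanSpace.norm_sq_eq, ← sq]
  rw [← h1, ← h2, ← b.sum_inner_mul_inner y y, ← b.sum_inner_mul_inner _ y, Finset.mul_sum]
  refine Finset.sum_le_sum fun i _ => ?_
  have h3 : inner ℝ ((LinearMap.adjoint T ∘ₗ T) y) (b i)
      = hsym.eigenvalues hn i * inner ℝ y (b i) := by
    rw [hsym y (b i), hb, hsym.apply_eigenvectorBasis hn i, inner_smul_right]
    simp
  rw [h3, ← T.sq_singularValues_fin hn i]
  have h4 : a ≤ T.singularValues i := h.trans (T.singularValues_antitone (by omega))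
  have h5 : inner ℝ y (b i) = inner ℝ (b i) y := real_inner_comm _ _
  rw [h5, mul_assoc]
  exact mul_le_mul_of_nonneg_right (pow_le_pow_left₀ ha h4 2) (mul_self_nonneg _)

lemma pinv_mul_self [Nonempty S] {G : Matrix I S ℝ} {a : ℝ} (ha : 0 < a) (h : a ≤ sigmaMin G) :
    pinv G * G = 1 := by
  have hdet : IsUnit (Gᵀ * G).det := by
    rw [← Matrix.isUnit_iff_isUnit_det, ← Matrix.mulVec_injective_iff_isUnit]
    rw [← Matrix.coe_mulVecLin, injective_iff_map_eq_zero]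
    intro x hx
    have h1 := sq_mul_dotProduct_le_of_sigmaMin ha.le h x
    have h2 : (G *ᵥ x) ⬝ᵥ (G *ᵥ x) = 0 := by
      rw [Matrix.mulVecLin_apply, ← Matrix.mulVec_mulVec] at hx
      rw [Matrix.dotProduct_mulVec, ← Matrix.mulVec_transpose, hx, zero_dotProduct]
    have h3 := dotProduct_self_nonneg' x
    have h4 : 0 < a ^ 2 := by positivity
    have h5 : x ⬝ᵥ x = 0 := by nlinarith
    exact dotProduct_self_eq_zero.mp h5
  rw [pinv, Matrix.mul_assoc, Matrix.nonsing_inv_mul _ hdet]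

lemma sq_mul_pinv_le [Nonempty S] {G : Matrix I S ℝ} {a : ℝ} (ha : 0 < a) (h : a ≤ sigmaMin G)
    (v : I → ℝ) : a ^ 2 * ((pinv G *ᵥ v) ⬝ᵥ (pinv G *ᵥ v)) ≤ v ⬝ᵥ v := by
  set u := pinv G *ᵥ v with hu
  have h1 := sq_mul_dotProduct_le_of_sigmaMin ha.le h u
  refine h1.trans ?_
  have hG := pinv_mul_self ha h
  -- `G u` is the orthogonal projection of `v` to the range of `G`
  have h2 : (Gᵀ * G) *ᵥ u = Gᵀ *ᵥ v := by
    have hdet : IsUnit (Gᵀ * G).det := by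
      rw [pinv, Matrix.mul_assoc] at hG
      exact Matrix.isUnit_det_of_left_inverse hG
    rw [hu, pinv, Matrix.mulVec_mulVec, ← Matrix.mul_assoc, Matrix.mul_nonsing_inv _ hdet,
      Matrix.one_mul]
  have h3 : (G *ᵥ u) ⬝ᵥ (G *ᵥ u) = (G *ᵥ u) ⬝ᵥ v := by
    have e1 : (G *ᵥ u) ⬝ᵥ (G *ᵥ u) = ((Gᵀ * G) *ᵥ u) ⬝ᵥ u := by
      rw [Matrix.dotProduct_mulVec, ← Matrix.mulVec_transpose, Matrix.mulVec_mulVec]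
    have e2 : (G *ᵥ u) ⬝ᵥ v = (Gᵀ *ᵥ v) ⬝ᵥ u := by
      rw [dotProduct_comm, Matrix.dotProduct_mulVec, ← Matrix.mulVec_transpose]
    rw [e1, h2, e2]
  have h4 := sq_dotProduct_le (G *ᵥ u) v
  rw [← h3] at h4
  have h5 := dotProduct_self_nonneg' (G *ᵥ u)
  have h6 := dotProduct_self_nonneg' v
  by_contra hlt
  push Not at hlt
  nlinarith

/-- The pseudo-inverse is bounded from the `1`-norm to the `1`-norm. -/
lemma sum_abs_pinv_le [Nonempty S] {G : Matrix I S ℝ} {a : ℝ} (ha : 0 < a) (h : a ≤ sigmaMin G)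
    (v : I → ℝ) : ∑ s, |(pinv G *ᵥ v) s| ≤ √(Fintype.card S) / a * ∑ i, |v i| := by
  have h1 := sum_abs_le_sqrt (pinv G *ᵥ v)
  have h2 := sq_mul_pinv_le ha h v
  have h3 := dotProduct_self_le_sq_sum_abs v
  have h0 : 0 ≤ ∑ i, |v i| := Finset.sum_nonneg fun _ _ => abs_nonneg _
  have h4 : √((pinv G *ᵥ v) ⬝ᵥ (pinv G *ᵥ v)) ≤ (∑ i, |v i|) / a := by
    apply Real.sqrt_le_iff.mpr ⟨by positivity, ?_⟩
    rw [div_pow, le_div_iff₀ (by positivity)]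
    linarith
  calc _ ≤ _ := h1
    _ ≤ √(Fintype.card S) * ((∑ i, |v i|) / a) := by gcongr
    _ = _ := by ring

/-! ### Regularized second-moment matrices -/

variable {ι : Type*}

/-- The regularized second-moment matrix `λ I + ∑ xᵢ xᵢᵀ`. -/
def momentMatrix (lam : ℝ) (s : Finset ι) (x : ι → S → ℝ) : Matrix S S ℝ :=
  lam • (1 : Matrix S S ℝ) + ∑ i ∈ s, Matrix.vecMulVec (x i) (x i)

/-- The squared norm `‖v‖²_{U⁻¹}` for `U = λ I + ∑ xᵢ xᵢᵀ`. -/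
def invNormSq (lam : ℝ) (s : Finset ι) (x : ι → S → ℝ) (v : S → ℝ) : ℝ :=
  v ⬝ᵥ ((momentMatrix lam s x)⁻¹ *ᵥ v)

variable {lam : ℝ} {s : Finset ι} {x : ι → S → ℝ}

lemma momentMatrix_mulVec (w : S → ℝ) :
    momentMatrix lam s x *ᵥ w = lam • w + ∑ i ∈ s, (x i ⬝ᵥ w) • x i := by
  rw [momentMatrix, Matrix.add_mulVec, Matrix.smul_mulVec, Matrix.one_mulVec, Matrix.sum_mulVec]
  congr 1
  refine Finset.sum_congr rfl fun i _ => ?_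
  rw [Matrix.vecMulVec_mulVec]
  simp

lemma dotProduct_momentMatrix_mulVec (v w : S → ℝ) :
    v ⬝ᵥ (momentMatrix lam s x *ᵥ w)
      = lam * (v ⬝ᵥ w) + ∑ i ∈ s, (v ⬝ᵥ x i) * (w ⬝ᵥ x i) := by
  rw [momentMatrix_mulVec, dotProduct_add, dotProduct_smul, dotProduct_sum, smul_eq_mul]
  congr 1
  refine Finset.sum_congr rfl fun i _ => ?_
  rw [dotProduct_smul, smul_eq_mul, dotProduct_comm (x i) w, mul_comm]

lemma posDef_momentMatrix (hlam : 0 < lam) : (momentMatrix lam s x).PosDef := by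
  refine Matrix.PosDef.of_dotProduct_mulVec_pos ?_ ?_
  · ext a b
    simp [momentMatrix, Matrix.sum_apply, Matrix.vecMulVec_apply, Matrix.one_apply, mul_comm,
      eq_comm]
  · intro v hv
    rw [star_trivial, dotProduct_momentMatrix_mulVec]
    have h1 : 0 < v ⬝ᵥ v :=
      lt_of_le_of_ne (dotProduct_self_nonneg' v) fun h => hv (dotProduct_self_eq_zero.mp h.symm)
    have h2 : 0 ≤ ∑ i ∈ s, (v ⬝ᵥ x i) * (v ⬝ᵥ x i) :=
      Finset.sum_nonneg fun _ _ => mul_self_nonneg _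
    positivity

lemma isUnit_det_momentMatrix (hlam : 0 < lam) : IsUnit (momentMatrix lam s x).det :=
  (posDef_momentMatrix hlam).det_pos.ne'.isUnit

lemma dotProduct_momentMatrix_self (w : S → ℝ) :
    w ⬝ᵥ (momentMatrix lam s x *ᵥ w) = quadForm lam s x w := by
  rw [dotProduct_momentMatrix_mulVec, quadForm]
  simp [sq]

lemma quadForm_inv (hlam : 0 < lam) (v : S → ℝ) :
    quadForm lam s x ((momentMatrix lam s x)⁻¹ *ᵥ v) = invNormSq lam s x v := by
  rw [← dotProduct_momentMatrix_self, Matrix.mulVec_mulVec,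
    Matrix.mul_nonsing_inv _ (isUnit_det_momentMatrix hlam), Matrix.one_mulVec, invNormSq,
    dotProduct_comm]

lemma invNormSq_nonneg (hlam : 0 < lam) (v : S → ℝ) : 0 ≤ invNormSq lam s x v := by
  rw [← quadForm_inv hlam]
  exact quadForm_nonneg hlam _

/-- The Cauchy-Schwarz inequality for the dual pair of norms `‖·‖_U` and `‖·‖_{U⁻¹}`. -/
lemma sq_dotProduct_le_invNormSq (hlam : 0 < lam) (w v : S → ℝ) :
    (w ⬝ᵥ v) ^ 2 ≤ invNormSq lam s x v * quadForm lam s x w := by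
  set u := (momentMatrix lam s x)⁻¹ *ᵥ v with hu
  have hv : v = momentMatrix lam s x *ᵥ u := by
    rw [hu, Matrix.mulVec_mulVec, Matrix.mul_nonsing_inv _ (isUnit_det_momentMatrix hlam),
      Matrix.one_mulVec]
  have h : ∀ t : ℝ, 0 ≤ quadForm lam s x w * (t * t) + (2 * (w ⬝ᵥ v)) * t
      + invNormSq lam s x v := by
    intro t
    have h0 := quadForm_nonneg (s := s) (x := x) hlam (t • w + u)
    have h1 : quadForm lam s x (t • w + u) = quadForm lam s x w * (t * t)
        + (2 * (w ⬝ᵥ v)) * t + invNormSq lam s x v := by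
      rw [← quadForm_inv hlam v, ← hu]
      conv_rhs => rw [hv, dotProduct_momentMatrix_mulVec]
      simp only [quadForm, add_dotProduct, dotProduct_add, smul_dotProduct, dotProduct_smul,
        smul_eq_mul, dotProduct_comm u w]
      have e : ∑ i ∈ s, (t * (w ⬝ᵥ x i) + u ⬝ᵥ x i) ^ 2
          = t * t * ∑ i ∈ s, (w ⬝ᵥ x i) ^ 2 + 2 * t * ∑ i ∈ s, (w ⬝ᵥ x i) * (u ⬝ᵥ x i)
            + ∑ i ∈ s, (u ⬝ᵥ x i) ^ 2 := by
        rw [Finset.mul_sum, Finset.mul_sum, ← Finset.sum_add_distrib, ← Finset.sum_add_distrib]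
        exact Finset.sum_congr rfl fun i _ => by ring
      rw [e]
      ring
    linarith
  have := discrim_le_zero h
  rw [discrim] at this
  nlinarith

/-- The norm `‖·‖_{U⁻¹}` is the smallest one for which the Cauchy-Schwarz inequality holds. -/
lemma invNormSq_le (hlam : 0 < lam) {v : S → ℝ} {B : ℝ} (hB : 0 ≤ B)
    (h : ∀ w, (w ⬝ᵥ v) ^ 2 ≤ B * quadForm lam s x w) : invNormSq lam s x v ≤ B := by
  have h1 := h ((momentMatrix lam s x)⁻¹ *ᵥ v)
  rw [quadForm_inv hlam, dotProduct_comm, ← invNormSq] at h1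
  have h2 := invNormSq_nonneg (s := s) (x := x) hlam v
  by_contra hlt
  push Not at hlt
  nlinarith

lemma invNormSq_le_div (hlam : 0 < lam) (v : S → ℝ) : invNormSq lam s x v ≤ (v ⬝ᵥ v) / lam := by
  refine invNormSq_le hlam (div_nonneg (dotProduct_self_nonneg' v) hlam.le) fun w => ?_
  have h1 := sq_dotProduct_le w v
  have h2 : 0 ≤ ∑ i ∈ s, (w ⬝ᵥ x i) ^ 2 := Finset.sum_nonneg fun _ _ => sq_nonneg _
  have h3 : 0 ≤ (v ⬝ᵥ v) / lam := div_nonneg (dotProduct_self_nonneg' v) hlam.le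
  calc (w ⬝ᵥ v) ^ 2 ≤ (v ⬝ᵥ v) / lam * (lam * (w ⬝ᵥ w)) := by
        rw [← mul_assoc, div_mul_cancel₀ _ hlam.ne']
        linarith [mul_comm (w ⬝ᵥ w) (v ⬝ᵥ v)]
    _ ≤ _ := by
        rw [quadForm]
        gcongr
        linarith

lemma sqrt_invNormSq_add_le (hlam : 0 < lam) (u v : S → ℝ) :
    √(invNormSq lam s x (u + v)) ≤ √(invNormSq lam s x u) + √(invNormSq lam s x v) := by
  apply Real.sqrt_le_iff.mpr ⟨by positivity, ?_⟩
  refine invNormSq_le hlam (by positivity) fun w => ?_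
  have hq := quadForm_nonneg (s := s) (x := x) hlam w
  have key : ∀ z, |w ⬝ᵥ z| ≤ √(invNormSq lam s x z) * √(quadForm lam s x w) := by
    intro z
    rw [← Real.sqrt_mul (invNormSq_nonneg hlam z)]
    exact Real.abs_le_sqrt (sq_dotProduct_le_invNormSq hlam w z)
  have h1 : |w ⬝ᵥ (u + v)| ≤ (√(invNormSq lam s x u) + √(invNormSq lam s x v))
      * √(quadForm lam s x w) := by
    rw [dotProduct_add, add_mul]
    exact (abs_add_le _ _).trans (add_le_add (key u) (key v))
  calc (w ⬝ᵥ (u + v)) ^ 2 = |w ⬝ᵥ (u + v)| ^ 2 := (sq_abs _).symm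
    _ ≤ ((√(invNormSq lam s x u) + √(invNormSq lam s x v)) * √(quadForm lam s x w)) ^ 2 := by
        gcongr
    _ = _ := by rw [mul_pow, Real.sq_sqrt hq]

/-- Comparison of the norms that come from the vectors `xᵢ` and from perturbations of their images
under a linear map. -/
lemma invNormSq_mulVec_le (hlam : 0 < lam) {x' : ι → S → ℝ} (W : Matrix S S ℝ) {C E : ℝ}
    (hC : 0 ≤ C) (hW : ∀ v, (W *ᵥ v) ⬝ᵥ (W *ᵥ v) ≤ C * (v ⬝ᵥ v))
    (hE : ∑ i ∈ s, (x' i - W *ᵥ x i) ⬝ᵥ (x' i - W *ᵥ x i) ≤ E) (v : S → ℝ) :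
    invNormSq lam s x' (W *ᵥ v) ≤ (2 + C + 2 * E / lam) * invNormSq lam s x v := by
  have hy := invNormSq_nonneg (s := s) (x := x) hlam v
  have hE0 : 0 ≤ E := (Finset.sum_nonneg fun i _ => dotProduct_self_nonneg' _).trans hE
  refine invNormSq_le hlam (by positivity) fun w => ?_
  set u := Wᵀ *ᵥ w with hu
  have e : ∀ z, w ⬝ᵥ (W *ᵥ z) = u ⬝ᵥ z := fun z => by
    rw [Matrix.dotProduct_mulVec, ← Matrix.mulVec_transpose]
  rw [e]
  have hww := dotProduct_self_nonneg' w
  have h1 : u ⬝ᵥ u ≤ C * (w ⬝ᵥ w) := by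
    have a1 : (u ⬝ᵥ u) ^ 2 ≤ (w ⬝ᵥ w) * (C * (u ⬝ᵥ u)) := by
      conv_lhs => rw [← e u]
      refine (sq_dotProduct_le _ _).trans ?_
      exact mul_le_mul_of_nonneg_left (hW u) hww
    have a2 := dotProduct_self_nonneg' u
    by_contra hlt
    push Not at hlt
    have : 0 ≤ C * (w ⬝ᵥ w) := by positivity
    nlinarith
  have h2 : quadForm lam s x u ≤ (2 + C + 2 * E / lam) * quadForm lam s x' w := by
    have b1 : ∀ i ∈ s, (u ⬝ᵥ x i) ^ 2 ≤ 2 * (w ⬝ᵥ x' i) ^ 2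
        + 2 * ((w ⬝ᵥ w) * ((x' i - W *ᵥ x i) ⬝ᵥ (x' i - W *ᵥ x i))) := by
      intro i _
      have c1 := sq_dotProduct_le w (x' i - W *ᵥ x i)
      have c2 : u ⬝ᵥ x i = w ⬝ᵥ x' i - w ⬝ᵥ (x' i - W *ᵥ x i) := by
        rw [dotProduct_sub, e]
        ring
      rw [c2]
      nlinarith [sq_nonneg (w ⬝ᵥ x' i + w ⬝ᵥ (x' i - W *ᵥ x i))]
    have b2 := Finset.sum_le_sum b1
    rw [Finset.sum_add_distrib, ← Finset.mul_sum, ← Finset.mul_sum, ← Finset.mul_sum] at b2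
    have b3 : (w ⬝ᵥ w) * ∑ i ∈ s, (x' i - W *ᵥ x i) ⬝ᵥ (x' i - W *ᵥ x i) ≤ (w ⬝ᵥ w) * E :=
      mul_le_mul_of_nonneg_left hE hww
    have b4 : 0 ≤ ∑ i ∈ s, (w ⬝ᵥ x' i) ^ 2 := Finset.sum_nonneg fun _ _ => sq_nonneg _
    have b5 : (2 + C + 2 * E / lam) * quadForm lam s x' w
        = 2 * lam * (w ⬝ᵥ w) + C * lam * (w ⬝ᵥ w) + 2 * E * (w ⬝ᵥ w)
          + 2 * ∑ i ∈ s, (w ⬝ᵥ x' i) ^ 2 + (C + 2 * E / lam) * ∑ i ∈ s, (w ⬝ᵥ x' i) ^ 2 := by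
      rw [quadForm]
      field_simp
      ring
    have b6 : 0 ≤ (C + 2 * E / lam) * ∑ i ∈ s, (w ⬝ᵥ x' i) ^ 2 := by positivity
    have b7 : 0 ≤ 2 * lam * (w ⬝ᵥ w) := by positivity
    rw [b5, quadForm]
    nlinarith
  calc (u ⬝ᵥ v) ^ 2 ≤ invNormSq lam s x v * quadForm lam s x u :=
        sq_dotProduct_le_invNormSq hlam u v
    _ ≤ invNormSq lam s x v * ((2 + C + 2 * E / lam) * quadForm lam s x' w) := by gcongr
    _ = _ := by ring

/-- The matrix determinant lemma for a rank-one update of a second-moment matrix. -/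
lemma det_momentMatrix_insert [DecidableEq ι] (hlam : 0 < lam) {i : ι} (hi : i ∉ s) :
    (momentMatrix lam (insert i s) x).det
      = (momentMatrix lam s x).det * (1 + invNormSq lam s x (x i)) := by
  have h1 : momentMatrix lam (insert i s) x = momentMatrix lam s x
      + Matrix.replicateCol Unit (x i) * Matrix.replicateRow Unit (x i) := by
    rw [momentMatrix, Finset.sum_insert hi, momentMatrix, ← Matrix.vecMulVec_eq]
    abel
  rw [h1, Matrix.det_add_mul _ _ (isUnit_det_momentMatrix hlam), Matrix.det_unique (n := Unit)]
  congr 1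
  rw [Matrix.add_apply, Matrix.one_apply_eq, invNormSq, Matrix.dotProduct_mulVec]
  simp [Matrix.mul_apply, Matrix.vecMul, dotProduct]

lemma det_momentMatrix_le [Nonempty S] (hlam : 0 < lam) (hx : ∀ i ∈ s, x i ⬝ᵥ x i ≤ 1) :
    (momentMatrix lam s x).det ≤ (lam * Fintype.card S + s.card) ^ Fintype.card S := by
  have hpd := posDef_momentMatrix (s := s) (x := x) hlam
  have htr : (momentMatrix lam s x).trace ≤ lam * Fintype.card S + s.card := by
    rw [momentMatrix, Matrix.trace_add, Matrix.trace_smul, Matrix.trace_one, Matrix.trace_sum,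
      smul_eq_mul]
    gcongr
    calc ∑ i ∈ s, (Matrix.vecMulVec (x i) (x i)).trace ≤ ∑ i ∈ s, (1 : ℝ) :=
          Finset.sum_le_sum fun i hi => by rw [Matrix.trace_vecMulVec]; exact hx i hi
      _ = s.card := by simp
  rw [hpd.isHermitian.det_eq_prod_eigenvalues, ← Finset.card_univ, ← Finset.prod_const]
  refine Finset.prod_le_prod (fun j _ => (hpd.eigenvalues_pos j).le) fun j _ => ?_
  refine le_trans ?_ htr
  rw [hpd.isHermitian.trace_eq_sum_eigenvalues]
  exact Finset.single_le_sum (f := fun j => hpd.isHermitian.eigenvalues j)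
    (fun j _ => (hpd.eigenvalues_pos j).le) (Finset.mem_univ j)

lemma sum_log_invNormSq_eq (hlam : 0 < lam) (y : ℕ → S → ℝ) (n : ℕ) :
    ∑ k ∈ Finset.range n, Real.log (1 + invNormSq lam (Finset.range k) y (y k))
      = Real.log (momentMatrix lam (Finset.range n) y).det
        - Fintype.card S * Real.log lam := by
  induction n with
  | zero => simp [momentMatrix, Real.log_pow]
  | succ n ih =>
    rw [Finset.sum_range_succ, ih, Finset.range_add_one,
      det_momentMatrix_insert hlam Finset.notMem_range_self,
      Real.log_mul (posDef_momentMatrix hlam).det_pos.ne']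
    · ring
    · have := invNormSq_nonneg (s := Finset.range n) (x := y) hlam (y n)
      positivity

/-- The elliptical potential lemma. -/
lemma sum_invNormSq_le [Nonempty S] (hlam : 0 < lam) (y : ℕ → S → ℝ)
    (hy : ∀ k, y k ⬝ᵥ y k ≤ 1) (n : ℕ) :
    ∑ k ∈ Finset.range n, invNormSq lam (Finset.range k) y (y k)
      ≤ (1 + 1 / lam) * (Fintype.card S * Real.log (Fintype.card S + n / lam)) := by
  have hr : 0 < (Fintype.card S : ℝ) := by exact_mod_cast Fintype.card_pos
  have h1 : ∀ k ∈ Finset.range n, invNormSq lam (Finset.range k) y (y k)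
      ≤ (1 + 1 / lam) * Real.log (1 + invNormSq lam (Finset.range k) y (y k)) := by
    intro k _
    set q := invNormSq lam (Finset.range k) y (y k)
    have hq : 0 ≤ q := invNormSq_nonneg hlam _
    have hq1 : q ≤ 1 / lam := (invNormSq_le_div hlam _).trans (by gcongr; exact hy k)
    have h2 := Real.one_sub_inv_le_log_of_pos (show 0 < 1 + q by positivity)
    have h3 : 1 - (1 + q)⁻¹ = q / (1 + q) := by field_simp; ring
    rw [h3] at h2
    calc q = (1 + q) * (q / (1 + q)) := by field_simp
      _ ≤ (1 + 1 / lam) * Real.log (1 + q) := by gcongr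
  refine (Finset.sum_le_sum h1).trans ?_
  rw [← Finset.mul_sum, sum_log_invNormSq_eq hlam]
  gcongr
  have h4 := det_momentMatrix_le (s := Finset.range n) hlam fun k _ => hy k
  rw [Finset.card_range] at h4
  have h5 := Real.log_le_log (posDef_momentMatrix hlam).det_pos h4
  have h6 : lam * Fintype.card S + n = lam * (Fintype.card S + n / lam) := by field_simp
  rw [h6, Real.log_pow, Real.log_mul hlam.ne' (by positivity)] at h5
  linarith

end LinearAlgebra

/-! ### Histories, their extensions and the sums over trajectories -/

section Histories

variable {X : Type*} {n : ℕ}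

/-- The history `τ` followed by one further entry. -/
def extend (τ : Fin n → X) (x : X) : Fin (n + 1) → X := Fin.snoc (α := fun _ => X) τ x

@[simp] lemma extend_castSucc (τ : Fin n → X) (x : X) (i : Fin n) :
    extend τ x i.castSucc = τ i := by simp [extend]

@[simp] lemma extend_last (τ : Fin n → X) (x : X) : extend τ x (Fin.last n) = x := by
  simp [extend]

lemma initial_extend (τ : Fin n → X) (x : X) {j : ℕ} (hj : j ≤ n) (hj' : j ≤ n + 1) :
    initial j hj' (extend τ x) = initial j hj τ := by
  funext i
  exact extend_castSucc τ x (Fin.castLE hj i)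

lemma past_extend_castSucc (τ : Fin n → X) (x : X) (t : Fin n) :
    past (extend τ x) t.castSucc = past τ t :=
  initial_extend τ x t.isLt.le _

lemma past_extend_last (τ : Fin n → X) (x : X) : past (extend τ x) (Fin.last n) = τ := by
  have h := initial_extend τ x le_rfl (Nat.le_succ n)
  exact h

lemma initial_self (τ : Fin n → X) : initial n le_rfl τ = τ := rfl

lemma extend_initial (τ : Fin n → X) {j : ℕ} (hj : j < n) :
    extend (initial j hj.le τ) (τ ⟨j, hj⟩) = initial (j + 1) hj τ := by
  funext i
  refine Fin.lastCases ?_ (fun i => ?_) i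
  · rw [extend_last]; rfl
  · rw [extend_castSucc]; rfl

lemma sum_extend [Fintype X] (f : (Fin (n + 1) → X) → ℝ) :
    ∑ τ, f τ = ∑ τ : Fin n → X, ∑ x, f (extend τ x) := by
  rw [← (Fin.snocEquiv fun _ => X).sum_comp f, Fintype.sum_prod_type, Finset.sum_comm]
  rfl

open Classical in
/-- The tuples of length `H` that start with `σ`. -/
def fiber [Fintype X] {t H : ℕ} (ht : t ≤ H) (σ : Fin t → X) : Finset (Fin H → X) :=
  Finset.univ.filter fun τ => initial t ht τ = σ

lemma mem_fiber [Fintype X] {t H : ℕ} {ht : t ≤ H} {σ : Fin t → X} {τ : Fin H → X} :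
    τ ∈ fiber ht σ ↔ initial t ht τ = σ := by simp [fiber]

lemma sum_fiber [Fintype X] {t H : ℕ} (ht : t ≤ H) (f : (Fin H → X) → ℝ) :
    ∑ τ, f τ = ∑ σ : Fin t → X, ∑ τ ∈ fiber ht σ, f τ := by
  classical
  rw [← Finset.sum_fiberwise Finset.univ (fun τ => initial t ht τ) f]
  refine Finset.sum_congr rfl fun σ _ => Finset.sum_congr ?_ fun _ _ => rfl
  ext τ
  simp [mem_fiber]

lemma sum_fiber_step [Fintype X] {t H : ℕ} (ht : t < H) (σ : Fin t → X)
    (f : (Fin H → X) → ℝ) :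
    ∑ τ ∈ fiber ht.le σ, f τ = ∑ x, ∑ τ ∈ fiber (t := t + 1) ht (extend σ x), f τ := by
  classical
  rw [← Finset.sum_fiberwise (fiber ht.le σ) (fun τ => τ ⟨t, ht⟩) f]
  refine Finset.sum_congr rfl fun x _ => Finset.sum_congr ?_ fun _ _ => rfl
  ext τ
  rw [Finset.mem_filter, mem_fiber, mem_fiber, ← extend_initial τ ht]
  constructor
  · rintro ⟨h1, h2⟩
    rw [h1, h2]
  · intro h
    constructor
    · have := congrArg (fun g => initial t (Nat.le_succ t) g) h
      simpa [initial_extend _ _ le_rfl, initial_self] using this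
    · have := congrFun h (Fin.last t)
      simpa using this

lemma fiber_self [Fintype X] {H : ℕ} (σ : Fin H → X) : fiber le_rfl σ = {σ} := by
  ext τ
  rw [mem_fiber, Finset.mem_singleton, initial_self]

end Histories

section Dynamics

variable {O A S : Type*} [Fintype O] [Fintype A] [Fintype S]

/-- One step of the forward recursion: the update of the unnormalized law of the latent state by
an observation and an action. -/
def POMDP.step (θ : POMDP O A S) (t : ℕ) (x : O × A) (v : S → ℝ) : S → ℝ :=
  fun s' => ∑ s, v s * θ.emit t s x.1 * θ.trans t x.2 s s'

variable (θ : POMDP O A S)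

lemma POMDP.forward_extend {n : ℕ} (τ : Fin n → O × A) (x : O × A) :
    θ.forward (n + 1) (extend τ x) = θ.step n x (θ.forward n τ) := by
  funext s'
  simp [POMDP.forward, POMDP.step]

lemma POMDP.forward_nonneg {n : ℕ} (τ : Fin n → O × A) (s : S) : 0 ≤ θ.forward n τ s := by
  induction n generalizing s with
  | zero => exact θ.init_nonneg s
  | succ n ih =>
    exact Finset.sum_nonneg fun s _ =>
      mul_nonneg (mul_nonneg (ih _ s) (θ.emit_nonneg _ _ _)) (θ.trans_nonneg _ _ _ _)

lemma POMDP.prob_nonneg {n : ℕ} (τ : Fin n → O × A) : 0 ≤ θ.prob τ :=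
  Finset.sum_nonneg fun s _ => θ.forward_nonneg τ s

lemma POMDP.prob_zero (τ : Fin 0 → O × A) : θ.prob τ = 1 := θ.init_sum

lemma POMDP.sum_step (t : ℕ) (x : O × A) (v : S → ℝ) :
    ∑ s', θ.step t x v s' = ∑ s, v s * θ.emit t s x.1 := by
  simp only [POMDP.step]
  rw [Finset.sum_comm]
  exact Finset.sum_congr rfl fun s _ => by rw [← Finset.mul_sum, θ.trans_sum, mul_one]

lemma POMDP.prob_extend {n : ℕ} (τ : Fin n → O × A) (x : O × A) :
    θ.prob (extend τ x) = ∑ s', θ.step n x (θ.forward n τ) s' := by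
  rw [POMDP.prob, θ.forward_extend]

lemma POMDP.step_sub (t : ℕ) (x : O × A) (v w : S → ℝ) :
    θ.step t x (v - w) = θ.step t x v - θ.step t x w := by
  funext s'
  simp [POMDP.step, sub_mul]

lemma sum_mul_sum_emit {p : O → A → ℝ} (hp : ∀ o, ∑ a, p o a = 1) (t : ℕ) (v : S → ℝ) :
    ∑ x : O × A, p x.1 x.2 * ∑ s, v s * θ.emit t s x.1 = ∑ s, v s := by
  rw [Fintype.sum_prod_type]
  have h1 : ∀ o, ∑ a, p o a * ∑ s, v s * θ.emit t s o = ∑ s, v s * θ.emit t s o := fun o => by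
    rw [← Finset.sum_mul, hp, one_mul]
  simp only [h1]
  rw [Finset.sum_comm]
  exact Finset.sum_congr rfl fun s _ => by rw [← Finset.mul_sum, θ.emit_sum, mul_one]

lemma POMDP.sum_mul_sum_step {p : O → A → ℝ} (hp : ∀ o, ∑ a, p o a = 1) (t : ℕ) (v : S → ℝ) :
    ∑ x : O × A, p x.1 x.2 * ∑ s', θ.step t x v s' = ∑ s, v s := by
  simp only [θ.sum_step]
  exact sum_mul_sum_emit θ hp t v

lemma POMDP.sum_abs_step_le (t : ℕ) (x : O × A) (v : S → ℝ) :
    ∑ s', |θ.step t x v s'| ≤ ∑ s', θ.step t x (fun s => |v s|) s' := by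
  refine Finset.sum_le_sum fun s' _ => ?_
  refine (Finset.abs_sum_le_sum_abs _ _).trans (Finset.sum_le_sum fun s _ => ?_)
  rw [abs_mul, abs_mul, abs_of_nonneg (θ.emit_nonneg _ _ _), abs_of_nonneg (θ.trans_nonneg _ _ _ _)]

/-- A step of the dynamics does not increase the `1`-norm. -/
lemma POMDP.sum_mul_sum_abs_step_le {p : O → A → ℝ} (hp0 : ∀ o a, 0 ≤ p o a)
    (hp : ∀ o, ∑ a, p o a = 1) (t : ℕ) (v : S → ℝ) :
    ∑ x : O × A, p x.1 x.2 * ∑ s', |θ.step t x v s'| ≤ ∑ s, |v s| := by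
  rw [← θ.sum_mul_sum_step hp t fun s => |v s|]
  exact Finset.sum_le_sum fun x _ =>
    mul_le_mul_of_nonneg_left (θ.sum_abs_step_le t x v) (hp0 _ _)

/-- The probability that `π` plays the actions of a history, given the observations. -/
def Policy.pathWeight (π : Policy O A) {n : ℕ} (τ : Fin n → O × A) : ℝ :=
  ∏ t : Fin n, π.prob t (past τ t) (τ t).1 (τ t).2

variable (π : Policy O A)

lemma Policy.pathWeight_extend {n : ℕ} (τ : Fin n → O × A) (x : O × A) :
    π.pathWeight (extend τ x) = π.pathWeight τ * π.prob n τ x.1 x.2 := by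
  rw [Policy.pathWeight, Fin.prod_univ_castSucc]
  simp only [extend_castSucc, extend_last]
  congr 1
  · refine Finset.prod_congr rfl fun t _ => ?_
    exact congrArg (fun g => π.prob t g (τ t).1 (τ t).2) (past_extend_castSucc τ x t)
  · exact congrArg (fun g => π.prob n g x.1 x.2) (past_extend_last τ x)

lemma Policy.pathWeight_nonneg {n : ℕ} (τ : Fin n → O × A) : 0 ≤ π.pathWeight τ :=
  Finset.prod_nonneg fun _ _ => π.prob_nonneg _ _ _ _

lemma Policy.pathWeight_zero (τ : Fin 0 → O × A) : π.pathWeight τ = 1 := by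
  simp [Policy.pathWeight]

lemma Policy.weight_nonneg {H : ℕ} (i j : ℕ) (τ : Traj O A H) : 0 ≤ π.weight i j τ :=
  Finset.prod_nonneg fun _ _ => π.prob_nonneg _ _ _ _

lemma Policy.weight_self {H : ℕ} (i : ℕ) (τ : Traj O A H) : π.weight i i τ = 1 := by
  rw [Policy.weight, Finset.filter_false_of_mem, Finset.prod_empty]
  intro t _
  omega

lemma Policy.weight_eq_mul {H i j : ℕ} (hij : i < j) (hj : j ≤ H) (τ : Traj O A H) :
    π.weight i j τ = π.prob i (initial i (hij.le.trans hj) τ) (τ ⟨i, hij.trans_le hj⟩).1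
      (τ ⟨i, hij.trans_le hj⟩).2 * π.weight (i + 1) j τ := by
  classical
  set t0 : Fin H := ⟨i, hij.trans_le hj⟩ with ht0
  have h : (Finset.univ.filter fun t : Fin H => i ≤ t.val ∧ t.val < j)
      = insert t0 (Finset.univ.filter fun t : Fin H => i + 1 ≤ t.val ∧ t.val < j) := by
    ext t
    simp only [Finset.mem_filter, Finset.mem_univ, true_and, Finset.mem_insert, ht0, Fin.ext_iff]
    omega
  rw [Policy.weight, h, Finset.prod_insert]
  · rfl
  · simp [ht0]

lemma Policy.weight_mul_weight {H i j k : ℕ} (hij : i ≤ j) (hjk : j ≤ k) (τ : Traj O A H) :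
    π.weight i j τ * π.weight j k τ = π.weight i k τ := by
  classical
  rw [Policy.weight, Policy.weight, Policy.weight, ← Finset.prod_union]
  · congr 1
    ext t
    simp only [Finset.mem_filter, Finset.mem_univ, true_and, Finset.mem_union]
    omega
  · rw [Finset.disjoint_left]
    intro t
    simp only [Finset.mem_filter, Finset.mem_univ, true_and]
    omega

lemma Policy.weight_zero_eq {H j : ℕ} (hj : j ≤ H) (τ : Traj O A H) :
    π.weight 0 j τ = π.pathWeight (initial j hj τ) := by
  induction j with
  | zero => rw [π.weight_self, π.pathWeight_zero]
  | succ j ih =>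
    rw [← π.weight_mul_weight (Nat.zero_le j) (Nat.le_succ j), ih (by omega),
      π.weight_eq_mul (Nat.lt_succ_self j) hj, π.weight_self, mul_one,
      ← extend_initial τ hj, π.pathWeight_extend]

/-- Marginalization of the law of a trajectory to the law of a history. -/
lemma sum_prob_mul_initial {H j : ℕ} (hj : j ≤ H) (f : (Fin j → O × A) → ℝ) :
    ∑ τ : Traj O A H, θ.prob τ * π.pathWeight τ * f (initial j hj τ)
      = ∑ σ, θ.prob σ * π.pathWeight σ * f σ := by
  induction H, hj using Nat.le_induction with
  | base => rfl
  | succ H hj ih =>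
    rw [← ih, sum_extend]
    refine Finset.sum_congr rfl fun τ _ => ?_
    simp only [initial_extend τ _ hj, π.pathWeight_extend, θ.prob_extend]
    rw [← Finset.sum_mul]
    congr 1
    rw [POMDP.prob, ← θ.sum_mul_sum_step (fun o => π.prob_sum H τ o) H (θ.forward H τ),
      Finset.sum_mul]
    exact Finset.sum_congr rfl fun x _ => by ring

lemma sum_prob_mul_pathWeight (H : ℕ) :
    ∑ τ : Traj O A H, θ.prob τ * π.pathWeight τ = 1 := by
  have h := sum_prob_mul_initial θ π (Nat.zero_le H) fun _ => 1
  simp only [mul_one] at h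
  rw [h]
  simp [θ.prob_zero, π.pathWeight_zero]

/-- The continuations of a history carry its probability, whatever the policy. -/
lemma sum_fiber_weight {H t : ℕ} (ht : t ≤ H) (σ : Fin t → O × A) :
    ∑ τ ∈ fiber ht σ, π.weight t H τ * θ.prob τ = θ.prob σ := by
  induction h : H - t generalizing t with
  | zero =>
    obtain rfl : t = H := by omega
    rw [fiber_self, Finset.sum_singleton, π.weight_self, one_mul]
  | succ k ih =>
    have htH : t < H := by omega
    rw [sum_fiber_step htH]
    have h1 : ∀ x, ∑ τ ∈ fiber (t := t + 1) htH (extend σ x), π.weight t H τ * θ.prob τ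
        = π.prob t σ x.1 x.2 * θ.prob (extend σ x) := by
      intro x
      rw [← ih htH (extend σ x) (by omega), Finset.mul_sum]
      refine Finset.sum_congr rfl fun τ hτ => ?_
      rw [mem_fiber, ← extend_initial τ htH] at hτ
      have e1 : initial t htH.le τ = σ := by
        have := congrArg (fun g => initial t (Nat.le_succ t) g) hτ
        simpa [initial_extend _ _ le_rfl, initial_self] using this
      have e2 : τ ⟨t, htH⟩ = x := by
        have := congrFun hτ (Fin.last t)
        simpa using this
      rw [π.weight_eq_mul htH le_rfl, e1, e2, mul_assoc]
    simp only [h1, θ.prob_extend]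
    exact θ.sum_mul_sum_step (fun o => π.prob_sum t σ o) t (θ.forward t σ)

end Dynamics

/-! ### Core tests and exploration sequences -/

section Tests

variable {O A S : Type*} [Fintype O] [Fintype A] [Fintype S]

lemma POMDP.obsProb_cons (θ : POMDP O A S) (t : ℕ) (o : O) (os : List O) (a : A) (as : List A)
    (s : S) : θ.obsProb t (o :: os) (a :: as) s
      = θ.emit t s o * ∑ s', θ.trans t a s s' * θ.obsProb (t + 1) os as s' := by
  cases os with
  | nil => simp [POMDP.obsProb, θ.trans_sum]
  | cons o' os => rw [POMDP.obsProb]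

lemma POMDP.obsProb_nil (θ : POMDP O A S) (t : ℕ) (as : List A) (s : S) :
    θ.obsProb t [] as s = 1 := by rw [POMDP.obsProb]

lemma POMDP.obsProb_singleton (θ : POMDP O A S) (t : ℕ) (o : O) (as : List A) (s : S) :
    θ.obsProb t [o] as s = θ.emit t s o := by rw [POMDP.obsProb]

lemma POMDP.obsProb_nonneg (θ : POMDP O A S) (t : ℕ) (os : List O) (as : List A) (s : S) :
    0 ≤ θ.obsProb t os as s := by
  induction os generalizing t as s with
  | nil => rw [θ.obsProb_nil]; exact zero_le_one
  | cons o os ih =>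
    cases as with
    | nil =>
      cases os with
      | nil => rw [θ.obsProb_singleton]; exact θ.emit_nonneg _ _ _
      | cons o' os => rw [POMDP.obsProb]
    | cons a as =>
      rw [θ.obsProb_cons]
      exact mul_nonneg (θ.emit_nonneg _ _ _)
        (Finset.sum_nonneg fun s' _ => mul_nonneg (θ.trans_nonneg _ _ _ _) (ih _ _ _))

lemma sum_ofFn_succ {X : Type*} [Fintype X] (n : ℕ) (f : List X → ℝ) :
    ∑ o : Fin (n + 1) → X, f (List.ofFn o) = ∑ x, ∑ o : Fin n → X, f (x :: List.ofFn o) := by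
  rw [← (Fin.consEquiv fun _ => X).sum_comp, Fintype.sum_prod_type]
  simp [Fin.consEquiv]

lemma POMDP.sum_obsProb (θ : POMDP O A S) (t n : ℕ) (as : List A) (h : n ≤ as.length + 1)
    (s : S) : ∑ o : Fin n → O, θ.obsProb t (List.ofFn o) as s = 1 := by
  induction n generalizing t as s with
  | zero => simp [θ.obsProb_nil]
  | succ n ih =>
    rw [sum_ofFn_succ n fun l => θ.obsProb t l as s]
    cases as with
    | nil =>
      obtain rfl : n = 0 := by simpa using h
      simp [θ.obsProb_singleton, θ.emit_sum]
    | cons a as =>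
      simp only [θ.obsProb_cons, ← Finset.mul_sum]
      have h1 : ∀ o : O, θ.emit t s o * ∑ i : Fin n → O, ∑ s', θ.trans t a s s' *
          θ.obsProb (t + 1) (List.ofFn i) as s' = θ.emit t s o := by
        intro o
        rw [Finset.sum_comm]
        simp only [← Finset.mul_sum, ih (t + 1) as (by simpa using h)]
        simp [θ.trans_sum]
      simp only [h1, θ.emit_sum]

lemma POMDP.emissionAction_nonneg (θ : POMDP O A S) (m H t : ℕ) (q : CoreTest O A m H t) (s : S) :
    0 ≤ θ.emissionAction m H t q s := θ.obsProb_nonneg _ _ _ _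

/-- For every core action sequence, the core tests with these actions exhaust the observations. -/
lemma POMDP.sum_emissionAction_obs (θ : POMDP O A S) (m H t : ℕ)
    (as : Fin (min (m - 1) (H - t)) → A) (s : S) :
    ∑ o, θ.emissionAction m H t (o, as) s = 1 :=
  θ.sum_obsProb t _ (List.ofFn as) (by simp only [List.length_ofFn]; omega) s

lemma POMDP.sum_emissionAction (θ : POMDP O A S) (m H t : ℕ) (s : S) :
    ∑ q, θ.emissionAction m H t q s = (Fintype.card A : ℝ) ^ (min (m - 1) (H - t)) := by
  rw [Fintype.sum_prod_type, Finset.sum_comm]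
  simp only [θ.sum_emissionAction_obs]
  simp

variable [DecidableEq A]

lemma card_coreActs (m H h : ℕ) :
    (coreActs A m H h).card = Fintype.card A ^ (min (m - 1) (H - h)) := by
  rw [coreActs, Finset.card_image_of_injective _ List.ofFn_injective]
  simp

lemma one_le_coreActsMax [Nonempty A] {m H : ℕ} (hH : 1 ≤ H) : 1 ≤ coreActsMax A m H := by
  have h : (coreActs A m H 0).card ≤ coreActsMax A m H :=
    Finset.le_sup (f := fun h => (coreActs A m H h).card) (Finset.mem_range.mpr hH)
  refine le_trans ?_ h
  rw [card_coreActs]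
  exact Nat.one_le_pow _ _ Fintype.card_pos

lemma card_coreActs_le [Nonempty A] {m H h : ℕ} (hH : 1 ≤ H) (hh : h ≤ H) :
    (coreActs A m H h).card ≤ coreActsMax A m H := by
  rcases hh.lt_or_eq with hlt | rfl
  · exact Finset.le_sup (f := fun h => (coreActs A m H h).card) (Finset.mem_range.mpr hlt)
  · rw [card_coreActs]
    simpa using one_le_coreActsMax hH

lemma card_exploreActs_le [Nonempty A] {m H h : ℕ} (hh : h < H) :
    ((exploreActs A m H h).card : ℝ) ≤ 2 * Fintype.card A * coreActsMax A m H := by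
  have h1 : (exploreActs A m H h).card
      ≤ Fintype.card A * coreActsMax A m H + coreActsMax A m H := by
    refine (Finset.card_union_le _ _).trans (add_le_add ?_ (card_coreActs_le (by omega) hh.le))
    refine Finset.card_image_le.trans ?_
    rw [Finset.card_product, Finset.card_univ]
    exact Nat.mul_le_mul_left _ (card_coreActs_le (by omega) hh)
  have h2 : Fintype.card A * coreActsMax A m H + coreActsMax A m H
      ≤ 2 * Fintype.card A * coreActsMax A m H := by
    have : 1 ≤ Fintype.card A := Fintype.card_pos
    nlinarith [Nat.zero_le (coreActsMax A m H)]
  exact_mod_cast h1.trans h2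

lemma POMDP.sum_emissionAction_le [Nonempty A] (θ : POMDP O A S) {m H t : ℕ} (hH : 1 ≤ H)
    (ht : t ≤ H) (s : S) : ∑ q, θ.emissionAction m H t q s ≤ coreActsMax A m H := by
  rw [θ.sum_emissionAction]
  have h := card_coreActs_le (A := A) (m := m) hH ht
  rw [card_coreActs] at h
  exact_mod_cast h

lemma POMDP.sum_abs_emissionAction_mulVec_le [Nonempty A] (θ : POMDP O A S) {m H t : ℕ}
    (hH : 1 ≤ H) (ht : t ≤ H) (v : S → ℝ) :
    ∑ q, |(θ.emissionAction m H t *ᵥ v) q| ≤ coreActsMax A m H * ∑ s, |v s| := by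
  calc ∑ q, |(θ.emissionAction m H t *ᵥ v) q|
      ≤ ∑ q, ∑ s, θ.emissionAction m H t q s * |v s| := by
        refine Finset.sum_le_sum fun q _ => (Finset.abs_sum_le_sum_abs _ _).trans
          (le_of_eq (Finset.sum_congr rfl fun s _ => ?_))
        rw [abs_mul, abs_of_nonneg (θ.emissionAction_nonneg m H t q s)]
    _ = ∑ s, (∑ q, θ.emissionAction m H t q s) * |v s| := by
        rw [Finset.sum_comm]
        simp only [Finset.sum_mul]
    _ ≤ ∑ s, coreActsMax A m H * |v s| := by
        gcongr with s
        exact θ.sum_emissionAction_le hH ht s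
    _ = _ := by rw [Finset.mul_sum]

lemma drop_ofFn {X : Type*} {H t : ℕ} (f : Fin H → X) (ht : t < H) :
    (List.ofFn f).drop t = f ⟨t, ht⟩ :: (List.ofFn f).drop (t + 1) := by
  rw [List.drop_eq_getElem_cons (by simpa using ht)]
  simp

/-- The probability of the actions of `τ` from step `t` on when first the sequence `as` is played
and then the policy `ρ`. -/
def seqWeight {H : ℕ} (ρ : Policy O A) (t : ℕ) (as : List A) (τ : Traj O A H) : ℝ :=
  if as <+: (List.ofFn fun i => (τ i).2).drop t then ρ.weight (t + as.length) H τ else 0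

lemma seqWeight_nonneg {H : ℕ} (ρ : Policy O A) (t : ℕ) (as : List A) (τ : Traj O A H) :
    0 ≤ seqWeight ρ t as τ := by
  rw [seqWeight]
  split_ifs
  · exact ρ.weight_nonneg _ _ _
  · exact le_rfl

lemma seqWeight_nil {H : ℕ} (ρ : Policy O A) (t : ℕ) (τ : Traj O A H) :
    seqWeight ρ t [] τ = ρ.weight t H τ := by simp [seqWeight]

lemma seqWeight_cons {H : ℕ} (ρ : Policy O A) {t : ℕ} (ht : t < H) (a : A) (as : List A)
    (τ : Traj O A H) :
    seqWeight ρ t (a :: as) τ = if a = (τ ⟨t, ht⟩).2 then seqWeight ρ (t + 1) as τ else 0 := by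
  simp only [seqWeight, drop_ofFn (fun i => (τ i).2) ht, List.cons_prefix_cons, List.length_cons]
  rw [show t + (as.length + 1) = t + 1 + as.length by omega]
  by_cases h1 : a = (τ ⟨t, ht⟩).2 <;> simp [h1]

lemma of_mem_fiber_extend {X : Type*} [Fintype X] {H t : ℕ} {ht : t < H} {σ : Fin t → X} {x : X}
    {τ : Fin H → X} (hτ : τ ∈ fiber (t := t + 1) ht (extend σ x)) :
    initial t ht.le τ = σ ∧ τ ⟨t, ht⟩ = x := by
  rw [mem_fiber, ← extend_initial τ ht] at hτ
  constructor
  · have := congrArg (fun g => initial t (Nat.le_succ t) g) hτ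
    simpa [initial_extend _ _ le_rfl, initial_self] using this
  · have := congrFun hτ (Fin.last t)
    simpa using this

lemma sum_fiber_seqWeight (θ : POMDP O A S) (ρ : Policy O A) {H t : ℕ} (ht : t ≤ H)
    (as : List A) (has : t + as.length ≤ H) (σ : Fin t → O × A) :
    ∑ τ ∈ fiber ht σ, seqWeight ρ t as τ * θ.prob τ = θ.prob σ := by
  induction as generalizing t with
  | nil =>
    simp only [seqWeight_nil]
    exact sum_fiber_weight θ ρ ht σ
  | cons a as ih =>
    rw [List.length_cons] at has
    have htH : t < H := by omega
    rw [sum_fiber_step htH]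
    have h1 : ∀ x, ∑ τ ∈ fiber (t := t + 1) htH (extend σ x), seqWeight ρ t (a :: as) τ * θ.prob τ
        = (if a = x.2 then 1 else 0) * θ.prob (extend σ x) := by
      intro x
      rw [← ih htH (by omega) (extend σ x), Finset.mul_sum]
      refine Finset.sum_congr rfl fun τ hτ => ?_
      rw [seqWeight_cons ρ htH, (of_mem_fiber_extend hτ).2]
      split_ifs <;> simp
    simp only [h1, θ.prob_extend]
    exact θ.sum_mul_sum_step (p := fun _ b => if a = b then 1 else 0) (fun o => by simp) t
      (θ.forward t σ)

open Classical in
/-- The continuations of a history that are compatible with a test carry the joint probability of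
the history and the test. -/
lemma sum_fiber_test (θ : POMDP O A S) (ρ : Policy O A) {H t : ℕ} (ht : t ≤ H) (os : List O)
    (as : List A) (hlen : os.length = as.length ∨ os.length = as.length + 1)
    (hos : t + os.length ≤ H) (σ : Fin t → O × A) :
    ∑ τ ∈ fiber ht σ, (if os <+: (List.ofFn fun i => (τ i).1).drop t then 1 else 0)
      * (seqWeight ρ t as τ * θ.prob τ) = ∑ s, θ.forward t σ s * θ.obsProb t os as s := by
  induction os generalizing t as with
  | nil =>
    obtain rfl : as = [] := List.length_eq_zero_iff.mp (by simp at hlen; omega)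
    simp only [seqWeight_nil, List.nil_prefix, if_true, one_mul, θ.obsProb_nil, mul_one]
    exact sum_fiber_weight θ ρ ht σ
  | cons o os ih =>
    rw [List.length_cons] at hos
    have htH : t < H := by omega
    rw [sum_fiber_step htH]
    cases as with
    | nil =>
      obtain rfl : os = [] := by simpa using hlen
      have h1 : ∀ x, ∑ τ ∈ fiber (t := t + 1) htH (extend σ x),
          (if [o] <+: (List.ofFn fun i => (τ i).1).drop t then (1 : ℝ) else 0)
            * (seqWeight ρ t [] τ * θ.prob τ)
          = (if o = x.1 then 1 else 0) * (ρ.prob t σ x.1 x.2 * θ.prob (extend σ x)) := by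
        intro x
        rw [← sum_fiber_weight θ ρ htH (extend σ x), Finset.mul_sum, Finset.mul_sum]
        refine Finset.sum_congr rfl fun τ hτ => ?_
        obtain ⟨e1, e2⟩ := of_mem_fiber_extend hτ
        rw [seqWeight_nil, ρ.weight_eq_mul htH le_rfl, e1, e2]
        simp only [drop_ofFn (fun i => (τ i).1) htH, List.cons_prefix_cons, e2, List.nil_prefix,
          and_true, Nat.succ_eq_add_one]
        ring
      simp only [h1, θ.prob_extend, θ.sum_step, θ.obsProb_singleton]
      rw [Fintype.sum_prod_type, Finset.sum_eq_single o]
      · simp [← Finset.sum_mul, ρ.prob_sum]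
      · intro o' _ ho'
        simp [Ne.symm ho']
      · simp
    | cons a as =>
      have h1 : ∀ x, ∑ τ ∈ fiber (t := t + 1) htH (extend σ x),
          (if o :: os <+: (List.ofFn fun i => (τ i).1).drop t then (1 : ℝ) else 0)
            * (seqWeight ρ t (a :: as) τ * θ.prob τ)
          = (if x = (o, a) then 1 else 0)
            * ∑ s, θ.step t x (θ.forward t σ) s * θ.obsProb (t + 1) os as s := by
        intro x
        rw [← θ.forward_extend, ← ih htH as (by simpa using hlen) (by omega) (extend σ x),
          Finset.mul_sum]
        refine Finset.sum_congr rfl fun τ hτ => ?_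
        obtain ⟨e1, e2⟩ := of_mem_fiber_extend hτ
        rw [seqWeight_cons ρ htH]
        simp only [drop_ofFn (fun i => (τ i).1) htH, List.cons_prefix_cons, e2]
        obtain ⟨x1, x2⟩ := x
        by_cases c1 : o = x1 <;> by_cases c2 : a = x2 <;>
          simp [c1, c2, eq_comm (a := x1), eq_comm (a := x2)]
      simp only [h1]
      rw [Finset.sum_eq_single (o, a)]
      · simp only [if_true, one_mul, POMDP.step, θ.obsProb_cons, Finset.sum_mul, Finset.mul_sum]
        rw [Finset.sum_comm]
        exact Finset.sum_congr rfl fun s _ => Finset.sum_congr rfl fun s' _ => by ring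
      · intro x _ hx
        simp [hx]
      · simp

open Classical in
lemma sum_prefix_le {X : Type*} [Fintype X] (n : ℕ) (l : List X) :
    ∑ o : Fin n → X, (if List.ofFn o <+: l then (1 : ℝ) else 0) ≤ 1 := by
  rw [Finset.sum_boole]
  have : (Finset.univ.filter fun o : Fin n → X => List.ofFn o <+: l).card ≤ 1 := by
    rw [Finset.card_le_one]
    intro o ho o' ho'
    simp only [Finset.mem_filter, Finset.mem_univ, true_and] at ho ho'
    exact List.ofFn_injective
      ((List.prefix_of_prefix_length_le ho ho' (by simp)).eq_of_length (by simp))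
  exact_mod_cast this

/-- The `ℓ¹` distance of the tests with given actions is at most the distance of the laws of the
continuations when these actions are played. -/
lemma sum_abs_tests_le (θ₁ θ₂ : POMDP O A S) (ρ : Policy O A) {H t n : ℕ} (ht : t ≤ H)
    (as : List A) (hlen : n = as.length ∨ n = as.length + 1) (hn : t + n ≤ H)
    (σ : Fin t → O × A) (c₁ c₂ : ℝ) :
    ∑ o : Fin n → O, |c₁ * ∑ s, θ₁.forward t σ s * θ₁.obsProb t (List.ofFn o) as s
        - c₂ * ∑ s, θ₂.forward t σ s * θ₂.obsProb t (List.ofFn o) as s|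
      ≤ ∑ τ ∈ fiber ht σ, seqWeight ρ t as τ * |c₁ * θ₁.prob τ - c₂ * θ₂.prob τ| := by
  classical
  have h1 : ∀ o : Fin n → O, |c₁ * ∑ s, θ₁.forward t σ s * θ₁.obsProb t (List.ofFn o) as s
        - c₂ * ∑ s, θ₂.forward t σ s * θ₂.obsProb t (List.ofFn o) as s|
      ≤ ∑ τ ∈ fiber ht σ,
        (if List.ofFn o <+: (List.ofFn fun i => (τ i).1).drop t then (1 : ℝ) else 0)
          * (seqWeight ρ t as τ * |c₁ * θ₁.prob τ - c₂ * θ₂.prob τ|) := by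
    intro o
    rw [← sum_fiber_test θ₁ ρ ht (List.ofFn o) as (by simpa using hlen) (by simpa using hn) σ,
      ← sum_fiber_test θ₂ ρ ht (List.ofFn o) as (by simpa using hlen) (by simpa using hn) σ,
      Finset.mul_sum, Finset.mul_sum, ← Finset.sum_sub_distrib]
    refine (Finset.abs_sum_le_sum_abs _ _).trans (Finset.sum_le_sum fun τ _ => ?_)
    have e : ∀ i w p p' : ℝ, c₁ * (i * (w * p)) - c₂ * (i * (w * p'))
        = i * (w * (c₁ * p - c₂ * p')) := fun i w p p' => by ring
    have hi : (0 : ℝ) ≤ if List.ofFn o <+: (List.ofFn fun i => (τ i).1).drop t then 1 else 0 := by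
      split_ifs <;> norm_num
    rw [e, abs_mul, abs_mul, abs_of_nonneg (seqWeight_nonneg ρ t as τ), abs_of_nonneg hi]
  refine (Finset.sum_le_sum fun o _ => h1 o).trans ?_
  rw [Finset.sum_comm]
  refine Finset.sum_le_sum fun τ _ => ?_
  rw [← Finset.sum_mul]
  have h2 := sum_prefix_le n ((List.ofFn fun i => (τ i).1).drop t)
  have h3 : 0 ≤ seqWeight ρ t as τ * |c₁ * θ₁.prob τ - c₂ * θ₂.prob τ| :=
    mul_nonneg (seqWeight_nonneg ρ t as τ) (abs_nonneg _)
  calc _ ≤ 1 * (seqWeight ρ t as τ * |c₁ * θ₁.prob τ - c₂ * θ₂.prob τ|) := by gcongr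
    _ = _ := one_mul _

/-- The probability of the actions of `τ` from step `h` on under the exploration policy. -/
def exploreTail {H : ℕ} (m : ℕ) (ρ : Policy O A) (h : ℕ) (τ : Traj O A H) : ℝ :=
  (∑ q ∈ exploreActs A m H h, seqWeight ρ h q τ) / (exploreActs A m H h).card

lemma exploreWeight_eq {H : ℕ} (m : ℕ) (ρ π : Policy O A) (h : Fin H) (τ : Traj O A H) :
    exploreWeight m ρ π h τ = π.weight 0 h τ * exploreTail m ρ h τ := rfl

lemma exploreTail_nonneg {H : ℕ} (m : ℕ) (ρ : Policy O A) (h : ℕ) (τ : Traj O A H) :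
    0 ≤ exploreTail m ρ h τ :=
  div_nonneg (Finset.sum_nonneg fun q _ => seqWeight_nonneg ρ h q τ) (Nat.cast_nonneg _)

lemma exploreActs_card_pos [Nonempty A] {m H h : ℕ} : 0 < (exploreActs A m H h).card := by
  rw [Finset.card_pos]
  refine Finset.Nonempty.inr ?_
  rw [← Finset.card_pos, card_coreActs]
  exact pow_pos Fintype.card_pos _

lemma length_le_of_mem_exploreActs {m H h : ℕ} (hh : h < H) {q : List A}
    (hq : q ∈ exploreActs A m H h) : h + q.length ≤ H := by
  simp only [exploreActs, coreActs, Finset.mem_union, Finset.mem_image, Finset.mem_product,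
    Finset.mem_univ, true_and, Prod.exists] at hq
  rcases hq with ⟨a, l, ⟨b, rfl⟩, rfl⟩ | ⟨b, rfl⟩
  · simp only [List.length_cons, List.length_ofFn]
    omega
  · simp only [List.length_ofFn]
    omega

lemma sum_fiber_exploreTail [Nonempty A] (θ : POMDP O A S) (ρ : Policy O A) {m H h : ℕ}
    (hh : h < H) (σ : Fin h → O × A) :
    ∑ τ ∈ fiber hh.le σ, exploreTail m ρ h τ * θ.prob τ = θ.prob σ := by
  have hc : ((exploreActs A m H h).card : ℝ) ≠ 0 := by exact_mod_cast exploreActs_card_pos.ne'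
  simp only [exploreTail, div_mul_eq_mul_div, Finset.sum_mul]
  rw [← Finset.sum_div, Finset.sum_comm, Finset.sum_congr rfl fun q hq =>
    sum_fiber_seqWeight θ ρ hh.le q (length_le_of_mem_exploreActs hh hq) σ]
  rw [Finset.sum_const, nsmul_eq_mul, mul_div_cancel_left₀ _ hc]

/-- The `ℓ¹` distance of the conditional laws of the continuations of a history under the
exploration policy. -/
def condTV (m : ℕ) (ρ : Policy O A) (θ₁ θ₂ : POMDP O A S) {h H : ℕ} (hh : h ≤ H)
    (σ : Fin h → O × A) : ℝ :=
  ∑ τ ∈ fiber hh σ, exploreTail m ρ h τ * |θ₁.prob τ / θ₁.prob σ - θ₂.prob τ / θ₂.prob σ|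

lemma condTV_nonneg (m : ℕ) (ρ : Policy O A) (θ₁ θ₂ : POMDP O A S) {h H : ℕ} (hh : h ≤ H)
    (σ : Fin h → O × A) : 0 ≤ condTV m ρ θ₁ θ₂ hh σ :=
  Finset.sum_nonneg fun _ _ => mul_nonneg (exploreTail_nonneg _ _ _ _) (abs_nonneg _)

lemma condTV_comm (m : ℕ) (ρ : Policy O A) (θ₁ θ₂ : POMDP O A S) {h H : ℕ} (hh : h ≤ H)
    (σ : Fin h → O × A) : condTV m ρ θ₁ θ₂ hh σ = condTV m ρ θ₂ θ₁ hh σ :=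
  Finset.sum_congr rfl fun _ _ => by rw [abs_sub_comm]

lemma sum_seqWeight_eq_condTV [Nonempty A] (m : ℕ) (ρ : Policy O A) (θ₁ θ₂ : POMDP O A S)
    {h H : ℕ} (hh : h ≤ H) (σ : Fin h → O × A) :
    ∑ q ∈ exploreActs A m H h, ∑ τ ∈ fiber hh σ,
        seqWeight ρ h q τ * |(θ₁.prob σ)⁻¹ * θ₁.prob τ - (θ₂.prob σ)⁻¹ * θ₂.prob τ|
      = (exploreActs A m H h).card * condTV m ρ θ₁ θ₂ hh σ := by
  have hc : ((exploreActs A m H h).card : ℝ) ≠ 0 := by exact_mod_cast exploreActs_card_pos.ne'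
  rw [Finset.sum_comm, condTV, Finset.mul_sum]
  refine Finset.sum_congr rfl fun τ _ => ?_
  rw [← Finset.sum_mul, exploreTail, div_eq_inv_mul (θ₁.prob τ), div_eq_inv_mul (θ₂.prob τ),
    ← mul_assoc, mul_div_cancel₀ _ hc]

/-- The normalized law of the latent state after a history. -/
def POMDP.belief (θ : POMDP O A S) {n : ℕ} (τ : Fin n → O × A) : S → ℝ :=
  (θ.prob τ)⁻¹ • θ.forward n τ

lemma POMDP.psiBar_eq (θ : POMDP O A S) (m H h : ℕ) (τ : Fin h → O × A) :
    θ.psiBar m H h τ = θ.emissionAction m H h *ᵥ θ.belief τ := by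
  funext q
  rw [POMDP.belief, Matrix.mulVec_smul, POMDP.psiBar, POMDP.psi, Pi.smul_apply, smul_eq_mul,
    div_eq_inv_mul, Matrix.mulVec, dotProduct]
  congr 1
  exact Finset.sum_congr rfl fun s _ => mul_comm _ _

lemma POMDP.smul_belief (θ : POMDP O A S) {n : ℕ} (τ : Fin n → O × A) :
    θ.prob τ • θ.belief τ = θ.forward n τ := by
  by_cases h : θ.prob τ = 0
  · rw [h, zero_smul]
    funext s
    exact ((Finset.sum_eq_zero_iff_of_nonneg fun s _ => θ.forward_nonneg τ s).mp h s
      (Finset.mem_univ s)).symm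
  · rw [POMDP.belief, smul_smul, mul_inv_cancel₀ h, one_smul]

lemma POMDP.belief_nonneg (θ : POMDP O A S) {n : ℕ} (τ : Fin n → O × A) (s : S) :
    0 ≤ θ.belief τ s :=
  mul_nonneg (inv_nonneg.mpr (θ.prob_nonneg τ)) (θ.forward_nonneg τ s)

lemma POMDP.sum_abs_belief_le (θ : POMDP O A S) {n : ℕ} (τ : Fin n → O × A) :
    ∑ s, |θ.belief τ s| ≤ 1 := by
  simp only [abs_of_nonneg (θ.belief_nonneg τ _)]
  simp only [POMDP.belief, Pi.smul_apply, smul_eq_mul, ← Finset.mul_sum]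
  exact inv_mul_le_one

lemma POMDP.belief_dotProduct_self_le (θ : POMDP O A S) {n : ℕ} (τ : Fin n → O × A) :
    θ.belief τ ⬝ᵥ θ.belief τ ≤ 1 := by
  refine (dotProduct_self_le_sq_sum_abs _).trans ?_
  have h1 := θ.sum_abs_belief_le τ
  have h2 : 0 ≤ ∑ s, |θ.belief τ s| := Finset.sum_nonneg fun _ _ => abs_nonneg _
  nlinarith

/-- The prediction features of two models are close where the conditional laws of the
continuations are. -/
lemma sum_abs_psiBar_sub_le [Nonempty A] (θ₁ θ₂ : POMDP O A S) (ρ : Policy O A) {m H h : ℕ}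
    (hm : 1 ≤ m) (hh : h < H) (σ : Fin h → O × A) :
    ∑ q, |θ₁.psiBar m H h σ q - θ₂.psiBar m H h σ q|
      ≤ (exploreActs A m H h).card * condTV m ρ θ₁ θ₂ hh.le σ := by
  rw [Fintype.sum_prod_type, Finset.sum_comm, ← sum_seqWeight_eq_condTV]
  set F : List A → ℝ := fun q => ∑ τ ∈ fiber hh.le σ,
    seqWeight ρ h q τ * |(θ₁.prob σ)⁻¹ * θ₁.prob τ - (θ₂.prob σ)⁻¹ * θ₂.prob τ| with hF
  have h1 : ∑ q ∈ coreActs A m H h, F q ≤ ∑ q ∈ exploreActs A m H h, F q :=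
    Finset.sum_le_sum_of_subset_of_nonneg Finset.subset_union_right fun q _ _ =>
      Finset.sum_nonneg fun τ _ => mul_nonneg (seqWeight_nonneg _ _ _ _) (abs_nonneg _)
  refine le_trans ?_ h1
  rw [coreActs, Finset.sum_image fun a _ b _ hab => List.ofFn_injective hab]
  refine Finset.sum_le_sum fun as _ => ?_
  refine le_trans (le_of_eq ?_) (sum_abs_tests_le θ₁ θ₂ ρ (n := min m (H - h)) hh.le (List.ofFn as)
    (by simp only [List.length_ofFn]; omega) (by omega) σ (θ₁.prob σ)⁻¹ (θ₂.prob σ)⁻¹)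
  refine Finset.sum_congr rfl fun o _ => ?_
  simp only [POMDP.psiBar, POMDP.psi, div_eq_inv_mul, POMDP.emissionAction, Matrix.of_apply]

lemma sum_abs_step_sub_le [Nonempty A] (θ₁ θ₂ : POMDP O A S) (ρ : Policy O A) {m H h : ℕ}
    (hm : 1 ≤ m) (hh : h < H) (σ : Fin h → O × A) :
    ∑ x, ∑ q, |(θ₁.emissionAction m H (h + 1) *ᵥ θ₁.step h x (θ₁.belief σ)) q
        - (θ₂.emissionAction m H (h + 1) *ᵥ θ₂.step h x (θ₂.belief σ)) q|
      ≤ (exploreActs A m H h).card * condTV m ρ θ₁ θ₂ hh.le σ := by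
  rw [← sum_seqWeight_eq_condTV]
  set F : List A → ℝ := fun q => ∑ τ ∈ fiber hh.le σ,
    seqWeight ρ h q τ * |(θ₁.prob σ)⁻¹ * θ₁.prob τ - (θ₂.prob σ)⁻¹ * θ₂.prob τ| with hF
  have h1 : ∑ q ∈ (Finset.univ ×ˢ coreActs A m H (h + 1)).image (fun p => p.1 :: p.2), F q
      ≤ ∑ q ∈ exploreActs A m H h, F q :=
    Finset.sum_le_sum_of_subset_of_nonneg Finset.subset_union_left fun q _ _ =>
      Finset.sum_nonneg fun τ _ => mul_nonneg (seqWeight_nonneg _ _ _ _) (abs_nonneg _)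
  refine le_trans ?_ h1
  rw [Finset.sum_image (by
    rintro ⟨a, l⟩ _ ⟨b, l'⟩ _ hab
    simpa using hab), Finset.sum_product, Fintype.sum_prod_type, Finset.sum_comm]
  refine Finset.sum_le_sum fun a _ => ?_
  rw [coreActs, Finset.sum_image fun a _ b _ hab => List.ofFn_injective hab]
  simp only [Fintype.sum_prod_type]
  simp only [Finset.sum_comm (s := (Finset.univ : Finset (Fin (min m (H - (h + 1))) → O)))]
  rw [Finset.sum_comm]
  refine Finset.sum_le_sum fun as _ => ?_
  refine le_trans (le_of_eq ?_) (sum_abs_tests_le θ₁ θ₂ ρ (n := min m (H - (h + 1)) + 1) hh.le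
    (a :: List.ofFn as) (by simp only [List.length_cons, List.length_ofFn]; omega) (by omega) σ
    (θ₁.prob σ)⁻¹ (θ₂.prob σ)⁻¹)
  rw [sum_ofFn_succ _ fun l => |(θ₁.prob σ)⁻¹ * ∑ s, θ₁.forward h σ s * θ₁.obsProb h l
    (a :: List.ofFn as) s - (θ₂.prob σ)⁻¹ * ∑ s, θ₂.forward h σ s * θ₂.obsProb h l
    (a :: List.ofFn as) s|]
  refine Finset.sum_congr rfl fun o _ => Finset.sum_congr rfl fun os _ => ?_
  have e : ∀ θ : POMDP O A S, (θ.emissionAction m H (h + 1) *ᵥ θ.step h (o, a) (θ.belief σ))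
      (os, as) = (θ.prob σ)⁻¹ * ∑ s, θ.forward h σ s * θ.obsProb h (o :: List.ofFn os)
        (a :: List.ofFn as) s := by
    intro θ
    simp only [POMDP.belief, Pi.smul_apply, smul_eq_mul,
      Matrix.mulVec, dotProduct, POMDP.emissionAction, Matrix.of_apply, θ.obsProb_cons,
      POMDP.step, Finset.mul_sum]
    rw [Finset.sum_comm]
    exact Finset.sum_congr rfl fun s _ => Finset.sum_congr rfl fun s' _ => by ring
  rw [e, e]

lemma reducedFeature_eq_belief [DecidableEq S] [Nonempty S] (θ : POMDP O A S) {m H : ℕ} {a : ℝ}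
    (ha : 0 < a) (hθ : θ.IsDecodable m H a) (h : Fin H) (τ : Traj O A H) :
    reducedFeature m θ h τ = θ.belief (past τ h) := by
  rw [reducedFeature, θ.psiBar_eq, Matrix.mulVec_mulVec, pinv_mul_self ha (hθ h),
    Matrix.one_mulVec]

end Tests

/-! ### Comparison of two models along a trajectory -/

section Supported

variable {S : Type*} [Fintype S]

/-- A function on vectors that at every point is attained by a linear functional below it, as is
the case for every seminorm. -/
def Supported (N : (S → ℝ) → ℝ) : Prop :=
  ∀ v, ∃ w : S → ℝ, w ⬝ᵥ v = N v ∧ ∀ v', |w ⬝ᵥ v'| ≤ N v'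

lemma supported_abs (w : S → ℝ) : Supported fun v => |w ⬝ᵥ v| := by
  intro v
  rcases le_total 0 (w ⬝ᵥ v) with h | h
  · exact ⟨w, (abs_of_nonneg h).symm, fun v' => le_rfl⟩
  · refine ⟨-w, ?_, fun v' => ?_⟩
    · rw [neg_dotProduct]; exact (abs_of_nonpos h).symm
    · rw [neg_dotProduct, abs_neg]

lemma supported_zero : Supported fun _ : S → ℝ => 0 :=
  fun v => ⟨0, by simp, fun v' => by simp⟩

lemma Supported.add {N N' : (S → ℝ) → ℝ} (h : Supported N) (h' : Supported N') :
    Supported fun v => N v + N' v := by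
  intro v
  obtain ⟨w, hw, hw'⟩ := h v
  obtain ⟨u, hu, hu'⟩ := h' v
  refine ⟨w + u, by rw [add_dotProduct, hw, hu], fun v' => ?_⟩
  rw [add_dotProduct]
  exact (abs_add_le _ _).trans (add_le_add (hw' v') (hu' v'))

lemma Supported.const_mul {N : (S → ℝ) → ℝ} (h : Supported N) {c : ℝ} (hc : 0 ≤ c) :
    Supported fun v => c * N v := by
  intro v
  obtain ⟨w, hw, hw'⟩ := h v
  refine ⟨c • w, by rw [smul_dotProduct, hw, smul_eq_mul], fun v' => ?_⟩
  rw [smul_dotProduct, smul_eq_mul, abs_mul, abs_of_nonneg hc]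
  exact mul_le_mul_of_nonneg_left (hw' v') hc

lemma supported_sum {ι : Type*} (s : Finset ι) {N : ι → (S → ℝ) → ℝ}
    (h : ∀ i ∈ s, Supported (N i)) : Supported fun v => ∑ i ∈ s, N i v := by
  classical
  induction s using Finset.induction_on with
  | empty => simpa using supported_zero
  | insert i s hi ih =>
    simp only [Finset.sum_insert hi]
    exact (h i (Finset.mem_insert_self i s)).add
      (ih fun j hj => h j (Finset.mem_insert_of_mem hj))

/-- A seminorm that is small at the data points `xᵢ` is small relative to the norm `‖·‖_{U⁻¹}`
for the second-moment matrix `U` of the data. -/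
lemma Supported.le_sqrt_mul_sqrt [DecidableEq S] {N : (S → ℝ) → ℝ} (h : Supported N) {ι : Type*}
    {lam b c : ℝ} (hlam : 0 < lam) (hb : 0 ≤ b) {s : Finset ι} {x : ι → S → ℝ} {t : ι → ℝ}
    (hN : ∀ v, N v ≤ b * √(v ⬝ᵥ v)) (hx : ∀ i ∈ s, N (x i) ≤ c * t i) (v : S → ℝ) :
    N v ≤ √(lam * b ^ 2 + c ^ 2 * ∑ i ∈ s, t i ^ 2) * √(invNormSq lam s x v) := by
  obtain ⟨w, hw, hw'⟩ := h v
  have h0 := dotProduct_self_nonneg' w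
  have h1 : √(w ⬝ᵥ w) ≤ b := by
    have a1 := (le_abs_self _).trans ((hw' w).trans (hN w))
    rcases (Real.sqrt_nonneg (w ⬝ᵥ w)).eq_or_lt with h2 | h2
    · rw [← h2]; exact hb
    · have a2 := Real.mul_self_sqrt h0
      by_contra hlt
      push Not at hlt
      nlinarith
  have h2 : w ⬝ᵥ w ≤ b ^ 2 := by
    rw [← Real.sq_sqrt h0]
    exact pow_le_pow_left₀ (Real.sqrt_nonneg _) h1 2
  have h3 : quadForm lam s x w ≤ lam * b ^ 2 + c ^ 2 * ∑ i ∈ s, t i ^ 2 := by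
    rw [quadForm, Finset.mul_sum]
    refine add_le_add (mul_le_mul_of_nonneg_left h2 hlam.le) (Finset.sum_le_sum fun i hi => ?_)
    rw [← mul_pow, ← sq_abs]
    exact pow_le_pow_left₀ (abs_nonneg _) ((hw' (x i)).trans (hx i hi)) 2
  rw [← hw, ← Real.sqrt_mul ((quadForm_nonneg hlam w).trans h3)]
  refine (le_abs_self _).trans (Real.abs_le_sqrt ?_)
  refine (sq_dotProduct_le_invNormSq (s := s) (x := x) hlam w v).trans ?_
  rw [mul_comm]
  exact mul_le_mul_of_nonneg_right h3 (invNormSq_nonneg hlam v)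

end Supported

section Simulation

variable {O A S : Type*} [Fintype O] [Fintype A] [Fintype S] [DecidableEq S]

/-- The matrix of one step of the forward recursion. -/
def POMDP.stepMatrix (θ : POMDP O A S) (t : ℕ) (x : O × A) : Matrix S S ℝ :=
  Matrix.of fun s' s => θ.emit t s x.1 * θ.trans t x.2 s s'

lemma POMDP.step_eq_mulVec (θ : POMDP O A S) (t : ℕ) (x : O × A) (v : S → ℝ) :
    θ.step t x v = θ.stepMatrix t x *ᵥ v := by
  funext s'
  exact Finset.sum_congr rfl fun s _ => by simp only [POMDP.stepMatrix, Matrix.of_apply]; ring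

/-- The map that reads a latent-state vector of `θ₁` as a latent-state vector of `θ₂`, through the
predictions of the core tests. -/
def transfer (m H : ℕ) (θ₁ θ₂ : POMDP O A S) (h : ℕ) : Matrix S S ℝ :=
  pinv (θ₂.emissionAction m H h) * θ₁.emissionAction m H h

/-- The one-step error that is made when the latent-state vector `v` of `θ₁` is first transferred
to `θ₂` and then moved on by `θ₂`, the actions being weighted by `p`. After the last step of an
episode only the total mass is compared. -/
def stepError (m H : ℕ) (θ₁ θ₂ : POMDP O A S) (h : ℕ) (p : O → A → ℝ) (v : S → ℝ) : ℝ :=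
  ∑ x : O × A, p x.1 x.2 *
    (|∑ s, ((θ₁.stepMatrix h x - θ₂.stepMatrix h x * transfer m H θ₁ θ₂ h) *ᵥ v) s| +
      if h + 1 < H then ∑ s, |((transfer m H θ₁ θ₂ (h + 1) * θ₁.stepMatrix h x
        - θ₂.stepMatrix h x * transfer m H θ₁ θ₂ h) *ᵥ v) s| else 0)

lemma stepError_eq (m H : ℕ) (θ₁ θ₂ : POMDP O A S) (h : ℕ) (p : O → A → ℝ) (v : S → ℝ) :
    stepError m H θ₁ θ₂ h p v = ∑ x : O × A, p x.1 x.2 *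
      (|∑ s, (θ₁.step h x v s - θ₂.step h x (transfer m H θ₁ θ₂ h *ᵥ v) s)| +
        if h + 1 < H then ∑ s, |(transfer m H θ₁ θ₂ (h + 1) *ᵥ θ₁.step h x v) s
          - θ₂.step h x (transfer m H θ₁ θ₂ h *ᵥ v) s| else 0) := by
  simp only [stepError, Matrix.sub_mulVec, ← Matrix.mulVec_mulVec, POMDP.step_eq_mulVec,
    Pi.sub_apply]

lemma supported_stepError (m H : ℕ) (θ₁ θ₂ : POMDP O A S) (h : ℕ) {p : O → A → ℝ}
    (hp : ∀ o a, 0 ≤ p o a) : Supported (stepError m H θ₁ θ₂ h p) := by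
  refine supported_sum _ fun x _ => Supported.const_mul (Supported.add ?_ ?_) (hp _ _)
  · have h1 : ∀ M : Matrix S S ℝ, Supported fun v => |∑ s, (M *ᵥ v) s| := by
      intro M
      convert supported_abs ((fun _ => 1) ᵥ* M) using 2 with v
      rw [← Matrix.dotProduct_mulVec]
      simp [dotProduct]
    exact h1 _
  · split_ifs
    · exact supported_sum _ fun s _ => supported_abs _
    · exact supported_zero

lemma stepError_smul (m H : ℕ) (θ₁ θ₂ : POMDP O A S) (h : ℕ) (p : O → A → ℝ) {c : ℝ}
    (hc : 0 ≤ c) (v : S → ℝ) :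
    stepError m H θ₁ θ₂ h p (c • v) = c * stepError m H θ₁ θ₂ h p v := by
  rw [stepError, stepError, Finset.mul_sum]
  refine Finset.sum_congr rfl fun x _ => ?_
  simp only [Matrix.mulVec_smul, Pi.smul_apply, smul_eq_mul, abs_mul, abs_of_nonneg hc,
    ← Finset.mul_sum]
  split_ifs <;> ring

lemma stepError_nonneg (m H : ℕ) (θ₁ θ₂ : POMDP O A S) (h : ℕ) {p : O → A → ℝ}
    (hp : ∀ o a, 0 ≤ p o a) (v : S → ℝ) : 0 ≤ stepError m H θ₁ θ₂ h p v := by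
  refine Finset.sum_nonneg fun x _ => mul_nonneg (hp _ _) (add_nonneg (abs_nonneg _) ?_)
  split_ifs
  · exact Finset.sum_nonneg fun _ _ => abs_nonneg _
  · exact le_rfl

/-! ### The telescoping argument -/

variable (m H : ℕ) (θ₁ θ₂ : POMDP O A S) (π : Policy O A)
  (alive : (n : ℕ) → (Fin n → O × A) → Prop)

open Classical in
/-- The distance after `h` steps of the latent-state vectors of the two models, where the first is
transferred to the second. On the histories that are no longer alive the signed difference of the
probabilities takes its place, which the further steps do not change. -/
def potential (h : ℕ) : ℝ :=
  ∑ σ : Fin h → O × A, π.pathWeight σ *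
    if alive h σ then ∑ s, |(transfer m H θ₁ θ₂ h *ᵥ θ₁.forward h σ) s - θ₂.forward h σ s|
    else θ₂.prob σ - θ₁.prob σ

open Classical in
/-- The expected one-step error on the histories of length `h` that are alive. -/
def aliveError (h : ℕ) : ℝ :=
  ∑ σ : Fin h → O × A, π.pathWeight σ *
    if alive h σ then stepError m H θ₁ θ₂ h (π.prob h σ) (θ₁.forward h σ) else 0

variable {m H θ₁ θ₂ π alive}

/-- One step of the telescoping argument, for any quantity that on the histories that are alive is
at most the one-step error plus the propagated distance. -/
lemma sum_mul_extend_le {h : ℕ} (f : (Fin (h + 1) → O × A) → ℝ)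
    (hf : ∀ σ x, alive h σ → f (extend σ x) ≤
      (|∑ s, (θ₁.step h x (θ₁.forward h σ) s
          - θ₂.step h x (transfer m H θ₁ θ₂ h *ᵥ θ₁.forward h σ) s)| +
        if h + 1 < H then ∑ s, |(transfer m H θ₁ θ₂ (h + 1) *ᵥ θ₁.step h x (θ₁.forward h σ)) s
          - θ₂.step h x (transfer m H θ₁ θ₂ h *ᵥ θ₁.forward h σ) s| else 0)
      + ∑ s, |θ₂.step h x (transfer m H θ₁ θ₂ h *ᵥ θ₁.forward h σ - θ₂.forward h σ) s|)
    (hf' : ∀ σ x, ¬ alive h σ → f (extend σ x) = θ₂.prob (extend σ x) - θ₁.prob (extend σ x)) :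
    ∑ σ, π.pathWeight σ * f σ
      ≤ potential m H θ₁ θ₂ π alive h + aliveError m H θ₁ θ₂ π alive h := by
  rw [sum_extend, potential, aliveError, ← Finset.sum_add_distrib]
  refine Finset.sum_le_sum fun σ _ => ?_
  simp only [π.pathWeight_extend, mul_assoc]
  rw [← Finset.mul_sum, ← mul_add]
  refine mul_le_mul_of_nonneg_left ?_ (π.pathWeight_nonneg σ)
  have hp := fun o => π.prob_sum h σ o
  by_cases hal : alive h σ
  · rw [if_pos hal, if_pos hal, stepError_eq, add_comm]
    refine (Finset.sum_le_sum fun x _ =>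
      mul_le_mul_of_nonneg_left (hf σ x hal) (π.prob_nonneg h σ x.1 x.2)).trans ?_
    simp only [mul_add _ _ (∑ s, |θ₂.step h _ _ s|)]
    rw [Finset.sum_add_distrib]
    exact add_le_add le_rfl (θ₂.sum_mul_sum_abs_step_le (π.prob_nonneg h σ) hp h _)
  · rw [if_neg hal, if_neg hal, add_zero]
    simp only [hf' σ _ hal, mul_sub, Finset.sum_sub_distrib, POMDP.prob_extend,
      POMDP.sum_mul_sum_step _ hp]
    exact le_rfl

lemma potential_succ_le {h : ℕ} (hh : h + 1 < H)
    (halive : ∀ n σ x, alive (n + 1) (extend σ x) → alive n σ) :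
    potential m H θ₁ θ₂ π alive (h + 1)
      ≤ potential m H θ₁ θ₂ π alive h + aliveError m H θ₁ θ₂ π alive h := by
  refine sum_mul_extend_le _ (fun σ x hal => ?_) fun σ x hal => ?_
  · rw [if_pos hh]
    split_ifs with h1
    · rw [θ₁.forward_extend, θ₂.forward_extend, θ₂.step_sub]
      have h2 : ∀ s, |(transfer m H θ₁ θ₂ (h + 1) *ᵥ θ₁.step h x (θ₁.forward h σ)) s
          - θ₂.step h x (θ₂.forward h σ) s|
          ≤ |(transfer m H θ₁ θ₂ (h + 1) *ᵥ θ₁.step h x (θ₁.forward h σ)) s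
              - θ₂.step h x (transfer m H θ₁ θ₂ h *ᵥ θ₁.forward h σ) s|
            + |(θ₂.step h x (transfer m H θ₁ θ₂ h *ᵥ θ₁.forward h σ)
              - θ₂.step h x (θ₂.forward h σ)) s| := fun s => by
        rw [Pi.sub_apply]; exact abs_sub_le _ _ _
      have h3 := Finset.sum_le_sum fun s (_ : s ∈ Finset.univ) => h2 s
      rw [Finset.sum_add_distrib] at h3
      refine h3.trans (add_le_add ?_ le_rfl)
      exact le_add_of_nonneg_left (abs_nonneg _)
    · have h4 : 0 ≤ ∑ s, |(transfer m H θ₁ θ₂ (h + 1) *ᵥ θ₁.step h x (θ₁.forward h σ)) s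
          - θ₂.step h x (transfer m H θ₁ θ₂ h *ᵥ θ₁.forward h σ) s| :=
        Finset.sum_nonneg fun _ _ => abs_nonneg _
      have h5 : θ₂.prob (extend σ x) - θ₁.prob (extend σ x)
          = -(∑ s, (θ₁.step h x (θ₁.forward h σ) s
              - θ₂.step h x (transfer m H θ₁ θ₂ h *ᵥ θ₁.forward h σ) s))
            - ∑ s, θ₂.step h x (transfer m H θ₁ θ₂ h *ᵥ θ₁.forward h σ - θ₂.forward h σ) s := by
        simp only [θ₂.step_sub, Pi.sub_apply, Finset.sum_sub_distrib, POMDP.prob_extend]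
        ring
      have h6 := neg_abs_le (∑ s, (θ₁.step h x (θ₁.forward h σ) s
              - θ₂.step h x (transfer m H θ₁ θ₂ h *ᵥ θ₁.forward h σ) s))
      have h7 := neg_abs_le
        (∑ s, θ₂.step h x (transfer m H θ₁ θ₂ h *ᵥ θ₁.forward h σ - θ₂.forward h σ) s)
      have h8 := Finset.abs_sum_le_sum_abs
        (fun s => θ₂.step h x (transfer m H θ₁ θ₂ h *ᵥ θ₁.forward h σ - θ₂.forward h σ) s)
        Finset.univ
      linarith
  · rw [if_neg fun h1 => hal (halive h σ x h1)]

open Classical in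
lemma sum_prob_sub_le {h : ℕ} :
    ∑ σ : Fin (h + 1) → O × A, π.pathWeight σ *
        (if alive h (initial h (Nat.le_succ h) σ) then |θ₁.prob σ - θ₂.prob σ|
          else θ₂.prob σ - θ₁.prob σ)
      ≤ potential m H θ₁ θ₂ π alive h + aliveError m H θ₁ θ₂ π alive h := by
  have hin : ∀ (σ : Fin h → O × A) x, initial h (Nat.le_succ h) (extend σ x) = σ := fun σ x => by
    rw [initial_extend σ x le_rfl, initial_self]
  refine sum_mul_extend_le _ (fun σ x hal => ?_) fun σ x hal => ?_
  · rw [hin, if_pos hal]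
    have h4 : 0 ≤ if h + 1 < H then ∑ s, |(transfer m H θ₁ θ₂ (h + 1) *ᵥ
        θ₁.step h x (θ₁.forward h σ)) s
          - θ₂.step h x (transfer m H θ₁ θ₂ h *ᵥ θ₁.forward h σ) s| else 0 := by
      split_ifs
      · exact Finset.sum_nonneg fun _ _ => abs_nonneg _
      · exact le_rfl
    have h5 : θ₁.prob (extend σ x) - θ₂.prob (extend σ x)
        = (∑ s, (θ₁.step h x (θ₁.forward h σ) s
            - θ₂.step h x (transfer m H θ₁ θ₂ h *ᵥ θ₁.forward h σ) s))
          + ∑ s, θ₂.step h x (transfer m H θ₁ θ₂ h *ᵥ θ₁.forward h σ - θ₂.forward h σ) s := by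
      simp only [θ₂.step_sub, Pi.sub_apply, Finset.sum_sub_distrib, POMDP.prob_extend]
      ring
    have h6 := abs_add_le (∑ s, (θ₁.step h x (θ₁.forward h σ) s
            - θ₂.step h x (transfer m H θ₁ θ₂ h *ᵥ θ₁.forward h σ) s))
      (∑ s, θ₂.step h x (transfer m H θ₁ θ₂ h *ᵥ θ₁.forward h σ - θ₂.forward h σ) s)
    have h8 := Finset.abs_sum_le_sum_abs
      (fun s => θ₂.step h x (transfer m H θ₁ θ₂ h *ᵥ θ₁.forward h σ - θ₂.forward h σ) s)
      Finset.univ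
    rw [h5]
    linarith
  · rw [hin, if_neg hal]

lemma POMDP.psi_eq_mulVec (θ : POMDP O A S) (m H h : ℕ) (τ : Fin h → O × A) :
    θ.psi m H h τ = θ.emissionAction m H h *ᵥ θ.forward h τ := by
  funext q
  exact Finset.sum_congr rfl fun s _ => mul_comm _ _

lemma potential_zero [Nonempty S] {a : ℝ} (ha : 0 < a) (hH : 0 < H) (h₂ : θ₂.IsDecodable m H a)
    (hψ : ∀ τ : Fin 0 → O × A, θ₁.psi m H 0 τ = θ₂.psi m H 0 τ) :
    potential m H θ₁ θ₂ π alive 0 = 0 := by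
  refine Finset.sum_eq_zero fun σ _ => mul_eq_zero_of_right _ ?_
  split_ifs
  · refine Finset.sum_eq_zero fun s _ => ?_
    rw [transfer, ← Matrix.mulVec_mulVec, ← θ₁.psi_eq_mulVec, hψ, θ₂.psi_eq_mulVec,
      Matrix.mulVec_mulVec, pinv_mul_self ha (h₂ ⟨0, hH⟩), Matrix.one_mulVec, sub_self, abs_zero]
  · rw [θ₁.prob_zero, θ₂.prob_zero, sub_self]

lemma potential_le [Nonempty S] {a : ℝ} (ha : 0 < a) (h₂ : θ₂.IsDecodable m H a)
    (hψ : ∀ τ : Fin 0 → O × A, θ₁.psi m H 0 τ = θ₂.psi m H 0 τ)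
    (halive : ∀ n σ x, alive (n + 1) (extend σ x) → alive n σ) {h : ℕ} (hh : h < H) :
    potential m H θ₁ θ₂ π alive h ≤ ∑ j ∈ Finset.range h, aliveError m H θ₁ θ₂ π alive j := by
  induction h with
  | zero => rw [potential_zero ha hh h₂ hψ]; simp
  | succ h ih =>
    rw [Finset.sum_range_succ]
    exact (potential_succ_le hh halive).trans (add_le_add_left (ih (by omega)) _)

open Classical in
lemma sum_prob_sub_le_sum [Nonempty S] {a : ℝ} (ha : 0 < a) (h₂ : θ₂.IsDecodable m H a)
    (hψ : ∀ τ : Fin 0 → O × A, θ₁.psi m H 0 τ = θ₂.psi m H 0 τ)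
    (halive : ∀ n σ x, alive (n + 1) (extend σ x) → alive n σ) {h : ℕ} (hh : h < H) :
    ∑ σ : Fin (h + 1) → O × A, π.pathWeight σ *
        (if alive h (initial h (Nat.le_succ h) σ) then |θ₁.prob σ - θ₂.prob σ|
          else θ₂.prob σ - θ₁.prob σ)
      ≤ ∑ j ∈ Finset.range (h + 1), aliveError m H θ₁ θ₂ π alive j := by
  rw [Finset.sum_range_succ]
  exact sum_prob_sub_le.trans (add_le_add_left (potential_le ha h₂ hψ halive hh) _)

/-! ### Bounds on the one-step error -/

lemma sum_abs_transfer_le [DecidableEq A] [Nonempty A] [Nonempty S] {a g : ℝ} (ha : 0 < a)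
    (h₂ : θ₂.IsDecodable m H a) (hg : √(Fintype.card S) / a ≤ g) {h : ℕ} (hh : h < H)
    (v : S → ℝ) :
    ∑ s, |(transfer m H θ₁ θ₂ h *ᵥ v) s| ≤ g * (coreActsMax A m H * ∑ s, |v s|) := by
  rw [transfer, ← Matrix.mulVec_mulVec]
  refine (sum_abs_pinv_le ha (h₂ ⟨h, hh⟩) _).trans ?_
  have h1 := θ₁.sum_abs_emissionAction_mulVec_le (m := m) (by omega) hh.le v
  have h0 : 0 ≤ ∑ q, |(θ₁.emissionAction m H h *ᵥ v) q| :=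
    Finset.sum_nonneg fun _ _ => abs_nonneg _
  exact mul_le_mul hg h1 h0 ((by positivity : 0 ≤ √(Fintype.card S) / a).trans hg)

lemma stepError_le_norm [DecidableEq A] [Nonempty A] [Nonempty S] {a g : ℝ} (ha : 0 < a)
    (h₂ : θ₂.IsDecodable m H a) (hg : √(Fintype.card S) / a ≤ g) (hg1 : 1 ≤ g) {h : ℕ}
    (hh : h < H) {p : O → A → ℝ} (hp0 : ∀ o a, 0 ≤ p o a) (hp : ∀ o, ∑ a, p o a = 1)
    (v : S → ℝ) :
    stepError m H θ₁ θ₂ h p v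
      ≤ 4 * g * coreActsMax A m H * √(Fintype.card S) * √(v ⬝ᵥ v) := by
  set q : ℝ := (coreActsMax A m H : ℝ) with hq
  have hq1 : 1 ≤ q := by
    have h1 : 1 ≤ coreActsMax A m H := one_le_coreActsMax (by omega)
    rw [hq]
    exact_mod_cast h1
  set R := transfer m H θ₁ θ₂ h
  set Z := ∑ s, |v s| with hZ
  have hZ0 : 0 ≤ Z := Finset.sum_nonneg fun _ _ => abs_nonneg _
  have hR : ∑ s, |(R *ᵥ v) s| ≤ g * (q * Z) := sum_abs_transfer_le ha h₂ hg hh v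
  have h1 : ∀ x, |∑ s, (θ₁.step h x v s - θ₂.step h x (R *ᵥ v) s)|
      ≤ ∑ s, |θ₁.step h x v s| + ∑ s, |θ₂.step h x (R *ᵥ v) s| := fun x => by
    rw [Finset.sum_sub_distrib]
    refine (abs_sub _ _).trans ?_
    exact add_le_add (Finset.abs_sum_le_sum_abs _ _) (Finset.abs_sum_le_sum_abs _ _)
  have h2 : ∀ x, (if h + 1 < H then ∑ s, |(transfer m H θ₁ θ₂ (h + 1) *ᵥ θ₁.step h x v) s
      - θ₂.step h x (R *ᵥ v) s| else 0)
      ≤ g * (q * ∑ s, |θ₁.step h x v s|) + ∑ s, |θ₂.step h x (R *ᵥ v) s| := fun x => by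
    split_ifs with hlt
    · refine le_trans ?_ (add_le_add_left
        (sum_abs_transfer_le (θ₁ := θ₁) ha h₂ hg hlt (θ₁.step h x v)) _)
      rw [← Finset.sum_add_distrib]
      exact Finset.sum_le_sum fun s _ => abs_sub _ _
    · have e1 : 0 ≤ ∑ s, |θ₁.step h x v s| := Finset.sum_nonneg fun _ _ => abs_nonneg _
      have e2 : 0 ≤ ∑ s, |θ₂.step h x (R *ᵥ v) s| := Finset.sum_nonneg fun _ _ => abs_nonneg _
      positivity
  have h3 : stepError m H θ₁ θ₂ h p v ≤ (1 + g * q) * ∑ x : O × A, p x.1 x.2 *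
      ∑ s, |θ₁.step h x v s| + 2 * ∑ x : O × A, p x.1 x.2 * ∑ s, |θ₂.step h x (R *ᵥ v) s| := by
    rw [stepError_eq, Finset.mul_sum, Finset.mul_sum, ← Finset.sum_add_distrib]
    refine Finset.sum_le_sum fun x _ => ?_
    have := mul_le_mul_of_nonneg_left (add_le_add (h1 x) (h2 x)) (hp0 x.1 x.2)
    refine this.trans (le_of_eq ?_)
    ring
  have h4 := θ₁.sum_mul_sum_abs_step_le hp0 hp h v
  have h5 := (θ₂.sum_mul_sum_abs_step_le hp0 hp h (R *ᵥ v)).trans hR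
  have h6 : stepError m H θ₁ θ₂ h p v ≤ (1 + g * q) * Z + 2 * (g * (q * Z)) := by
    refine h3.trans (add_le_add (mul_le_mul_of_nonneg_left h4 (by positivity))
      (mul_le_mul_of_nonneg_left h5 zero_le_two))
  have h7 : Z ≤ √(Fintype.card S) * √(v ⬝ᵥ v) := sum_abs_le_sqrt v
  have h8 : Z ≤ g * q * Z := by
    have : 1 ≤ g * q := by nlinarith
    nlinarith
  calc stepError m H θ₁ θ₂ h p v ≤ 4 * g * q * Z := by nlinarith
    _ ≤ 4 * g * q * (√(Fintype.card S) * √(v ⬝ᵥ v)) := by gcongr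
    _ = _ := by ring

lemma abs_sum_sub_le [Nonempty A] (m H t : ℕ) (θ₁ θ₂ : POMDP O A S) (u v : S → ℝ) :
    |∑ s, (u s - v s)|
      ≤ ∑ q, |(θ₁.emissionAction m H t *ᵥ u) q - (θ₂.emissionAction m H t *ᵥ v) q| := by
  classical
  set as : Fin (min (m - 1) (H - t)) → A := fun _ => Classical.arbitrary A
  have e : ∀ (θ : POMDP O A S) (w : S → ℝ),
      ∑ o, (θ.emissionAction m H t *ᵥ w) (o, as) = ∑ s, w s := fun θ w => by
    simp only [Matrix.mulVec, dotProduct]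
    rw [Finset.sum_comm]
    exact Finset.sum_congr rfl fun s _ => by
      rw [← Finset.sum_mul, θ.sum_emissionAction_obs, one_mul]
  rw [Finset.sum_sub_distrib, ← e θ₁ u, ← e θ₂ v, ← Finset.sum_sub_distrib]
  refine (Finset.abs_sum_le_sum_abs _ _).trans ?_
  rw [Fintype.sum_prod_type]
  exact Finset.sum_le_sum fun o _ => Finset.single_le_sum
    (f := fun as => |(θ₁.emissionAction m H t *ᵥ u) (o, as)
      - (θ₂.emissionAction m H t *ᵥ v) (o, as)|) (fun _ _ => abs_nonneg _) (Finset.mem_univ as)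

lemma sum_abs_transfer_belief_sub_le [DecidableEq A] [Nonempty A] [Nonempty S] {a g : ℝ}
    (ha : 0 < a) (hm : 1 ≤ m) (h₂ : θ₂.IsDecodable m H a) (hg : √(Fintype.card S) / a ≤ g)
    (ρ : Policy O A) {h : ℕ} (hh : h < H) (σ : Fin h → O × A) :
    ∑ s, |(transfer m H θ₁ θ₂ h *ᵥ θ₁.belief σ - θ₂.belief σ) s|
      ≤ g * (2 * Fintype.card A * coreActsMax A m H * condTV m ρ θ₁ θ₂ hh.le σ) := by
  have h1 : transfer m H θ₁ θ₂ h *ᵥ θ₁.belief σ - θ₂.belief σ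
      = pinv (θ₂.emissionAction m H h) *ᵥ (θ₁.psiBar m H h σ - θ₂.psiBar m H h σ) := by
    rw [Matrix.mulVec_sub, θ₁.psiBar_eq, θ₂.psiBar_eq, Matrix.mulVec_mulVec,
      Matrix.mulVec_mulVec, pinv_mul_self ha (h₂ ⟨h, hh⟩), Matrix.one_mulVec, transfer]
  rw [h1]
  refine (sum_abs_pinv_le ha (h₂ ⟨h, hh⟩) _).trans ?_
  have h0 : 0 ≤ ∑ q, |(θ₁.psiBar m H h σ - θ₂.psiBar m H h σ) q| :=
    Finset.sum_nonneg fun _ _ => abs_nonneg _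
  refine mul_le_mul hg ?_ h0 ((by positivity : 0 ≤ √(Fintype.card S) / a).trans hg)
  refine (sum_abs_psiBar_sub_le θ₁ θ₂ ρ hm hh σ).trans ?_
  exact mul_le_mul_of_nonneg_right (card_exploreActs_le hh) (condTV_nonneg _ _ _ _ _ _)

/-- At a belief of `θ₁` the one-step error is bounded by the distance of the conditional laws of
the continuations under the exploration policy. -/
lemma stepError_belief_le [DecidableEq A] [Nonempty A] [Nonempty S] {a g : ℝ} (ha : 0 < a)
    (hm : 1 ≤ m) (h₂ : θ₂.IsDecodable m H a) (hg : √(Fintype.card S) / a ≤ g) (hg1 : 1 ≤ g)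
    (ρ : Policy O A) {h : ℕ} (hh : h < H) {p : O → A → ℝ} (hp0 : ∀ o a, 0 ≤ p o a)
    (hp : ∀ o, ∑ a, p o a = 1) (σ : Fin h → O × A) :
    stepError m H θ₁ θ₂ h p (θ₁.belief σ)
      ≤ 8 * g * Fintype.card A * coreActsMax A m H * condTV m ρ θ₁ θ₂ hh.le σ := by
  set R := transfer m H θ₁ θ₂ h
  set b₁ := θ₁.belief σ
  set b₂ := θ₂.belief σ
  set T := 2 * Fintype.card A * coreActsMax A m H * condTV m ρ θ₁ θ₂ hh.le σ with hT
  have hT0 : 0 ≤ T := mul_nonneg (by positivity) (condTV_nonneg _ _ _ _ _ _)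
  set d : O × A → ℝ := fun x => ∑ q, |(θ₁.emissionAction m H (h + 1) *ᵥ θ₁.step h x b₁) q
        - (θ₂.emissionAction m H (h + 1) *ᵥ θ₂.step h x b₂) q| with hd
  have hd0 : ∀ x, 0 ≤ d x := fun x => Finset.sum_nonneg fun _ _ => abs_nonneg _
  set f : O × A → ℝ := fun x => ∑ s, |θ₂.step h x (R *ᵥ b₁ - b₂) s| with hf
  have hf0 : ∀ x, 0 ≤ f x := fun x => Finset.sum_nonneg fun _ _ => abs_nonneg _
  have hp1 : ∀ o a, p o a ≤ 1 := fun o a => by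
    rw [← hp o]
    exact Finset.single_le_sum (fun a _ => hp0 o a) (Finset.mem_univ a)
  have hsum : ∑ x, d x ≤ T := by
    refine (sum_abs_step_sub_le θ₁ θ₂ ρ hm hh σ).trans ?_
    exact mul_le_mul_of_nonneg_right (card_exploreActs_le hh) (condTV_nonneg _ _ _ _ _ _)
  have h1 : ∀ x, |∑ s, (θ₁.step h x b₁ s - θ₂.step h x (R *ᵥ b₁) s)| ≤ d x + f x := fun x => by
    have e : ∑ s, (θ₁.step h x b₁ s - θ₂.step h x (R *ᵥ b₁) s)
        = ∑ s, (θ₁.step h x b₁ s - θ₂.step h x b₂ s) - ∑ s, θ₂.step h x (R *ᵥ b₁ - b₂) s := by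
      rw [θ₂.step_sub, ← Finset.sum_sub_distrib]
      exact Finset.sum_congr rfl fun s _ => by rw [Pi.sub_apply]; ring
    rw [e]
    exact (abs_sub _ _).trans
      (add_le_add (abs_sum_sub_le m H (h + 1) θ₁ θ₂ _ _) (Finset.abs_sum_le_sum_abs _ _))
  have h2 : ∀ x, (if h + 1 < H then ∑ s, |(transfer m H θ₁ θ₂ (h + 1) *ᵥ θ₁.step h x b₁) s
      - θ₂.step h x (R *ᵥ b₁) s| else 0) ≤ g * d x + f x := fun x => by
    split_ifs with hlt
    · have e : ∀ s, (transfer m H θ₁ θ₂ (h + 1) *ᵥ θ₁.step h x b₁) s - θ₂.step h x (R *ᵥ b₁) s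
          = (pinv (θ₂.emissionAction m H (h + 1)) *ᵥ
              (θ₁.emissionAction m H (h + 1) *ᵥ θ₁.step h x b₁
                - θ₂.emissionAction m H (h + 1) *ᵥ θ₂.step h x b₂)) s
            - θ₂.step h x (R *ᵥ b₁ - b₂) s := fun s => by
        rw [Matrix.mulVec_sub, Matrix.mulVec_mulVec, Matrix.mulVec_mulVec,
          pinv_mul_self ha (h₂ ⟨h + 1, hlt⟩), Matrix.one_mulVec, θ₂.step_sub, transfer,
          Pi.sub_apply, Pi.sub_apply]
        ring
      simp only [e]
      refine (Finset.sum_le_sum fun s _ => abs_sub _ _).trans ?_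
      rw [Finset.sum_add_distrib]
      refine add_le_add ((sum_abs_pinv_le ha (h₂ ⟨h + 1, hlt⟩) _).trans ?_) le_rfl
      exact mul_le_mul_of_nonneg_right hg (hd0 x)
    · have := hd0 x
      have := hf0 x
      positivity
  have h3 : stepError m H θ₁ θ₂ h p b₁ ≤ (1 + g) * ∑ x, d x
      + 2 * ∑ x : O × A, p x.1 x.2 * f x := by
    rw [stepError_eq, Finset.mul_sum, Finset.mul_sum, ← Finset.sum_add_distrib]
    refine Finset.sum_le_sum fun x _ => ?_
    have := mul_le_mul_of_nonneg_left (add_le_add (h1 x) (h2 x)) (hp0 x.1 x.2)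
    refine this.trans ?_
    have e1 : p x.1 x.2 * ((1 + g) * d x) ≤ 1 * ((1 + g) * d x) :=
      mul_le_mul_of_nonneg_right (hp1 _ _) (mul_nonneg (by positivity) (hd0 x))
    linarith
  have h4 : ∑ x : O × A, p x.1 x.2 * f x ≤ g * T :=
    (θ₂.sum_mul_sum_abs_step_le hp0 hp h _).trans
      (sum_abs_transfer_belief_sub_le ha hm h₂ hg ρ hh σ)
  calc stepError m H θ₁ θ₂ h p b₁ ≤ (1 + g) * T + 2 * (g * T) := by
        refine h3.trans (add_le_add (mul_le_mul_of_nonneg_left hsum (by positivity)) ?_)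
        exact mul_le_mul_of_nonneg_left h4 zero_le_two
    _ ≤ 4 * g * T := by nlinarith
    _ = _ := by rw [hT]; ring

/-- The one-step error is controlled by the norm of the belief for the inverse of the second-moment
matrix of the beliefs at the histories `d i`. -/
lemma stepError_le_invNormSq [DecidableEq A] [Nonempty A] [Nonempty S] {a g lam : ℝ} (ha : 0 < a)
    (hm : 1 ≤ m) (h₂ : θ₂.IsDecodable m H a) (hg : √(Fintype.card S) / a ≤ g) (hg1 : 1 ≤ g)
    (hlam : 0 < lam) (ρ : Policy O A) {h : ℕ} (hh : h < H) {p : O → A → ℝ}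
    (hp0 : ∀ o a, 0 ≤ p o a) (hp : ∀ o, ∑ a, p o a = 1) {ι : Type*} (I : Finset ι)
    (d : ι → Fin h → O × A) (v : S → ℝ) :
    stepError m H θ₁ θ₂ h p v
      ≤ √(lam * (4 * g * coreActsMax A m H * √(Fintype.card S)) ^ 2
          + (8 * g * Fintype.card A * coreActsMax A m H) ^ 2
            * ∑ i ∈ I, condTV m ρ θ₁ θ₂ hh.le (d i) ^ 2)
        * √(invNormSq lam I (fun i => θ₁.belief (d i)) v) :=
  (supported_stepError m H θ₁ θ₂ h hp0).le_sqrt_mul_sqrt hlam (by positivity)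
    (stepError_le_norm ha h₂ hg hg1 hh hp0 hp)
    (fun i _ => stepError_belief_le ha hm h₂ hg hg1 ρ hh hp0 hp (d i)) v

end Simulation

/-! ### The bonus bounds the distance of two models -/

section Bonus

variable {O A S : Type*} [Fintype O] [Fintype A] [Fintype S] [DecidableEq S] {H : ℕ}

/-- The squared norm of the belief of `θ` after the history `σ`, for the inverse of the regularized
second-moment matrix of the beliefs at the data. -/
def beliefNormSq (lam : ℝ) (θ : POMDP O A S) {k : ℕ} (D : Data O A H k) (h : Fin H)
    (σ : Fin h → O × A) : ℝ :=
  invNormSq lam Finset.univ (fun i => θ.belief (past (D i h) h)) (θ.belief σ)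

lemma beliefNormSq_nonneg {lam : ℝ} (hlam : 0 < lam) (θ : POMDP O A S) {k : ℕ}
    (D : Data O A H k) (h : Fin H) (σ : Fin h → O × A) : 0 ≤ beliefNormSq lam θ D h σ :=
  invNormSq_nonneg hlam _

lemma bonus_eq [DecidableEq A] [Nonempty S] {m : ℕ} {lam α a : ℝ} (ha : 0 < a) (θ : POMDP O A S)
    (hθ : θ.IsDecodable m H a) {k : ℕ} (D : Data O A H k) (τ : Traj O A H) :
    bonus m lam α θ D τ = min (α * √(∑ h, beliefNormSq lam θ D h (past τ h))) 1 := by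
  simp only [bonus, gram, reducedFeature_eq_belief θ ha hθ, beliefNormSq, invNormSq, momentMatrix]

lemma bonus_nonneg {m : ℕ} {lam α : ℝ} (hα : 0 ≤ α) (θ : POMDP O A S) {k : ℕ}
    (D : Data O A H k) (τ : Traj O A H) : 0 ≤ bonus m lam α θ D τ :=
  le_min (mul_nonneg hα (Real.sqrt_nonneg _)) zero_le_one

/-- The squared norms of the beliefs along the first steps of a history. -/
def cumNormSq (y : (h : Fin H) → (Fin h → O × A) → ℝ) (n : ℕ) (σ : Fin n → O × A) : ℝ :=
  ∑ j : Fin H, if hj : j.val ≤ n then y j (initial j hj σ) else 0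

lemma cumNormSq_extend_le {y : (h : Fin H) → (Fin h → O × A) → ℝ} (hy : ∀ h σ, 0 ≤ y h σ)
    (n : ℕ) (σ : Fin n → O × A) (x : O × A) :
    cumNormSq y n σ ≤ cumNormSq y (n + 1) (extend σ x) := by
  refine Finset.sum_le_sum fun j _ => ?_
  by_cases hj : j.val ≤ n
  · rw [dif_pos hj, dif_pos (hj.trans (Nat.le_succ n)), initial_extend σ x hj]
  · rw [dif_neg hj]
    split_ifs
    · exact hy _ _
    · exact le_rfl

lemma cumNormSq_initial (y : (h : Fin H) → (Fin h → O × A) → ℝ) {n : ℕ} (hn : n ≤ H)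
    (τ : Traj O A H) :
    cumNormSq y n (initial n hn τ) = ∑ j : Fin H, if j.val ≤ n then y j (past τ j) else 0 := by
  refine Finset.sum_congr rfl fun j _ => ?_
  by_cases hj : j.val ≤ n
  · rw [dif_pos hj, if_pos hj]; rfl
  · rw [dif_neg hj, if_neg hj]

open Classical in
/-- The terms up to the first time at which the accumulated sum is large contribute at most the
clipped square root of the whole sum. -/
lemma sqrt_sum_alive_le {y : (h : Fin H) → (Fin h → O × A) → ℝ} (hy : ∀ h σ, 0 ≤ y h σ)
    {α : ℝ} (hα : 0 < α) (τ : Traj O A H) :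
    α * √(∑ j : Fin H, if α * √(cumNormSq y j (past τ j)) < 1 then y j (past τ j) else 0)
      ≤ min (α * √(∑ j, y j (past τ j))) 1 := by
  refine le_min ?_ ?_
  · gcongr with j
    split_ifs
    · exact le_rfl
    · exact hy _ _
  · by_cases hne : ∃ j : Fin H, α * √(cumNormSq y j (past τ j)) < 1
    · -- the last time at which the accumulated sum is small
      obtain ⟨j, hj, hmax⟩ := (Finset.univ.filter fun j : Fin H =>
        α * √(cumNormSq y j (past τ j)) < 1).exists_max_image id (by
          obtain ⟨j, hj⟩ := hne
          exact ⟨j, by simpa using hj⟩)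
      simp only [Finset.mem_filter, Finset.mem_univ, true_and, id] at hj hmax
      refine le_trans ?_ hj.le
      gcongr
      rw [past, cumNormSq_initial]
      refine Finset.sum_le_sum fun i _ => ?_
      split_ifs with h1 h2
      · exact le_rfl
      · exact absurd (hmax i h1) h2
      · exact hy _ _
      · exact le_rfl
    · push Not at hne
      simp only [not_lt.mpr (hne _), if_false, Finset.sum_const_zero, Real.sqrt_zero, mul_zero]
      exact zero_le_one

lemma aliveError_le [DecidableEq A] [Nonempty A] [Nonempty S] {m : ℕ} {a g lam : ℝ}
    {θ₁ θ₂ : POMDP O A S} (ha : 0 < a) (hm : 1 ≤ m) (h₂ : θ₂.IsDecodable m H a)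
    (hg : √(Fintype.card S) / a ≤ g) (hg1 : 1 ≤ g) (hlam : 0 < lam) (ρ π : Policy O A) {k : ℕ}
    (D : Data O A H k) (alive : (n : ℕ) → (Fin n → O × A) → Prop) (h : Fin H) [DecidablePred (alive h)] :
    aliveError m H θ₁ θ₂ π alive h ≤ ∑ τ : Traj O A H, θ₁.prob τ * π.pathWeight τ *
      (√(lam * (4 * g * coreActsMax A m H * √(Fintype.card S)) ^ 2
          + (8 * g * Fintype.card A * coreActsMax A m H) ^ 2
            * ∑ i, condTV m ρ θ₁ θ₂ h.isLt.le (past (D i h) h) ^ 2)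
        * if alive h (past τ h) then √(beliefNormSq lam θ₁ D h (past τ h)) else 0) := by
  set ζ := √(lam * (4 * g * coreActsMax A m H * √(Fintype.card S)) ^ 2
          + (8 * g * Fintype.card A * coreActsMax A m H) ^ 2
            * ∑ i, condTV m ρ θ₁ θ₂ h.isLt.le (past (D i h) h) ^ 2) with hζ
  have key := sum_prob_mul_initial θ₁ π h.isLt.le
    fun σ => ζ * if alive h σ then √(beliefNormSq lam θ₁ D h σ) else 0
  refine le_trans ?_ key.ge
  refine Finset.sum_le_sum fun σ _ => ?_
  rw [mul_comm (θ₁.prob σ), mul_assoc]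
  refine mul_le_mul_of_nonneg_left ?_ (π.pathWeight_nonneg σ)
  by_cases hal : alive h σ
  · rw [if_pos hal, if_pos hal, ← θ₁.smul_belief, stepError_smul _ _ _ _ _ _ (θ₁.prob_nonneg σ)]
    refine mul_le_mul_of_nonneg_left ?_ (θ₁.prob_nonneg σ)
    exact stepError_le_invNormSq ha hm h₂ hg hg1 hlam ρ h.isLt (π.prob_nonneg h σ)
      (π.prob_sum h σ) Finset.univ (fun i => past (D i h) h) (θ₁.belief σ)
  · rw [if_neg hal, if_neg hal, mul_zero, mul_zero]

/-- The sum over the steps of the squared coefficients in the bound on the one-step errors. -/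
lemma sum_sq_coeff_le {Hr r q A' g lam β : ℝ} (hg1 : 1 ≤ g) (hlam : 0 < lam) (hr : 0 ≤ r)
    (hH : 0 ≤ Hr) (hq : 0 ≤ q) (hA : 0 ≤ A') (hβ : 0 ≤ β) :
    Hr * (lam * (4 * g * q * √r) ^ 2) + (8 * g * A' * q) ^ 2 * (64 * β)
      ≤ (64 * (q * √(Hr * r) * g ^ 2 * √lam + A' * q * √β * g)) ^ 2 := by
  have e1 : (√r) ^ 2 = r := Real.sq_sqrt hr
  have e2 : (√(Hr * r)) ^ 2 = Hr * r := Real.sq_sqrt (by positivity)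
  have e3 : (√lam) ^ 2 = lam := Real.sq_sqrt hlam.le
  have e4 : (√β) ^ 2 = β := Real.sq_sqrt hβ
  have h1 : Hr * (lam * (4 * g * q * √r) ^ 2) ≤ (64 * (q * √(Hr * r) * g ^ 2 * √lam)) ^ 2 := by
    have l : Hr * (lam * (4 * g * q * √r) ^ 2) = 16 * (Hr * r * lam * q ^ 2) * g ^ 2 := by
      rw [mul_pow, e1]; ring
    have l' : (64 * (q * √(Hr * r) * g ^ 2 * √lam)) ^ 2
        = 4096 * (Hr * r * lam * q ^ 2) * (g ^ 2) ^ 2 := by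
      rw [mul_pow, mul_pow, mul_pow, mul_pow, e2, e3]; ring
    rw [l, l']
    have h0 : 0 ≤ Hr * r * lam * q ^ 2 := by positivity
    have h2 : g ^ 2 ≤ (g ^ 2) ^ 2 := by
      have : 1 ≤ g ^ 2 := one_le_pow₀ hg1
      nlinarith
    nlinarith
  have h2 : (8 * g * A' * q) ^ 2 * (64 * β) = (64 * (A' * q * √β * g)) ^ 2 := by
    rw [mul_pow 64, mul_pow (A' * q * √β), mul_pow (A' * q), e4]; ring
  have h3 : 0 ≤ (64 * (q * √(Hr * r) * g ^ 2 * √lam)) * (64 * (A' * q * √β * g)) := by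
    positivity
  rw [h2]
  nlinarith

/-- The hypothesis that two models predict the continuations of the histories in the data almost
equally well. -/
def CloseOnData (m : ℕ) (ρ : Policy O A) [DecidableEq A] (θ₁ θ₂ : POMDP O A S) {k : ℕ}
    (D : Data O A H k) (β : ℝ) : Prop :=
  ∑ h : Fin H, ∑ i, condTV m ρ θ₁ θ₂ h.isLt.le (past (D i h) h) ^ 2 ≤ 64 * β

lemma CloseOnData.symm {m : ℕ} {ρ : Policy O A} [DecidableEq A] {θ₁ θ₂ : POMDP O A S} {k : ℕ}
    {D : Data O A H k} {β : ℝ} (h : CloseOnData m ρ θ₁ θ₂ D β) : CloseOnData m ρ θ₂ θ₁ D β := by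
  rw [CloseOnData]
  simp only [condTV_comm m ρ θ₂ θ₁]
  exact h

/-- The factor `α / c` in the bonus. -/
def bonusScale (A' r q g Hr lam β : ℝ) : ℝ := q * √(Hr * r) * g ^ 2 * √lam + A' * q * √β * g

open Classical in
/-- The total one-step error up to any step, on the histories that are alive. -/
lemma sum_aliveError_le [DecidableEq A] [Nonempty A] [Nonempty S] {m : ℕ} {a g lam β : ℝ}
    {θ₁ θ₂ : POMDP O A S} (ha : 0 < a) (hm : 1 ≤ m) (h₂ : θ₂.IsDecodable m H a)
    (hg : √(Fintype.card S) / a ≤ g) (hg1 : 1 ≤ g) (hlam : 0 < lam) (hβ : 0 ≤ β)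
    (ρ π : Policy O A) {k : ℕ} (D : Data O A H k) (hD : CloseOnData m ρ θ₁ θ₂ D β)
    (alive : (n : ℕ) → (Fin n → O × A) → Prop) :
    ∑ h ∈ Finset.range H, aliveError m H θ₁ θ₂ π alive h
      ≤ ∑ τ : Traj O A H, θ₁.prob τ * π.pathWeight τ *
        (64 * bonusScale (Fintype.card A) (Fintype.card S) (coreActsMax A m H) g H lam β *
          √(∑ h : Fin H, if alive h (past τ h) then beliefNormSq lam θ₁ D h (past τ h) else 0)) := by
  rw [Finset.sum_range]
  refine (Finset.sum_le_sum fun h _ =>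
    aliveError_le ha hm h₂ hg hg1 hlam ρ π D alive h).trans ?_
  rw [Finset.sum_comm]
  refine Finset.sum_le_sum fun τ _ => ?_
  rw [← Finset.mul_sum]
  refine mul_le_mul_of_nonneg_left ?_ (mul_nonneg (θ₁.prob_nonneg τ) (π.pathWeight_nonneg τ))
  set z : Fin H → ℝ := fun h => lam * (4 * g * coreActsMax A m H * √(Fintype.card S)) ^ 2
          + (8 * g * Fintype.card A * coreActsMax A m H) ^ 2
            * ∑ i, condTV m ρ θ₁ θ₂ h.isLt.le (past (D i h) h) ^ 2 with hz
  have hz0 : ∀ h, 0 ≤ z h := fun h => add_nonneg (by positivity)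
    (mul_nonneg (by positivity) (Finset.sum_nonneg fun _ _ => sq_nonneg _))
  set w : Fin H → ℝ := fun h =>
    if alive h (past τ h) then beliefNormSq lam θ₁ D h (past τ h) else 0 with hw
  have hw0 : ∀ h, 0 ≤ w h := fun h => by
    simp only [hw]
    split_ifs
    · exact beliefNormSq_nonneg hlam _ _ _ _
    · exact le_rfl
  have hzsum : ∑ h, z h ≤ (64 * bonusScale (Fintype.card A) (Fintype.card S)
      (coreActsMax A m H) g H lam β) ^ 2 := by
    refine le_trans ?_ (sum_sq_coeff_le hg1 hlam (Nat.cast_nonneg _) (Nat.cast_nonneg _)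
      (Nat.cast_nonneg _) (Nat.cast_nonneg _) hβ)
    rw [hz, Finset.sum_add_distrib, Finset.sum_const, Finset.card_univ, Fintype.card_fin,
      nsmul_eq_mul, ← Finset.mul_sum]
    exact add_le_add le_rfl (mul_le_mul_of_nonneg_left hD (sq_nonneg _))
  have hscale : 0 ≤ 64 * bonusScale (Fintype.card A) (Fintype.card S)
      (coreActsMax A m H) g H lam β := by
    rw [bonusScale]
    positivity
  calc ∑ h, √(z h) * (if alive h (past τ h) then √(beliefNormSq lam θ₁ D h (past τ h)) else 0)
      = ∑ h, √(z h) * √(w h) := by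
        refine Finset.sum_congr rfl fun h _ => ?_
        simp only [hw]
        split_ifs <;> simp
    _ ≤ √(∑ h, z h) * √(∑ h, w h) :=
        Real.sum_sqrt_mul_sqrt_le Finset.univ hz0 hw0
    _ ≤ _ := by
        refine mul_le_mul_of_nonneg_right ?_ (Real.sqrt_nonneg _)
        exact Real.sqrt_le_iff.mpr ⟨hscale, hzsum⟩

lemma POMDP.value_eq (θ : POMDP O A S) (π : Policy O A) (f : Traj O A H → ℝ) :
    θ.value π f = ∑ τ : Traj O A H, θ.prob τ * π.pathWeight τ * f τ := by
  simp only [POMDP.value, π.weight_zero_eq le_rfl, initial_self]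

lemma tvDist_eq (θ₁ θ₂ : POMDP O A S) (π : Policy O A) :
    tvDist H θ₁ θ₂ π = ∑ τ : Traj O A H, π.pathWeight τ * |θ₁.prob τ - θ₂.prob τ| := by
  simp only [tvDist, π.weight_zero_eq le_rfl, initial_self]
  refine Finset.sum_congr rfl fun τ _ => ?_
  rw [← sub_mul, abs_mul, abs_of_nonneg (π.pathWeight_nonneg τ), mul_comm]

/-- The distance of two models that are close on the data is bounded by the value of the bonus
under the first one. The factor is close to `2` for large `c`: the histories are cut where the
bonus reaches its maximal value `1`, where the distance is at most `2`, and before that the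
telescoping error is small relative to the bonus. -/
lemma tvDist_le_value_bonus [DecidableEq A] [Nonempty A] [Nonempty S] {m : ℕ}
    {a g lam β c : ℝ} {θ₁ θ₂ : POMDP O A S} (ha : 0 < a) (hm : 1 ≤ m)
    (hH : 1 ≤ H) (h₁ : θ₁.IsDecodable m H a) (h₂ : θ₂.IsDecodable m H a)
    (hψ : ∀ τ : Fin 0 → O × A, θ₁.psi m H 0 τ = θ₂.psi m H 0 τ)
    (hg : √(Fintype.card S) / a ≤ g) (hg1 : 1 ≤ g) (hlam : 0 < lam) (hβ : 0 < β) (hc : 0 < c)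
    (ρ π : Policy O A) {k : ℕ} (D : Data O A H k) (hD : CloseOnData m ρ θ₁ θ₂ D β) :
    tvDist H θ₁ θ₂ π ≤ (2 + 64 / c) * θ₁.value π (bonus m lam
      (c * bonusScale (Fintype.card A) (Fintype.card S) (coreActsMax A m H) g H lam β) θ₁ D) := by
  classical
  set B := bonusScale (Fintype.card A) (Fintype.card S) (coreActsMax A m H) g H lam β with hB
  have hB0 : 0 < B := by
    have hq : (0 : ℝ) < coreActsMax A m H := by
      exact_mod_cast one_le_coreActsMax (A := A) (m := m) hH
    have hA : (0 : ℝ) < Fintype.card A := by exact_mod_cast Fintype.card_pos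
    have h1 : 0 < √β := Real.sqrt_pos.mpr hβ
    rw [hB, bonusScale]
    positivity
  set α := c * B with hα
  have hα0 : 0 < α := by positivity
  set y : (h : Fin H) → (Fin h → O × A) → ℝ := fun h σ => beliefNormSq lam θ₁ D h σ with hy
  have hy0 : ∀ h σ, 0 ≤ y h σ := fun h σ => beliefNormSq_nonneg hlam θ₁ D h σ
  set alive : (n : ℕ) → (Fin n → O × A) → Prop := fun n σ => α * √(cumNormSq y n σ) < 1
    with halive
  have hmono : ∀ n σ x, alive (n + 1) (extend σ x) → alive n σ := fun n σ x h =>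
    lt_of_le_of_lt (by gcongr; exact cumNormSq_extend_le hy0 n σ x) h
  obtain ⟨n, rfl⟩ : ∃ n, H = n + 1 := ⟨H - 1, by omega⟩
  have key := sum_prob_sub_le_sum (π := π) ha h₂ hψ hmono (Nat.lt_succ_self n)
  have key2 := key.trans (sum_aliveError_le ha hm h₂ hg hg1 hlam hβ.le ρ π D hD alive)
  have hbonus : ∀ τ, bonus m lam α θ₁ D τ = min (α * √(∑ h, y h (past τ h))) 1 :=
    bonus_eq ha θ₁ h₁ D
  have hdead : ∀ τ : Traj O A (n + 1), ¬ alive n (initial n (Nat.le_succ n) τ) →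
      bonus m lam α θ₁ D τ = 1 := by
    intro τ h
    simp only [halive, not_lt] at h
    rw [hbonus, min_eq_right]
    refine h.trans ?_
    rw [cumNormSq_initial]
    gcongr with j
    split_ifs
    · exact le_rfl
    · exact hy0 _ _
  have hpoint : ∀ τ : Traj O A (n + 1),
      64 * B * √(∑ h : Fin (n + 1), if alive h (past τ h) then y h (past τ h) else 0)
        ≤ 64 / c * bonus m lam α θ₁ D τ := by
    intro τ
    rw [hbonus]
    refine le_trans (le_of_eq ?_) (mul_le_mul_of_nonneg_left (sqrt_sum_alive_le hy0 hα0 τ)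
      (by positivity : 0 ≤ 64 / c))
    have e : 64 * B = 64 / c * α := by rw [hα]; field_simp
    rw [e, mul_assoc]
  have key3 : ∑ τ : Traj O A (n + 1), θ₁.prob τ * π.pathWeight τ *
      (64 * B * √(∑ h : Fin (n + 1), if alive h (past τ h) then y h (past τ h) else 0))
      ≤ 64 / c * θ₁.value π (bonus m lam α θ₁ D) := by
    rw [θ₁.value_eq, Finset.mul_sum]
    refine Finset.sum_le_sum fun τ _ => ?_
    have := mul_le_mul_of_nonneg_left (hpoint τ)
      (mul_nonneg (θ₁.prob_nonneg τ) (π.pathWeight_nonneg τ))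
    linarith
  have key4 := key2.trans key3
  have key5 : tvDist (n + 1) θ₁ θ₂ π ≤ ∑ τ : Traj O A (n + 1), π.pathWeight τ *
        (if alive n (initial n (Nat.le_succ n) τ) then |θ₁.prob τ - θ₂.prob τ|
          else θ₂.prob τ - θ₁.prob τ) + 2 * θ₁.value π (bonus m lam α θ₁ D) := by
    rw [tvDist_eq, θ₁.value_eq, Finset.mul_sum, ← Finset.sum_add_distrib]
    refine Finset.sum_le_sum fun τ _ => ?_
    have hp := θ₁.prob_nonneg τ
    have hp2 := θ₂.prob_nonneg τ
    have hw := π.pathWeight_nonneg τ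
    split_ifs with hal
    · have := bonus_nonneg (m := m) (lam := lam) hα0.le θ₁ D τ
      have : 0 ≤ 2 * (θ₁.prob τ * π.pathWeight τ * bonus m lam α θ₁ D τ) := by positivity
      linarith
    · rw [hdead τ hal]
      have : |θ₁.prob τ - θ₂.prob τ| ≤ θ₂.prob τ - θ₁.prob τ + 2 * θ₁.prob τ := by
        rw [abs_le]; constructor <;> linarith
      nlinarith
  linarith

/-- A planner that is optimal for a model close to the true one is nearly optimal. -/
lemma value_sub_value_le {θ θ' : POMDP O A S} {e : ℝ} (h : ∀ π, tvDist H θ θ' π ≤ e)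
    {R : Traj O A H → ℝ} (hR : ∀ τ, 0 ≤ R τ ∧ R τ ≤ 1) {πbar : Policy O A}
    (hπ : θ.IsGreedy R πbar) (π : Policy O A) : θ'.value π R - θ'.value πbar R ≤ e := by
  -- as both laws have mass one, the values differ by at most half of the distance
  have key : ∀ π : Policy O A, |θ.value π R - θ'.value π R| ≤ e / 2 := by
    intro π
    have h1 : θ.value π R - θ'.value π R
        = ∑ τ : Traj O A H, (θ.prob τ - θ'.prob τ) * π.pathWeight τ * (R τ - 1 / 2) := by
      have e1 := sum_prob_mul_pathWeight θ π H
      have e2 := sum_prob_mul_pathWeight θ' π H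
      have e3 : ∑ τ : Traj O A H, (θ.prob τ - θ'.prob τ) * π.pathWeight τ * (R τ - 1 / 2)
          = (∑ τ : Traj O A H, θ.prob τ * π.pathWeight τ * R τ
            - ∑ τ : Traj O A H, θ'.prob τ * π.pathWeight τ * R τ)
            - (1 / 2) * (∑ τ : Traj O A H, θ.prob τ * π.pathWeight τ
              - ∑ τ : Traj O A H, θ'.prob τ * π.pathWeight τ) := by
        simp only [Finset.mul_sum, mul_sub, ← Finset.sum_sub_distrib]
        exact Finset.sum_congr rfl fun τ _ => by ring
      rw [e3, e1, e2, sub_self, mul_zero, sub_zero, θ.value_eq, θ'.value_eq]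
    rw [h1]
    have h2 := h π
    rw [tvDist_eq] at h2
    calc |∑ τ : Traj O A H, (θ.prob τ - θ'.prob τ) * π.pathWeight τ * (R τ - 1 / 2)|
        ≤ ∑ τ : Traj O A H, (π.pathWeight τ * |θ.prob τ - θ'.prob τ|) * (1 / 2) := by
          refine (Finset.abs_sum_le_sum_abs _ _).trans (Finset.sum_le_sum fun τ _ => ?_)
          rw [abs_mul, abs_mul, abs_of_nonneg (π.pathWeight_nonneg τ),
            mul_comm (π.pathWeight τ)]
          have hR1 : |R τ - 1 / 2| ≤ 1 / 2 := by
            obtain ⟨a1, a2⟩ := hR τ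
            rw [abs_le]; constructor <;> linarith
          exact mul_le_mul_of_nonneg_left hR1
            (mul_nonneg (abs_nonneg _) (π.pathWeight_nonneg τ))
      _ ≤ e / 2 := by rw [← Finset.sum_mul]; linarith
  have k1 := abs_le.mp (key π)
  have k2 := abs_le.mp (key πbar)
  have k3 := hπ π
  linarith

end Bonus

/-! ### The law of the data -/

section Law

variable {O A S : Type*} [Fintype O] [Fintype A] [Fintype S] [DecidableEq A] {H : ℕ}

lemma sum_exploreWeight_mul (m : ℕ) (ρ π : Policy O A) (h : Fin H) (F : Traj O A H → ℝ) :
    ∑ τ, exploreWeight m ρ π h τ * F τ = ∑ σ : Fin h → O × A, π.pathWeight σ *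
      ∑ τ ∈ fiber h.isLt.le σ, exploreTail m ρ h τ * F τ := by
  rw [sum_fiber h.isLt.le]
  refine Finset.sum_congr rfl fun σ _ => ?_
  rw [Finset.mul_sum]
  refine Finset.sum_congr rfl fun τ hτ => ?_
  rw [exploreWeight_eq, π.weight_zero_eq h.isLt.le, mem_fiber.mp hτ, mul_assoc]

/-- Under the exploration policy the history before the exploration has the same law as under the
policy that is followed there. -/
lemma sum_prob_mul_exploreWeight [Nonempty A] (θ : POMDP O A S) (m : ℕ) (ρ π : Policy O A)
    (h : Fin H) (f : (Fin h → O × A) → ℝ) :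
    ∑ τ, θ.prob τ * exploreWeight m ρ π h τ * f (past τ h)
      = ∑ σ, θ.prob σ * π.pathWeight σ * f σ := by
  have h1 := sum_exploreWeight_mul m ρ π h fun τ => θ.prob τ * f (past τ h)
  have h2 : ∀ σ : Fin h → O × A, ∑ τ ∈ fiber h.isLt.le σ, exploreTail m ρ h τ *
      (θ.prob τ * f (past τ h)) = θ.prob σ * f σ := by
    intro σ
    rw [← sum_fiber_exploreTail θ ρ (m := m) h.isLt σ, Finset.sum_mul]
    refine Finset.sum_congr rfl fun τ hτ => ?_
    rw [show past τ h = σ from mem_fiber.mp hτ, mul_assoc]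
  simp only [h2] at h1
  calc _ = ∑ τ, exploreWeight m ρ π h τ * (θ.prob τ * f (past τ h)) :=
        Finset.sum_congr rfl fun τ _ => by ring
    _ = _ := h1
    _ = _ := Finset.sum_congr rfl fun σ _ => by ring

lemma exploreWeight_nonneg (m : ℕ) (ρ π : Policy O A) (h : Fin H) (τ : Traj O A H) :
    0 ≤ exploreWeight m ρ π h τ :=
  mul_nonneg (π.weight_nonneg _ _ _) (exploreTail_nonneg m ρ h τ)

lemma sum_prob_mul_exploreWeight_eq_one [Nonempty A] (θ : POMDP O A S) (m : ℕ) (ρ π : Policy O A)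
    (h : Fin H) : ∑ τ, θ.prob τ * exploreWeight m ρ π h τ = 1 := by
  have h1 := sum_prob_mul_exploreWeight θ m ρ π h fun _ => 1
  simp only [mul_one] at h1
  rw [h1]
  exact sum_prob_mul_pathWeight θ π h

/-- The policy that follows `π` for `h` steps, then plays the sequence `q`, then follows `ρ`. -/
def splice (π : Policy O A) (h : ℕ) (q : List A) (ρ : Policy O A) : Policy O A where
  prob t τ o a := if t < h then π.prob t τ o a else
    if hq : t - h < q.length then (if a = q[t - h] then 1 else 0) else ρ.prob t τ o a
  prob_nonneg t τ o a := by
    split_ifs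
    · exact π.prob_nonneg _ _ _ _
    · exact zero_le_one
    · exact le_rfl
    · exact ρ.prob_nonneg _ _ _ _
  prob_sum t τ o := by
    split_ifs
    · exact π.prob_sum _ _ _
    · simp
    · exact ρ.prob_sum _ _ _

lemma splice_weight {π ρ : Policy O A} {h : ℕ} {q : List A} (hq : h + q.length ≤ H)
    (τ : Traj O A H) (hpre : q <+: (List.ofFn fun t => (τ t).2).drop h) :
    (splice π h q ρ).weight 0 H τ = π.weight 0 h τ * ρ.weight (h + q.length) H τ := by
  rw [← (splice π h q ρ).weight_mul_weight (Nat.zero_le (h + q.length)) hq,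
    ← (splice π h q ρ).weight_mul_weight (Nat.zero_le h) (Nat.le_add_right h q.length)]
  have h1 : (splice π h q ρ).weight 0 h τ = π.weight 0 h τ := by
    refine Finset.prod_congr rfl fun t ht => ?_
    have : t.val < h := (Finset.mem_filter.mp ht).2.2
    simp [splice, this]
  have h2 : (splice π h q ρ).weight h (h + q.length) τ = 1 := by
    refine Finset.prod_eq_one fun t ht => ?_
    obtain ⟨_, ha, hb⟩ := Finset.mem_filter.mp ht
    have hlt : t.val - h < q.length := by omega
    have e : (τ t).2 = q[t.val - h] := by
      rw [hpre.getElem hlt]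
      simp [Nat.add_sub_cancel' ha]
    simp only [splice, not_lt.mpr ha, if_false, dif_pos hlt, if_pos e]
  have h3 : (splice π h q ρ).weight (h + q.length) H τ = ρ.weight (h + q.length) H τ := by
    refine Finset.prod_congr rfl fun t ht => ?_
    have ha : h + q.length ≤ t.val := (Finset.mem_filter.mp ht).2.1
    have hb : ¬ t.val < h := by omega
    have hc : ¬ t.val - h < q.length := by omega
    simp [splice, hb, hc]
  rw [h1, h2, h3, mul_one]

/-- A bound that holds under every policy holds under the exploration policies, which are mixtures
of policies. -/
lemma sum_mul_exploreWeight_le [Nonempty A] {F : Traj O A H → ℝ} (hF : ∀ τ, 0 ≤ F τ) {ε : ℝ}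
    (h : ∀ π : Policy O A, ∑ τ, F τ * π.weight 0 H τ ≤ ε) (m : ℕ) (ρ π : Policy O A)
    (h0 : Fin H) : ∑ τ, F τ * exploreWeight m ρ π h0 τ ≤ ε := by
  have hc : (0 : ℝ) < (exploreActs A m H h0).card := by exact_mod_cast exploreActs_card_pos
  have e : ∑ τ, F τ * exploreWeight m ρ π h0 τ = (∑ q ∈ exploreActs A m H h0, ∑ τ,
      F τ * (π.weight 0 h0 τ * seqWeight ρ h0 q τ)) / (exploreActs A m H h0).card := by
    rw [Finset.sum_comm, Finset.sum_div]
    refine Finset.sum_congr rfl fun τ _ => ?_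
    rw [exploreWeight_eq, exploreTail, ← Finset.mul_sum, ← Finset.mul_sum]
    ring
  rw [e, div_le_iff₀ hc, mul_comm ε, ← nsmul_eq_mul]
  refine Finset.sum_le_card_nsmul _ _ _ fun q hq => ?_
  refine le_trans (Finset.sum_le_sum fun τ _ => mul_le_mul_of_nonneg_left ?_ (hF τ))
    (h (splice π h0 q ρ))
  rw [seqWeight]
  split_ifs with hpre
  · rw [splice_weight (length_le_of_mem_exploreActs h0.isLt hq) τ hpre]
  · rw [mul_zero]
    exact Policy.weight_nonneg _ _ _ _

variable (L : Learner O A S H) (m : ℕ) (θ : POMDP O A S)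

/-- The conditional law of the data of one iteration, given the earlier data. -/
def Learner.iterLaw {k : ℕ} (D : Data O A H k) (d : Fin H → Traj O A H) : ℝ :=
  ∏ h, θ.prob (d h) * exploreWeight m L.completion (L.policy k D) h (d h)

lemma Learner.iterLaw_nonneg {k : ℕ} (D : Data O A H k) (d : Fin H → Traj O A H) :
    0 ≤ L.iterLaw m θ D d :=
  Finset.prod_nonneg fun _ _ => mul_nonneg (θ.prob_nonneg _) (exploreWeight_nonneg _ _ _ _ _)

lemma Learner.likelihood_eq {k : ℕ} (D : Data O A H k) :
    L.likelihood m θ D = ∏ i, L.iterLaw m θ (past D i) (D i) := rfl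

lemma Learner.likelihood_nonneg {k : ℕ} (D : Data O A H k) : 0 ≤ L.likelihood m θ D :=
  Finset.prod_nonneg fun i _ => L.iterLaw_nonneg m θ (past D i) (D i)

lemma prod_past_extend {X : Type*} {k : ℕ} (φ : (i : ℕ) → (Fin i → X) → X → ℝ)
    (D : Fin k → X) (d : X) :
    ∏ i : Fin (k + 1), φ i (past (extend D d) i) (extend D d i)
      = (∏ i : Fin k, φ i (past D i) (D i)) * φ k D d := by
  rw [Fin.prod_univ_castSucc]
  simp only [extend_castSucc, extend_last]
  congr 1
  · refine Finset.prod_congr rfl fun t _ => ?_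
    exact congrArg (fun g => φ t g (D t)) (past_extend_castSucc D d t)
  · exact congrArg (fun g => φ k g d) (past_extend_last D d)

lemma Learner.likelihood_extend {k : ℕ} (D : Data O A H k) (d : Fin H → Traj O A H) :
    L.likelihood m θ (extend D d) = L.likelihood m θ D * L.iterLaw m θ D d := by
  rw [L.likelihood_eq, L.likelihood_eq]
  exact prod_past_extend (fun i D d => L.iterLaw m θ D d) D d

/-- The factors of an iteration are independent. -/
lemma Learner.sum_iterLaw_mul_prod {k : ℕ} (D : Data O A H k) (φ : Fin H → Traj O A H → ℝ) :
    ∑ d, L.iterLaw m θ D d * ∏ h, φ h (d h)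
      = ∏ h, ∑ τ, θ.prob τ * exploreWeight m L.completion (L.policy k D) h τ * φ h τ := by
  rw [Finset.prod_univ_sum, Fintype.piFinset_univ]
  refine Finset.sum_congr rfl fun d _ => ?_
  rw [Learner.iterLaw, ← Finset.prod_mul_distrib]

lemma Learner.sum_iterLaw [Nonempty A] {k : ℕ} (D : Data O A H k) :
    ∑ d, L.iterLaw m θ D d = 1 := by
  have h := L.sum_iterLaw_mul_prod m θ D fun _ _ => 1
  simp only [Finset.prod_const_one, mul_one, sum_prob_mul_exploreWeight_eq_one] at h
  exact h

lemma Learner.sum_iterLaw_mul_single [Nonempty A] {k : ℕ} (D : Data O A H k) (h0 : Fin H)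
    (φ : Traj O A H → ℝ) :
    ∑ d, L.iterLaw m θ D d * φ (d h0)
      = ∑ τ, θ.prob τ * exploreWeight m L.completion (L.policy k D) h0 τ * φ τ := by
  have h := L.sum_iterLaw_mul_prod m θ D fun h τ => if h = h0 then φ τ else 1
  simp only [Finset.prod_ite_eq', Finset.mem_univ, if_true] at h
  rw [h, Finset.prod_eq_single h0]
  · simp
  · intro b _ hb
    simp [hb, sum_prob_mul_exploreWeight_eq_one]
  · simp

lemma Learner.sum_likelihood [Nonempty A] (K : ℕ) :
    ∑ D : Data O A H K, L.likelihood m θ D = 1 := by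
  induction K with
  | zero => simp [Learner.likelihood]
  | succ K ih =>
    rw [sum_extend]
    simp only [L.likelihood_extend, ← Finset.mul_sum, L.sum_iterLaw, mul_one]
    exact ih

/-- A product of adapted factors whose conditional means are at most `1` has mean at most `1`. -/
lemma Learner.sum_likelihood_mul_prod_le
    (g : (i : ℕ) → Data O A H i → (Fin H → Traj O A H) → ℝ) (hg0 : ∀ i D d, 0 ≤ g i D d)
    (hg : ∀ i D, ∑ d, L.iterLaw m θ D d * g i D d ≤ 1) (K : ℕ) :
    ∑ D : Data O A H K, L.likelihood m θ D * ∏ i : Fin K, g i (past D i) (D i) ≤ 1 := by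
  induction K with
  | zero => simp [Learner.likelihood]
  | succ K ih =>
    rw [sum_extend]
    refine le_trans (Finset.sum_le_sum fun D _ => ?_) ih
    have e : ∀ d, L.likelihood m θ (extend D d) *
        ∏ i : Fin (K + 1), g i (past (extend D d) i) (extend D d i)
        = (L.likelihood m θ D * ∏ i : Fin K, g i (past D i) (D i))
          * (L.iterLaw m θ D d * g K D d) := fun d => by
      rw [L.likelihood_extend, prod_past_extend g D d]
      ring
    simp only [e, ← Finset.mul_sum]
    exact mul_le_of_le_one_right (mul_nonneg (L.likelihood_nonneg m θ D)
      (Finset.prod_nonneg fun i _ => hg0 _ _ _)) (hg K D)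

/-- A bound on the conditional mean of a function of the data of one iteration bounds its mean. -/
lemma Learner.sum_likelihood_mul_le [Nonempty A]
    (φ : (i : ℕ) → Data O A H i → (Fin H → Traj O A H) → ℝ) (hφ0 : ∀ i D d, 0 ≤ φ i D d) {p : ℝ}
    (hp : 0 < p) (hφ : ∀ i D, ∑ d, L.iterLaw m θ D d * φ i D d ≤ p) {K : ℕ} (i : Fin K) :
    ∑ D : Data O A H K, L.likelihood m θ D * φ i (past D i) (D i) ≤ p := by
  have h := L.sum_likelihood_mul_prod_le m θ
    (fun j D d => if j = i.val then φ j D d / p else 1) (fun j D d => by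
      split_ifs
      · exact div_nonneg (hφ0 _ _ _) hp.le
      · exact zero_le_one) (fun j D => by
      split_ifs
      · simp only [mul_div_assoc', ← Finset.sum_div]
        exact (div_le_one hp).mpr (hφ j D)
      · simpa using (L.sum_iterLaw m θ D).le) K
  have e : ∀ D : Data O A H K, ∏ j : Fin K,
      (if j.val = i.val then φ j (past D j) (D j) / p else 1) = φ i (past D i) (D i) / p := by
    intro D
    rw [Finset.prod_eq_single i]
    · simp
    · intro b _ hb
      rw [if_neg fun h => hb (Fin.ext h)]
    · simp
  simp only [e, mul_div_assoc', ← Finset.sum_div] at h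
  exact (div_le_one hp).mp h

open Classical in
/-- Markov's inequality. -/
lemma Learner.markov {K : ℕ} {Y : Data O A H K → ℝ} (hY : ∀ D, 0 ≤ Y D)
    (h : ∑ D, L.likelihood m θ D * Y D ≤ 1) {t : ℝ} (ht : 0 < t) :
    ∑ D, L.likelihood m θ D * (if t < Y D then 1 else 0) ≤ 1 / t := by
  rw [le_div_iff₀ ht, Finset.sum_mul]
  refine le_trans (Finset.sum_le_sum fun D _ => ?_) h
  rw [mul_assoc]
  refine mul_le_mul_of_nonneg_left ?_ (L.likelihood_nonneg m θ D)
  split_ifs with h1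
  · rw [one_mul]; exact h1.le
  · rw [zero_mul]; exact hY D

lemma likelihood_pos_iff {K : ℕ} {D : Data O A H K} (hD : 0 < L.likelihood m θ D) (i : Fin K)
    (h : Fin H) : 0 < θ.prob (D i h) ∧ 0 < L.dataWeight m D i h := by
  have h1 : θ.prob (D i h) * L.dataWeight m D i h ≠ 0 :=
    Finset.prod_ne_zero_iff.mp (Finset.prod_ne_zero_iff.mp hD.ne' i (Finset.mem_univ i)) h
      (Finset.mem_univ h)
  exact ⟨lt_of_le_of_ne (θ.prob_nonneg _) (Ne.symm (left_ne_zero_of_mul h1)),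
    lt_of_le_of_ne (exploreWeight_nonneg _ _ _ _ _) (Ne.symm (right_ne_zero_of_mul h1))⟩

/-! ### The sampled histories are likely under the true model -/

open Classical in
/-- With high probability no sampled history is unlikely: the unlikely ones are few. -/
lemma Learner.sum_likelihood_unlikely_le [Nonempty A] {pmin : ℝ} (hp : 0 < pmin) (K : ℕ)
    [Nonempty O] :
    ∑ D : Data O A H K, L.likelihood m θ D * (if ∃ (i : Fin K) (h : Fin H),
        θ.prob (past (D i h) h) * (L.policy i (past D i)).weight 0 h (D i h) < pmin then 1 else 0)
      ≤ K * (H * ((Fintype.card O : ℝ) ^ H * (Fintype.card A : ℝ) ^ H * pmin)) := by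
  set C := (Fintype.card O : ℝ) ^ H * (Fintype.card A : ℝ) ^ H * pmin with hC
  set φ : (i : ℕ) → Data O A H i → (Fin H → Traj O A H) → Fin H → ℝ := fun i D d h =>
    if θ.prob (past (d h) h) * (L.policy i D).pathWeight (past (d h) h) < pmin then 1 else 0
    with hφ
  have hO : 1 ≤ (Fintype.card O : ℝ) := by exact_mod_cast Nat.one_le_iff_ne_zero.mpr Fintype.card_ne_zero
  have hA : 1 ≤ (Fintype.card A : ℝ) := by exact_mod_cast Nat.one_le_iff_ne_zero.mpr Fintype.card_ne_zero
  have hC0 : 0 < C := by positivity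
  have hφ0 : ∀ i D d h, 0 ≤ φ i D d h := fun i D d h => by
    simp only [hφ]
    split_ifs <;> norm_num
  have h1 : ∀ (h : Fin H) i D, ∑ d, L.iterLaw m θ D d * φ i D d h ≤ C := by
    intro h i D
    have e := L.sum_iterLaw_mul_single m θ D h fun τ =>
      if θ.prob (past τ h) * (L.policy i D).pathWeight (past τ h) < pmin then (1 : ℝ) else 0
    refine e.le.trans ?_
    rw [sum_prob_mul_exploreWeight θ m L.completion (L.policy i D) h fun σ =>
      if θ.prob σ * (L.policy i D).pathWeight σ < pmin then (1 : ℝ) else 0]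
    have h2 : ∀ σ ∈ (Finset.univ : Finset (Fin h → O × A)),
        θ.prob σ * (L.policy i D).pathWeight σ *
        (if θ.prob σ * (L.policy i D).pathWeight σ < pmin then (1 : ℝ) else 0) ≤ pmin := by
      intro σ _
      split_ifs with h3
      · rw [mul_one]; exact h3.le
      · rw [mul_zero]; exact hp.le
    refine (Finset.sum_le_card_nsmul _ _ _ h2).trans ?_
    rw [nsmul_eq_mul, hC]
    refine mul_le_mul_of_nonneg_right ?_ hp.le
    simp only [Finset.card_univ, Fintype.card_fun, Fintype.card_prod, Fintype.card_fin,
      Nat.cast_pow, Nat.cast_mul, mul_pow]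
    gcongr <;> first | assumption | exact h.isLt.le
  have h2 : ∀ D : Data O A H K, (if ∃ (i : Fin K) (h : Fin H),
        θ.prob (past (D i h) h) * (L.policy i (past D i)).weight 0 h (D i h) < pmin then (1 : ℝ)
        else 0) ≤ ∑ i : Fin K, ∑ h, φ i (past D i) (D i) h := by
    intro D
    split_ifs with h3
    · obtain ⟨i, h, hih⟩ := h3
      have e1 : φ i (past D i) (D i) h = 1 := by
        rw [Policy.weight_zero_eq _ h.isLt.le] at hih
        simp only [hφ]
        rw [if_pos]
        exact hih
      rw [← e1]
      refine le_trans ?_ (Finset.single_le_sum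
        (f := fun i : Fin K => ∑ h, φ i (past D i) (D i) h)
        (fun i _ => Finset.sum_nonneg fun h _ => hφ0 _ _ _ _) (Finset.mem_univ i))
      exact Finset.single_le_sum (f := fun h => φ i (past D i) (D i) h)
        (fun h _ => hφ0 _ _ _ _) (Finset.mem_univ h)
    · exact Finset.sum_nonneg fun i _ => Finset.sum_nonneg fun h _ => hφ0 _ _ _ _
  calc _ ≤ ∑ D : Data O A H K, L.likelihood m θ D * ∑ i : Fin K, ∑ h, φ i (past D i) (D i) h :=
        Finset.sum_le_sum fun D _ => mul_le_mul_of_nonneg_left (h2 D) (L.likelihood_nonneg m θ D)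
    _ = ∑ i : Fin K, ∑ h, ∑ D : Data O A H K, L.likelihood m θ D * φ i (past D i) (D i) h := by
        simp only [Finset.mul_sum]
        rw [Finset.sum_comm]
        exact Finset.sum_congr rfl fun i _ => Finset.sum_comm
    _ ≤ ∑ _i : Fin K, ∑ _h : Fin H, C := Finset.sum_le_sum fun i _ => Finset.sum_le_sum fun h _ =>
        L.sum_likelihood_mul_le m θ (fun i D d => φ i D d h) (fun i D d => hφ0 i D d h) hC0 (h1 h) i
    _ = _ := by simp

end Law

/-! ### Concentration of the belief norms -/

section Concentration

variable {O A S : Type*} [Fintype O] [Fintype A] [Fintype S] [DecidableEq A] {H : ℕ}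
  (L : Learner O A S H) (m : ℕ) (θ : POMDP O A S)

lemma exp_neg_le {x : ℝ} (h0 : 0 ≤ x) (h1 : x ≤ 1) : Real.exp (-x) ≤ 1 - x / 2 := by
  have h2 := Real.exp_bound_div_one_sub_of_interval (x := x) h0
  have h3 : 0 < Real.exp (-x) := Real.exp_pos _
  have h4 := Real.add_one_le_exp x
  have h5 : Real.exp (-x) * Real.exp x = 1 := by rw [← Real.exp_add]; simp
  nlinarith

/-- The conditional mean, given the earlier data, of the squared norm of the belief after the
history that iteration `i` samples for index `h`. -/
def Learner.meanNormSq [DecidableEq S] (lam : ℝ) {k : ℕ} (D : Data O A H k) (h : Fin H) : ℝ :=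
  ∑ σ : Fin h → O × A, θ.prob σ * (L.policy k D).pathWeight σ * beliefNormSq lam θ D h σ

lemma Learner.meanNormSq_nonneg [DecidableEq S] {lam : ℝ} (hlam : 0 < lam) {k : ℕ}
    (D : Data O A H k) (h : Fin H) : 0 ≤ L.meanNormSq θ lam D h :=
  Finset.sum_nonneg fun σ _ => mul_nonneg
    (mul_nonneg (θ.prob_nonneg σ) (Policy.pathWeight_nonneg _ σ)) (beliefNormSq_nonneg hlam _ _ _ _)

lemma mul_beliefNormSq_le_one [DecidableEq S] {lam : ℝ} (hlam : 0 < lam) {k : ℕ}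
    (D : Data O A H k) (h : Fin H) (σ : Fin h → O × A) : lam * beliefNormSq lam θ D h σ ≤ 1 := by
  have h1 := invNormSq_le_div (s := Finset.univ) (x := fun i => θ.belief (past (D i h) h)) hlam
    (θ.belief σ)
  rw [le_div_iff₀ hlam, mul_comm] at h1
  exact h1.trans (θ.belief_dotProduct_self_le σ)

/-- An exponential supermartingale that compares the squared norms of the sampled beliefs with
their conditional means. -/
lemma Learner.sum_likelihood_mul_exp_le [DecidableEq S] [Nonempty A] {lam : ℝ} (hlam : 0 < lam)
    (K : ℕ) :
    ∑ D : Data O A H K, L.likelihood m θ D * ∏ i : Fin K, ∏ h : Fin H,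
      Real.exp (lam * (L.meanNormSq θ lam (past D i) h / 2
        - beliefNormSq lam θ (past D i) h (past (D i h) h))) ≤ 1 := by
  refine L.sum_likelihood_mul_prod_le m θ (fun i D d => ∏ h : Fin H,
    Real.exp (lam * (L.meanNormSq θ lam D h / 2 - beliefNormSq lam θ D h (past (d h) h))))
    (fun i D d => Finset.prod_nonneg fun _ _ => (Real.exp_pos _).le) (fun i D => ?_) K
  rw [L.sum_iterLaw_mul_prod m θ D fun h τ =>
    Real.exp (lam * (L.meanNormSq θ lam D h / 2 - beliefNormSq lam θ D h (past τ h)))]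
  refine Finset.prod_le_one (fun h _ => Finset.sum_nonneg fun τ _ => mul_nonneg
    (mul_nonneg (θ.prob_nonneg τ) (exploreWeight_nonneg _ _ _ _ _)) (Real.exp_pos _).le) fun h _ => ?_
  set μ := L.meanNormSq θ lam D h with hμ
  rw [sum_prob_mul_exploreWeight θ m L.completion (L.policy i D) h fun σ =>
    Real.exp (lam * (μ / 2 - beliefNormSq lam θ D h σ))]
  have h1 : ∀ σ : Fin h → O × A, Real.exp (lam * (μ / 2 - beliefNormSq lam θ D h σ))
      ≤ Real.exp (lam * μ / 2) * (1 - lam * beliefNormSq lam θ D h σ / 2) := by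
    intro σ
    have := exp_neg_le (mul_nonneg hlam.le (beliefNormSq_nonneg hlam θ D h σ))
      (mul_beliefNormSq_le_one θ hlam D h σ)
    rw [show lam * (μ / 2 - beliefNormSq lam θ D h σ)
      = lam * μ / 2 + -(lam * beliefNormSq lam θ D h σ) by ring, Real.exp_add]
    gcongr
  have h2 : ∑ σ : Fin h → O × A, θ.prob σ * (L.policy i D).pathWeight σ *
      (Real.exp (lam * μ / 2) * (1 - lam * beliefNormSq lam θ D h σ / 2))
      = Real.exp (lam * μ / 2) * (1 - lam * μ / 2) := by
    have e1 := sum_prob_mul_pathWeight θ (L.policy i D) h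
    calc _ = Real.exp (lam * μ / 2) * (∑ σ : Fin h → O × A, θ.prob σ * (L.policy i D).pathWeight σ
          - lam / 2 * ∑ σ : Fin h → O × A, θ.prob σ * (L.policy i D).pathWeight σ *
            beliefNormSq lam θ D h σ) := by
          rw [Finset.mul_sum, ← Finset.sum_sub_distrib, Finset.mul_sum]
          exact Finset.sum_congr rfl fun σ _ => by ring
      _ = _ := by
          rw [e1, hμ, Learner.meanNormSq]
          ring
  have h3 : Real.exp (lam * μ / 2) * (1 - lam * μ / 2) ≤ 1 := by
    have a1 := Real.add_one_le_exp (-(lam * μ / 2))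
    have a2 : Real.exp (lam * μ / 2) * Real.exp (-(lam * μ / 2)) = 1 := by
      rw [← Real.exp_add]; simp
    have a3 := Real.exp_pos (lam * μ / 2)
    nlinarith
  refine (Finset.sum_le_sum fun σ _ => mul_le_mul_of_nonneg_left (h1 σ) (mul_nonneg
    (θ.prob_nonneg σ) (Policy.pathWeight_nonneg _ σ))).trans ?_
  rw [h2]
  exact h3

/-! ### Maximum likelihood -/

/-- The integral of `F` over the continuations of a history under the exploration policy. -/
def tailSum (m : ℕ) (ρ : Policy O A) {h H : ℕ} (hh : h ≤ H) (σ : Fin h → O × A)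
    (F : Traj O A H → ℝ) : ℝ :=
  ∑ τ ∈ fiber hh σ, exploreTail m ρ h τ * F τ

/-- The square root of a likelihood ratio of `f` and the model `θ`, divided by its conditional mean
given the history before the exploration, up to the square root of the likelihood ratio of this
history. The conditional mean is the affinity of the conditional laws. -/
def ratioFactor (ρ : Policy O A) (f : Traj O A H → ℝ) (h : Fin H) (τ : Traj O A H) : ℝ :=
  √(f τ / θ.prob τ) * (√(tailSum m ρ h.isLt.le (past τ h) f * θ.prob (past τ h))
    / tailSum m ρ h.isLt.le (past τ h) fun τ => √(f τ * θ.prob τ))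

variable {m θ} {ρ : Policy O A} {f : Traj O A H → ℝ}

lemma tailSum_nonneg {h : ℕ} {hh : h ≤ H} {σ : Fin h → O × A} {F : Traj O A H → ℝ}
    (hF : ∀ τ, 0 ≤ F τ) : 0 ≤ tailSum m ρ hh σ F :=
  Finset.sum_nonneg fun τ _ => mul_nonneg (exploreTail_nonneg m ρ h τ) (hF τ)

lemma ratioFactor_nonneg (h : Fin H) (τ : Traj O A H) :
    0 ≤ ratioFactor m θ ρ f h τ :=
  mul_nonneg (Real.sqrt_nonneg _)
    (div_nonneg (Real.sqrt_nonneg _) (tailSum_nonneg fun _ => Real.sqrt_nonneg _))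

lemma sum_mul_ratioFactor_le [Nonempty A] (hf : ∀ τ, 0 ≤ f τ) {ε : ℝ} (π : Policy O A)
    (h : Fin H) (hε : ∑ τ, f τ * exploreWeight m ρ π h τ ≤ 1 + ε) :
    ∑ τ, θ.prob τ * exploreWeight m ρ π h τ * ratioFactor m θ ρ f h τ ≤ Real.exp (ε / 2) := by
  have e0 : ∀ τ, θ.prob τ * exploreWeight m ρ π h τ * ratioFactor m θ ρ f h τ
      = exploreWeight m ρ π h τ * (√(f τ * θ.prob τ) *
        (√(tailSum m ρ h.isLt.le (past τ h) f * θ.prob (past τ h))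
          / tailSum m ρ h.isLt.le (past τ h) fun τ => √(f τ * θ.prob τ))) := fun τ => by
    have e1 : θ.prob τ * √(f τ / θ.prob τ) = √(f τ * θ.prob τ) := by
      rcases (θ.prob_nonneg τ).eq_or_lt with h0 | h0
      · rw [← h0]; simp
      · rw [Real.sqrt_div (hf τ), Real.sqrt_mul (hf τ)]
        have := Real.mul_self_sqrt h0.le
        have h1 : √(θ.prob τ) ≠ 0 := (Real.sqrt_pos.mpr h0).ne'
        field_simp
        rw [Real.sq_sqrt h0.le, mul_comm]
    rw [← e1, ratioFactor]
    ring
  simp only [e0]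
  rw [sum_exploreWeight_mul]
  have e2 : ∀ σ : Fin h → O × A, ∑ τ ∈ fiber h.isLt.le σ, exploreTail m ρ h τ *
      (√(f τ * θ.prob τ) * (√(tailSum m ρ h.isLt.le (past τ h) f * θ.prob (past τ h))
          / tailSum m ρ h.isLt.le (past τ h) fun τ => √(f τ * θ.prob τ)))
      ≤ √(tailSum m ρ h.isLt.le σ f) * √(θ.prob σ) := by
    intro σ
    have e3 : ∑ τ ∈ fiber h.isLt.le σ, exploreTail m ρ h τ *
      (√(f τ * θ.prob τ) * (√(tailSum m ρ h.isLt.le (past τ h) f * θ.prob (past τ h))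
          / tailSum m ρ h.isLt.le (past τ h) fun τ => √(f τ * θ.prob τ)))
        = (tailSum m ρ h.isLt.le σ fun τ => √(f τ * θ.prob τ)) *
          (√(tailSum m ρ h.isLt.le σ f * θ.prob σ)
          / tailSum m ρ h.isLt.le σ fun τ => √(f τ * θ.prob τ)) := by
      conv_rhs => rw [tailSum, Finset.sum_mul]
      refine Finset.sum_congr rfl fun τ hτ => ?_
      rw [show past τ h = σ from mem_fiber.mp hτ, mul_assoc]
      rfl
    rw [e3, ← Real.sqrt_mul (tailSum_nonneg hf)]
    set t := tailSum m ρ h.isLt.le σ fun τ => √(f τ * θ.prob τ)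
    by_cases ht : t = 0
    · rw [ht, zero_mul]; exact Real.sqrt_nonneg _
    · rw [mul_div_cancel₀ _ ht]
  refine (Finset.sum_le_sum fun σ _ =>
    mul_le_mul_of_nonneg_left (e2 σ) (π.pathWeight_nonneg σ)).trans ?_
  have hw : ∀ σ : Fin h → O × A, 0 ≤ π.pathWeight σ := π.pathWeight_nonneg
  have e4 : ∀ σ : Fin h → O × A, π.pathWeight σ * (√(tailSum m ρ h.isLt.le σ f) * √(θ.prob σ))
      = √(π.pathWeight σ * tailSum m ρ h.isLt.le σ f) * √(θ.prob σ * π.pathWeight σ) := fun σ => by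
    rw [Real.sqrt_mul (hw σ), Real.sqrt_mul (θ.prob_nonneg σ)]
    nth_rewrite 1 [← Real.mul_self_sqrt (hw σ)]
    ring
  simp only [e4]
  refine (Real.sum_sqrt_mul_sqrt_le Finset.univ
    (fun σ => mul_nonneg (hw σ) (tailSum_nonneg hf))
    (fun σ => mul_nonneg (θ.prob_nonneg σ) (hw σ))).trans ?_
  rw [sum_prob_mul_pathWeight, Real.sqrt_one, mul_one]
  have e5 : ∑ σ : Fin h → O × A, π.pathWeight σ * tailSum m ρ h.isLt.le σ f ≤ 1 + ε := by
    have := sum_exploreWeight_mul m ρ π h f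
    refine le_trans (le_of_eq ?_) hε
    rw [show ∑ τ, f τ * exploreWeight m ρ π h τ = ∑ τ, exploreWeight m ρ π h τ * f τ from
      Finset.sum_congr rfl fun τ _ => mul_comm _ _, this]
    rfl
  apply Real.sqrt_le_iff.mpr ⟨(Real.exp_pos _).le, ?_⟩
  rw [← Real.exp_nat_mul]
  have e6 := Real.add_one_le_exp ε
  have e7 : ((2 : ℕ) : ℝ) * (ε / 2) = ε := by push_cast; ring
  rw [e7]
  linarith

/-- The total variation distance is bounded by the Hellinger distance. -/
lemma sq_sum_abs_sub_le {ι : Type*} (s : Finset ι) {e p q : ι → ℝ} (he : ∀ i, 0 ≤ e i)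
    (hp : ∀ i, 0 ≤ p i) (hq : ∀ i, 0 ≤ q i) (hp1 : ∑ i ∈ s, e i * p i = 1)
    (hq1 : ∑ i ∈ s, e i * q i = 1) :
    (∑ i ∈ s, e i * |p i - q i|) ^ 2 ≤ 8 * (1 - ∑ i ∈ s, e i * √(p i * q i)) := by
  set F := ∑ i ∈ s, e i * √(p i * q i) with hF
  have h1 : ∑ i ∈ s, e i * (√(p i) - √(q i)) ^ 2 = 2 - 2 * F := by
    have : ∀ i, e i * (√(p i) - √(q i)) ^ 2 = e i * p i + e i * q i - 2 * (e i * √(p i * q i)) := by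
      intro i
      rw [Real.sqrt_mul (hp i), sub_sq, Real.sq_sqrt (hp i), Real.sq_sqrt (hq i)]
      ring
    simp only [this, Finset.sum_sub_distrib, Finset.sum_add_distrib, hp1, hq1, ← Finset.mul_sum]
    ring
  have h2 : ∑ i ∈ s, e i * (√(p i) + √(q i)) ^ 2 = 2 + 2 * F := by
    have : ∀ i, e i * (√(p i) + √(q i)) ^ 2 = e i * p i + e i * q i + 2 * (e i * √(p i * q i)) := by
      intro i
      rw [Real.sqrt_mul (hp i), add_sq, Real.sq_sqrt (hp i), Real.sq_sqrt (hq i)]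
      ring
    simp only [this, Finset.sum_add_distrib, hp1, hq1, ← Finset.mul_sum]
    ring
  have h3 : 0 ≤ 2 - 2 * F := by
    rw [← h1]
    exact Finset.sum_nonneg fun i _ => mul_nonneg (he i) (sq_nonneg _)
  have h4 : ∑ i ∈ s, e i * |p i - q i|
      = ∑ i ∈ s, √(e i * (√(p i) - √(q i)) ^ 2) * √(e i * (√(p i) + √(q i)) ^ 2) := by
    refine Finset.sum_congr rfl fun i _ => ?_
    have e1 : p i - q i = (√(p i) - √(q i)) * (√(p i) + √(q i)) := by
      rw [mul_comm, ← sq_sub_sq, Real.sq_sqrt (hp i), Real.sq_sqrt (hq i)]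
    rw [Real.sqrt_mul (he i), Real.sqrt_mul (he i), Real.sqrt_sq_eq_abs, Real.sqrt_sq_eq_abs, e1,
      abs_mul]
    nth_rewrite 1 [← Real.mul_self_sqrt (he i)]
    ring
  have h5 := Real.sum_sqrt_mul_sqrt_le s (f := fun i => e i * (√(p i) - √(q i)) ^ 2)
    (g := fun i => e i * (√(p i) + √(q i)) ^ 2) (fun i => mul_nonneg (he i) (sq_nonneg _))
    (fun i => mul_nonneg (he i) (sq_nonneg _))
  rw [← h4, h1, h2] at h5
  have h6 : 0 ≤ ∑ i ∈ s, e i * |p i - q i| :=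
    Finset.sum_nonneg fun i _ => mul_nonneg (he i) (abs_nonneg _)
  calc (∑ i ∈ s, e i * |p i - q i|) ^ 2 ≤ (√(2 - 2 * F) * √(2 + 2 * F)) ^ 2 :=
        pow_le_pow_left₀ h6 h5 2
    _ = (2 - 2 * F) * (2 + 2 * F) := by
        rw [mul_pow, Real.sq_sqrt h3, Real.sq_sqrt (by
          rw [← h2]; exact Finset.sum_nonneg fun i _ => mul_nonneg (he i) (sq_nonneg _))]
    _ ≤ _ := by nlinarith

/-- Normalizing a function above a probability density moves it by at most twice the relative excess
mass. -/
lemma sum_abs_div_sub_div_le {ι : Type*} (s : Finset ι) {e f p : ι → ℝ} (he : ∀ i, 0 ≤ e i)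
    (hp : ∀ i, 0 ≤ p i) (hpf : ∀ i, p i ≤ f i) {P F : ℝ} (hP : 0 < P)
    (hp1 : ∑ i ∈ s, e i * p i = P) (hf1 : ∑ i ∈ s, e i * f i = F) :
    ∑ i ∈ s, e i * |p i / P - f i / F| ≤ 2 * ((F - P) / P) := by
  have hPF : P ≤ F := by
    rw [← hp1, ← hf1]
    exact Finset.sum_le_sum fun i _ => mul_le_mul_of_nonneg_left (hpf i) (he i)
  have hF : 0 < F := hP.trans_le hPF
  have h1 : ∀ i ∈ s, e i * |p i / P - f i / F|
      ≤ (e i * f i - e i * p i) / P + e i * f i * (1 / P - 1 / F) := by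
    intro i _
    have e1 : p i / P - f i / F = -((f i - p i) / P) + f i * (1 / P - 1 / F) := by
      field_simp; ring
    have e2 : 0 ≤ 1 / P - 1 / F := sub_nonneg.mpr (one_div_le_one_div_of_le hP hPF)
    have e3 : |p i / P - f i / F| ≤ (f i - p i) / P + f i * (1 / P - 1 / F) := by
      rw [e1]
      refine (abs_add_le _ _).trans ?_
      rw [abs_neg, abs_of_nonneg (div_nonneg (sub_nonneg.mpr (hpf i)) hP.le),
        abs_of_nonneg (mul_nonneg ((hp i).trans (hpf i)) e2)]
    refine (mul_le_mul_of_nonneg_left e3 (he i)).trans (le_of_eq ?_)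
    ring
  refine (Finset.sum_le_sum h1).trans (le_of_eq ?_)
  rw [Finset.sum_add_distrib, ← Finset.sum_div, Finset.sum_sub_distrib, ← Finset.sum_mul, hp1, hf1]
  field_simp
  ring

/-- At a sampled trajectory, the distance of the conditional laws of an estimated and the true model
is controlled by the factor of the normalized likelihood ratio and the log-likelihood ratio. -/
lemma sq_condTV_le [Nonempty A] {θ' : POMDP O A S} (hf : ∀ τ, θ'.prob τ ≤ f τ) {ε pmin : ℝ}
    (hpmin : 0 < pmin) (π : Policy O A) (h : Fin H)
    (hε : ∑ τ, (f τ - θ'.prob τ) * exploreWeight m ρ π h τ ≤ ε)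
    {τ : Traj O A H} (hτ : 0 < θ.prob τ) (hw : 0 < exploreTail m ρ h τ) (hτ' : 0 < θ'.prob τ)
    (hmin : pmin ≤ θ'.prob (past τ h) * π.weight 0 h τ) :
    condTV m ρ θ' θ h.isLt.le (past τ h) ^ 2
      ≤ 16 * (Real.log (ratioFactor m θ ρ f h τ)
          - (Real.log (θ'.prob τ) - Real.log (θ.prob τ)) / 2) + 8 * (ε / pmin) ^ 2
      ∧ 0 < ratioFactor m θ ρ f h τ := by
  set σ := past τ h with hσ
  have hmem : τ ∈ fiber h.isLt.le σ := mem_fiber.mpr rfl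
  have hf0 : ∀ τ, 0 ≤ f τ := fun τ => (θ'.prob_nonneg τ).trans (hf τ)
  have he : ∀ τ : Traj O A H, 0 ≤ exploreTail m ρ h τ := exploreTail_nonneg m ρ h
  have hpos : ∀ F : Traj O A H → ℝ, (∀ τ, 0 ≤ F τ) → 0 < F τ → 0 < tailSum m ρ h.isLt.le σ F :=
    fun F hF hFτ => lt_of_lt_of_le (mul_pos hw hFτ) (Finset.single_le_sum
      (f := fun τ => exploreTail m ρ h τ * F τ) (fun τ _ => mul_nonneg (he τ) (hF τ)) hmem)
  have hfτ : 0 < f τ := hτ'.trans_le (hf τ)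
  have eP : tailSum m ρ h.isLt.le σ θ.prob = θ.prob σ := sum_fiber_exploreTail θ ρ h.isLt σ
  have eP' : tailSum m ρ h.isLt.le σ θ'.prob = θ'.prob σ := sum_fiber_exploreTail θ' ρ h.isLt σ
  have hP : 0 < θ.prob σ := eP ▸ hpos _ θ.prob_nonneg hτ
  have hP' : 0 < θ'.prob σ := eP' ▸ hpos _ θ'.prob_nonneg hτ'
  set F := tailSum m ρ h.isLt.le σ f with hFdef
  have hF : 0 < F := hpos f hf0 hfτ
  set G := tailSum m ρ h.isLt.le σ fun τ => √(f τ * θ.prob τ) with hG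
  have hGpos : 0 < G := hpos _ (fun _ => Real.sqrt_nonneg _) (Real.sqrt_pos.mpr (by positivity))
  have hFP : 0 < √(F * θ.prob σ) := Real.sqrt_pos.mpr (by positivity)
  -- the affinity of the conditional laws
  set Φ := G / √(F * θ.prob σ) with hΦ
  have hΦpos : 0 < Φ := by positivity
  have hfactor : ratioFactor m θ ρ f h τ = √(f τ / θ.prob τ) * Φ⁻¹ := by
    rw [ratioFactor, hΦ, inv_div]
  have hpos' : 0 < √(f τ / θ.prob τ) := Real.sqrt_pos.mpr (by positivity)
  refine ⟨?_, by rw [hfactor]; positivity⟩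
  have h1 : (∑ τ ∈ fiber h.isLt.le σ, exploreTail m ρ h τ * |f τ / F - θ.prob τ / θ.prob σ|) ^ 2
      ≤ 8 * (1 - Φ) := by
    have := sq_sum_abs_sub_le (fiber h.isLt.le σ) (e := exploreTail m ρ h)
      (p := fun τ => f τ / F) (q := fun τ => θ.prob τ / θ.prob σ) he
      (fun τ => div_nonneg (hf0 τ) hF.le) (fun τ => div_nonneg (θ.prob_nonneg τ) hP.le)
      (by
        simp only [mul_div_assoc', ← Finset.sum_div]
        exact div_self hF.ne')
      (by
        simp only [mul_div_assoc', ← Finset.sum_div]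
        rw [sum_fiber_exploreTail θ ρ h.isLt σ]
        exact div_self hP.ne')
    refine this.trans (le_of_eq ?_)
    congr 2
    rw [hΦ, hG, tailSum, Finset.sum_div]
    refine Finset.sum_congr rfl fun τ _ => ?_
    rw [div_mul_div_comm, Real.sqrt_div (mul_nonneg (hf0 τ) (θ.prob_nonneg τ)), mul_div_assoc']
  have h2 : ∑ τ ∈ fiber h.isLt.le σ, exploreTail m ρ h τ * |θ'.prob τ / θ'.prob σ - f τ / F|
      ≤ 2 * (ε / pmin) := by
    refine (sum_abs_div_sub_div_le (fiber h.isLt.le σ) he θ'.prob_nonneg hf hP'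
      (sum_fiber_exploreTail θ' ρ h.isLt σ) rfl).trans ?_
    have a1 : π.weight 0 h τ * (F - θ'.prob σ) ≤ ε := by
      refine le_trans ?_ hε
      have b1 := sum_exploreWeight_mul m ρ π h fun τ => f τ - θ'.prob τ
      rw [show ∑ τ, (f τ - θ'.prob τ) * exploreWeight m ρ π h τ
        = ∑ τ, exploreWeight m ρ π h τ * (f τ - θ'.prob τ) from
        Finset.sum_congr rfl fun τ _ => mul_comm _ _, b1, π.weight_zero_eq h.isLt.le]
      have b2 : F - θ'.prob σ
          = ∑ τ ∈ fiber h.isLt.le σ, exploreTail m ρ h τ * (f τ - θ'.prob τ) := by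
        simp only [mul_sub, Finset.sum_sub_distrib]
        rw [sum_fiber_exploreTail θ' ρ h.isLt σ]
        rfl
      rw [b2]
      exact Finset.single_le_sum (f := fun σ : Fin h → O × A => π.pathWeight σ *
        ∑ τ ∈ fiber h.isLt.le σ, exploreTail m ρ h τ * (f τ - θ'.prob τ))
        (fun σ _ => mul_nonneg (π.pathWeight_nonneg σ) (Finset.sum_nonneg fun τ _ =>
          mul_nonneg (he τ) (sub_nonneg.mpr (hf τ)))) (Finset.mem_univ σ)
    have a2 : 0 < π.weight 0 h τ := by
      by_contra hneg
      have : π.weight 0 h τ = 0 := le_antisymm (not_lt.mp hneg) (π.weight_nonneg _ _ _)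
      rw [this, mul_zero] at hmin
      linarith
    have a3 : (F - θ'.prob σ) / θ'.prob σ ≤ ε / pmin := by
      have hε0 : 0 ≤ ε := le_trans (Finset.sum_nonneg fun τ _ => mul_nonneg
        (sub_nonneg.mpr (hf τ)) (exploreWeight_nonneg _ _ _ _ _)) hε
      rw [div_le_div_iff₀ hP' hpmin]
      have a4 : (F - θ'.prob σ) * π.weight 0 h τ * pmin
          ≤ ε * (θ'.prob σ * π.weight 0 h τ) := by
        have : (F - θ'.prob σ) * π.weight 0 h τ ≤ ε := by linarith
        exact mul_le_mul this hmin hpmin.le hε0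
      by_contra hlt
      push Not at hlt
      nlinarith
    exact mul_le_mul_of_nonneg_left a3 zero_le_two
  have h3 : condTV m ρ θ' θ h.isLt.le σ
      ≤ ∑ τ ∈ fiber h.isLt.le σ, exploreTail m ρ h τ * |θ'.prob τ / θ'.prob σ - f τ / F|
        + ∑ τ ∈ fiber h.isLt.le σ, exploreTail m ρ h τ * |f τ / F - θ.prob τ / θ.prob σ| := by
    rw [condTV, ← Finset.sum_add_distrib]
    refine Finset.sum_le_sum fun τ _ => ?_
    rw [← mul_add]
    exact mul_le_mul_of_nonneg_left (abs_sub_le _ _ _) (he τ)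
  have h4 : Real.log (θ'.prob τ) ≤ Real.log (f τ) := Real.log_le_log hτ' (hf τ)
  have h5 : Real.log (ratioFactor m θ ρ f h τ)
      = (Real.log (f τ) - Real.log (θ.prob τ)) / 2 - Real.log Φ := by
    rw [hfactor, Real.log_mul hpos'.ne' (inv_pos.mpr hΦpos).ne', Real.log_inv,
      Real.log_sqrt (by positivity), Real.log_div hfτ.ne' hτ.ne']
    ring
  have h6 := Real.log_le_sub_one_of_pos hΦpos
  set u := ∑ τ ∈ fiber h.isLt.le σ, exploreTail m ρ h τ * |θ'.prob τ / θ'.prob σ - f τ / F|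
  set v := ∑ τ ∈ fiber h.isLt.le σ, exploreTail m ρ h τ * |f τ / F - θ.prob τ / θ.prob σ|
  have hu0 : 0 ≤ u := Finset.sum_nonneg fun τ _ => mul_nonneg (he τ) (abs_nonneg _)
  have h7 : condTV m ρ θ' θ h.isLt.le σ ^ 2 ≤ 2 * u ^ 2 + 2 * v ^ 2 := by
    have := pow_le_pow_left₀ (condTV_nonneg m ρ θ' θ h.isLt.le σ) h3 2
    nlinarith [sq_nonneg (u - v)]
  have h8 : u ^ 2 ≤ (2 * (ε / pmin)) ^ 2 := pow_le_pow_left₀ hu0 h2 2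
  nlinarith

end Concentration

/-! ### The maximum likelihood estimate is close to the true model on the data -/

section Likelihood

variable {O A S : Type*} [Fintype O] [Fintype A] [Fintype S] [DecidableEq A] {H : ℕ}
  (L : Learner O A S H) (m : ℕ) (θ : POMDP O A S)

/-- The square root of the likelihood ratio of `f` and `θ` over the data, normalized as in
`ratioFactor`. The factors `exp (-ε / 2)` make up for the excess mass of `f`. -/
def Learner.ratioProd (ε : ℝ) (f : Traj O A H → ℝ) {k : ℕ} (D : Data O A H k) : ℝ :=
  ∏ i : Fin k, ∏ h : Fin H, Real.exp (-(ε / 2)) * ratioFactor m θ L.completion f h (D i h)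

lemma Learner.ratioProd_nonneg (ε : ℝ) (f : Traj O A H → ℝ) {k : ℕ} (D : Data O A H k) :
    0 ≤ L.ratioProd m θ ε f D :=
  Finset.prod_nonneg fun _ _ => Finset.prod_nonneg fun _ _ =>
    mul_nonneg (Real.exp_pos _).le (ratioFactor_nonneg _ _)

lemma prod_initial {K k : ℕ} (hk : k ≤ K) {X : Type*} (φ : X → ℝ) (D : Fin K → X) :
    ∏ i : Fin K, (if i.val < k then φ (D i) else 1) = ∏ i : Fin k, φ (initial k hk D i) := by
  rw [← Finset.prod_filter]
  symm
  refine Finset.prod_bij (fun i _ => Fin.castLE hk i) (fun i _ => ?_) (fun i _ j _ h => ?_)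
    (fun i hi => ?_) fun i _ => rfl
  · simp
  · exact Fin.castLE_injective hk h
  · exact ⟨⟨i.val, by simpa using hi⟩, Finset.mem_univ _, rfl⟩

lemma Learner.sum_likelihood_mul_ratioProd_le [Nonempty A] {ε : ℝ} {f : Traj O A H → ℝ}
    (hf : ∀ τ, 0 ≤ f τ) (hε : ∀ π : Policy O A, ∑ τ, f τ * π.weight 0 H τ ≤ 1 + ε) {K k : ℕ}
    (hk : k ≤ K) :
    ∑ D : Data O A H K, L.likelihood m θ D * L.ratioProd m θ ε f (initial k hk D) ≤ 1 := by
  have h := L.sum_likelihood_mul_prod_le m θ (fun i _ d => if i < k then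
    ∏ h : Fin H, Real.exp (-(ε / 2)) * ratioFactor m θ L.completion f h (d h) else 1)
    (fun i D d => by
      split_ifs
      · exact Finset.prod_nonneg fun _ _ =>
          mul_nonneg (Real.exp_pos _).le (ratioFactor_nonneg _ _)
      · exact zero_le_one) (fun i D => ?_) K
  · refine le_trans (Finset.sum_le_sum fun D _ => ?_) h
    rw [Learner.ratioProd, ← prod_initial hk (fun d : Fin H → Traj O A H =>
      ∏ h : Fin H, Real.exp (-(ε / 2)) * ratioFactor m θ L.completion f h (d h))]
  · split_ifs
    · rw [L.sum_iterLaw_mul_prod m θ D fun h τ =>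
        Real.exp (-(ε / 2)) * ratioFactor m θ L.completion f h τ]
      refine Finset.prod_le_one (fun h _ => Finset.sum_nonneg fun τ _ => mul_nonneg
        (mul_nonneg (θ.prob_nonneg τ) (exploreWeight_nonneg _ _ _ _ _))
        (mul_nonneg (Real.exp_pos _).le (ratioFactor_nonneg _ _))) fun h _ => ?_
      have h1 := sum_mul_ratioFactor_le (m := m) (θ := θ) (ρ := L.completion) hf (L.policy i D) h
        (sum_mul_exploreWeight_le hf hε m L.completion (L.policy i D) h)
      have h2 := mul_le_mul_of_nonneg_left h1 (Real.exp_pos (-(ε / 2))).le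
      rw [← Real.exp_add, neg_add_cancel, Real.exp_zero, Finset.mul_sum] at h2
      refine le_trans (le_of_eq (Finset.sum_congr rfl fun τ _ => ?_)) h2
      ring
    · simpa using (L.sum_iterLaw m θ D).le

open Classical in
/-- The union bound. -/
lemma Learner.sum_likelihood_exists_le {ι : Type*} {K : ℕ} (s : Finset ι)
    (p : ι → Data O A H K → Prop) {b : ℝ}
    (h : ∀ x ∈ s, ∑ D : Data O A H K, L.likelihood m θ D * (if p x D then 1 else 0) ≤ b) :
    ∑ D : Data O A H K, L.likelihood m θ D * (if ∃ x ∈ s, p x D then 1 else 0) ≤ s.card * b := by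
  rw [← nsmul_eq_mul]
  refine le_trans ?_ (Finset.sum_le_card_nsmul s _ b h)
  rw [Finset.sum_comm]
  refine Finset.sum_le_sum fun D _ => ?_
  rw [← Finset.mul_sum]
  refine mul_le_mul_of_nonneg_left ?_ (L.likelihood_nonneg m θ D)
  have h0 : ∀ x ∈ s, (0 : ℝ) ≤ if p x D then 1 else 0 := fun x _ => by split_ifs <;> norm_num
  split_ifs with h1
  · obtain ⟨x, hx, hp⟩ := h1
    refine le_trans (le_of_eq ?_) (Finset.single_le_sum h0 hx)
    rw [if_pos hp]
  · exact Finset.sum_nonneg h0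

open Classical in
/-- With high probability all likelihood ratios of a finite set of functions are small. -/
lemma Learner.sum_likelihood_ratioProd_large_le [Nonempty A] {ε t : ℝ} (ht : 0 < t)
    (N : Finset (Traj O A H → ℝ)) (K : ℕ) :
    ∑ D : Data O A H K, L.likelihood m θ D * (if ∃ (k : ℕ) (hk : k ≤ K), 1 ≤ k ∧ ∃ f ∈ N,
        (∀ τ, 0 ≤ f τ) ∧ (∀ π : Policy O A, ∑ τ, f τ * π.weight 0 H τ ≤ 1 + ε) ∧
        t < L.ratioProd m θ ε f (initial k hk D) then 1 else 0) ≤ K * N.card / t := by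
  have h := L.sum_likelihood_exists_le m θ (K := K) ((Finset.univ : Finset (Fin K)) ×ˢ N)
    (fun x D => (∀ τ, 0 ≤ x.2 τ) ∧ (∀ π : Policy O A, ∑ τ, x.2 τ * π.weight 0 H τ ≤ 1 + ε) ∧
      t < L.ratioProd m θ ε x.2 (initial (x.1.val + 1) x.1.isLt D)) (b := 1 / t) ?_
  · rw [Finset.card_product, Finset.card_univ, Fintype.card_fin, Nat.cast_mul, mul_one_div] at h
    refine le_trans (Finset.sum_le_sum fun D _ => ?_) h
    refine mul_le_mul_of_nonneg_left ?_ (L.likelihood_nonneg m θ D)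
    split_ifs with h1 h2 h3
    · exact le_rfl
    · obtain ⟨k, hk, hk1, f, hf, h3⟩ := h1
      obtain ⟨j, rfl⟩ : ∃ j, k = j + 1 := ⟨k - 1, by omega⟩
      exact absurd ⟨(⟨j, hk⟩, f), Finset.mem_product.mpr ⟨Finset.mem_univ _, hf⟩, h3⟩ h2
    · exact zero_le_one
    · exact le_rfl
  · rintro ⟨j, f⟩ -
    by_cases hf : (∀ τ, 0 ≤ f τ) ∧ ∀ π : Policy O A, ∑ τ, f τ * π.weight 0 H τ ≤ 1 + ε
    · simp only [hf, true_and, implies_true]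
      exact L.markov m θ (fun D => L.ratioProd_nonneg m θ ε f _)
        (L.sum_likelihood_mul_ratioProd_le m θ hf.1 hf.2 j.isLt) ht
    · have : ∀ D : Data O A H K, ¬ ((∀ τ, 0 ≤ f τ) ∧
          (∀ π : Policy O A, ∑ τ, f τ * π.weight 0 H τ ≤ 1 + ε) ∧
          t < L.ratioProd m θ ε f (initial (j.val + 1) j.isLt D)) :=
        fun D h => hf ⟨h.1, h.2.1⟩
      simp only [this, if_false, mul_zero, Finset.sum_const_zero]
      positivity

variable {m θ}

lemma Learner.log_likelihood {k : ℕ} {D : Data O A H k} (hD : 0 < L.likelihood m θ D) :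
    Real.log (L.likelihood m θ D)
      = ∑ i, ∑ h, (Real.log (θ.prob (D i h)) + Real.log (L.dataWeight m D i h)) := by
  have hpos := likelihood_pos_iff L m θ hD
  rw [Learner.likelihood, Real.log_prod fun i _ => Finset.prod_ne_zero_iff.mpr fun h _ =>
    (mul_pos (hpos i h).1 (hpos i h).2).ne']
  refine Finset.sum_congr rfl fun i _ => ?_
  rw [Real.log_prod fun h _ => (mul_pos (hpos i h).1 (hpos i h).2).ne']
  exact Finset.sum_congr rfl fun h _ => Real.log_mul (hpos i h).1.ne' (hpos i h).2.ne'

/-- A model with a large likelihood predicts the continuations of the histories in the data well. -/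
lemma Learner.sum_sq_condTV_le [Nonempty A] {θ' : POMDP O A S} {ε pmin β t : ℝ}
    (hpmin : 0 < pmin) {f : Traj O A H → ℝ} (hf : ∀ τ, θ'.prob τ ≤ f τ)
    (hε : ∀ π : Policy O A, ∑ τ, (f τ - θ'.prob τ) * π.weight 0 H τ ≤ ε) {k : ℕ}
    {D : Data O A H k} (hD : 0 < L.likelihood m θ D)
    (hmin : ∀ (i : Fin k) (h : Fin H),
      pmin ≤ θ'.prob (past (D i h) h) * (L.policy i (past D i)).weight 0 h (D i h))
    (hβ : Real.exp (-β) * L.likelihood m θ D ≤ L.likelihood m θ' D)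
    (hY : L.ratioProd m θ ε f D ≤ t) :
    ∑ h : Fin H, ∑ i, condTV m L.completion θ' θ h.isLt.le (past (D i h) h) ^ 2
      ≤ 16 * (Real.log t + k * H * (ε / 2)) + 8 * β + 8 * (k * H * (ε / pmin) ^ 2) := by
  have hD' : 0 < L.likelihood m θ' D := lt_of_lt_of_le (mul_pos (Real.exp_pos _) hD) hβ
  have hpos := likelihood_pos_iff L m θ hD
  have hpos' := likelihood_pos_iff L m θ' hD'
  have key := fun (i : Fin k) (h : Fin H) => sq_condTV_le (m := m) (θ := θ) (ρ := L.completion) hf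
    hpmin (L.policy i (past D i)) h (sum_mul_exploreWeight_le (fun τ => sub_nonneg.mpr (hf τ)) hε
      m L.completion (L.policy i (past D i)) h) (hpos i h).1 (by
        have h1 := (hpos i h).2
        rw [Learner.dataWeight, exploreWeight_eq] at h1
        exact pos_of_mul_pos_right h1 (Policy.weight_nonneg _ _ _ _)) (hpos' i h).1 (hmin i h)
  have e1 : ∑ i, ∑ h, (Real.log (θ'.prob (D i h)) - Real.log (θ.prob (D i h)))
      = Real.log (L.likelihood m θ' D) - Real.log (L.likelihood m θ D) := by
    rw [L.log_likelihood hD, L.log_likelihood hD', ← Finset.sum_sub_distrib]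
    refine Finset.sum_congr rfl fun i _ => ?_
    rw [← Finset.sum_sub_distrib]
    exact Finset.sum_congr rfl fun h _ => by ring
  have h1 : -β ≤ Real.log (L.likelihood m θ' D) - Real.log (L.likelihood m θ D) := by
    have := Real.log_le_log (mul_pos (Real.exp_pos _) hD) hβ
    rw [Real.log_mul (Real.exp_pos _).ne' hD.ne', Real.log_exp] at this
    linarith
  have h2 : ∑ i : Fin k, ∑ h : Fin H,
      Real.log (ratioFactor m θ L.completion f h (D i h)) ≤ Real.log t + k * H * (ε / 2) := by
    have hne : ∀ i h, Real.exp (-(ε / 2)) * ratioFactor m θ L.completion f h (D i h) ≠ 0 :=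
      fun i h => (mul_pos (Real.exp_pos _) (key i h).2).ne'
    have hYpos : 0 < L.ratioProd m θ ε f D := Finset.prod_pos fun i _ => Finset.prod_pos
      fun h _ => mul_pos (Real.exp_pos _) (key i h).2
    have h3 := Real.log_le_log hYpos hY
    rw [Learner.ratioProd, Real.log_prod fun i _ => Finset.prod_ne_zero_iff.mpr
      fun h _ => hne i h] at h3
    have e2 : ∀ i : Fin k, Real.log (∏ h : Fin H,
        Real.exp (-(ε / 2)) * ratioFactor m θ L.completion f h (D i h))
        = ∑ h : Fin H, Real.log (ratioFactor m θ L.completion f h (D i h)) - H * (ε / 2) := by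
      intro i
      rw [Real.log_prod fun h _ => hne i h]
      simp only [Real.log_mul (Real.exp_pos _).ne' (key i _).2.ne', Real.log_exp,
        Finset.sum_add_distrib, Finset.sum_const, Finset.card_univ, Fintype.card_fin, nsmul_eq_mul]
      ring
    simp only [e2, Finset.sum_sub_distrib, Finset.sum_const, Finset.card_univ, Fintype.card_fin,
      nsmul_eq_mul] at h3
    linarith
  rw [Finset.sum_comm]
  refine (Finset.sum_le_sum fun i _ => Finset.sum_le_sum fun h _ => (key i h).1).trans ?_
  have e3 : ∑ i : Fin k, ∑ h : Fin H, (16 * (Real.log (ratioFactor m θ L.completion f h (D i h))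
          - (Real.log (θ'.prob (D i h)) - Real.log (θ.prob (D i h))) / 2) + 8 * (ε / pmin) ^ 2)
      = 16 * ∑ i : Fin k, ∑ h : Fin H, Real.log (ratioFactor m θ L.completion f h (D i h))
        - 8 * ∑ i, ∑ h, (Real.log (θ'.prob (D i h)) - Real.log (θ.prob (D i h)))
        + 8 * (k * H * (ε / pmin) ^ 2) := by
    have e4 : ∀ i h, 16 * (Real.log (ratioFactor m θ L.completion f h (D i h))
          - (Real.log (θ'.prob (D i h)) - Real.log (θ.prob (D i h))) / 2) + 8 * (ε / pmin) ^ 2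
        = 16 * Real.log (ratioFactor m θ L.completion f h (D i h))
          - 8 * (Real.log (θ'.prob (D i h)) - Real.log (θ.prob (D i h))) + 8 * (ε / pmin) ^ 2 :=
      fun i h => by ring
    simp only [e4, Finset.sum_add_distrib, Finset.sum_sub_distrib, ← Finset.mul_sum,
      Finset.sum_const, Finset.card_univ, Fintype.card_fin, nsmul_eq_mul]
    ring
  rw [e3, e1]
  linarith

variable (m θ)

lemma POMDP.prob_le_one {n : ℕ} (τ : Fin n → O × A) : θ.prob τ ≤ 1 := by
  induction n with
  | zero => exact θ.init_sum.le
  | succ n ih =>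
    refine le_trans ?_ (ih fun i => τ i.castSucc)
    simp only [POMDP.prob, POMDP.forward]
    rw [Finset.sum_comm]
    refine Finset.sum_le_sum fun s _ => ?_
    rw [← Finset.mul_sum, θ.trans_sum, mul_one]
    refine mul_le_of_le_one_right (θ.forward_nonneg _ _) ?_
    rw [← θ.emit_sum n s]
    exact Finset.single_le_sum (f := θ.emit n s) (fun o _ => θ.emit_nonneg n s o)
      (Finset.mem_univ _)

lemma Learner.likelihood_le_prod {k : ℕ} (D : Data O A H k) :
    L.likelihood m θ D ≤ ∏ i, ∏ h, L.dataWeight m D i h := by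
  refine Finset.prod_le_prod (fun i _ => L.iterLaw_nonneg m θ (past D i) (D i)) fun i _ => ?_
  refine Finset.prod_le_prod (fun h _ => mul_nonneg (θ.prob_nonneg _)
    (exploreWeight_nonneg _ _ _ _ _)) fun h _ => ?_
  exact mul_le_of_le_one_left (exploreWeight_nonneg _ _ _ _ _) (θ.prob_le_one _)

/-- An approximate maximizer of the likelihood exists. -/
lemma Learner.confidenceSet_nonempty {Θ : Set (POMDP O A S)} {pmin β : ℝ} (hβ : 0 < β) {k : ℕ}
    {D : Data O A H k} (hD : 0 < L.likelihood m θ D) (hθ : θ ∈ L.stableModels Θ pmin D) :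
    (L.confidenceSet m Θ pmin β D).Nonempty := by
  set V := (fun θ => L.likelihood m θ D) '' L.stableModels Θ pmin D
  have hbdd : BddAbove V := ⟨∏ i, ∏ h, L.dataWeight m D i h, by
    rintro _ ⟨θ', -, rfl⟩
    exact L.likelihood_le_prod m θ' D⟩
  have hpos : 0 < sSup V := lt_of_lt_of_le hD (le_csSup hbdd ⟨θ, hθ, rfl⟩)
  have hlt : Real.exp (-β) * sSup V < sSup V :=
    mul_lt_of_lt_one_left hpos (Real.exp_zero ▸ Real.exp_lt_exp.mpr (neg_lt_zero.mpr hβ))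
  obtain ⟨_, ⟨θ', hθ', rfl⟩, h⟩ := exists_lt_of_lt_csSup (s := V) ⟨_, θ, hθ, rfl⟩ hlt
  refine ⟨θ', hθ', fun θ'' hθ'' => le_trans ?_ h.le⟩
  exact mul_le_mul_of_nonneg_left (le_csSup hbdd ⟨θ'', hθ'', rfl⟩) (Real.exp_pos _).le

end Likelihood

/-! ### The value of the bonus in one iteration -/

section Regret

variable {O A S : Type*} [Fintype O] [Fintype A] [Fintype S] [DecidableEq S] [DecidableEq A]
  [Nonempty A] [Nonempty S] {H m : ℕ} {a g lam β : ℝ} {θ₁ θ₂ : POMDP O A S}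

/-- A bound on the distance of two models that are close on the data by the norms of the beliefs of
the first one, uniformly over the steps: for the reading of the latent states of the first model by
the second, and for the laws of the histories. -/
lemma potential_le_and_sum_prob_sub_le (ha : 0 < a) (hm : 1 ≤ m) (h₂ : θ₂.IsDecodable m H a)
    (hψ : ∀ τ : Fin 0 → O × A, θ₁.psi m H 0 τ = θ₂.psi m H 0 τ)
    (hg : √(Fintype.card S) / a ≤ g) (hg1 : 1 ≤ g) (hlam : 0 < lam) (hβ : 0 ≤ β)
    (ρ π : Policy O A) {k : ℕ} {D : Data O A H k} (hD : CloseOnData m ρ θ₁ θ₂ D β) {B : ℝ}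
    (hB : B = 64 * bonusScale (Fintype.card A) (Fintype.card S) (coreActsMax A m H) g H lam β)
    {E : ℝ} (hE : E = ∑ τ : Traj O A H, θ₁.prob τ * π.pathWeight τ *
      √(∑ h, beliefNormSq lam θ₁ D h (past τ h))) :
    (∀ h < H, ∑ σ : Fin h → O × A, π.pathWeight σ *
        ∑ s, |(transfer m H θ₁ θ₂ h *ᵥ θ₁.forward h σ) s - θ₂.forward h σ s| ≤ B * E) ∧
      ∀ h ≤ H, ∑ σ : Fin h → O × A, π.pathWeight σ * |θ₁.prob σ - θ₂.prob σ| ≤ B * E := by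
  classical
  -- no history is cut here
  set alive : (n : ℕ) → (Fin n → O × A) → Prop := fun _ _ => True with halive
  have hmono : ∀ n σ x, alive (n + 1) (extend σ x) → alive n σ := fun _ _ _ _ => trivial
  have hsum := sum_aliveError_le ha hm h₂ hg hg1 hlam hβ ρ π D hD alive
  have hsum' : ∑ h ∈ Finset.range H, aliveError m H θ₁ θ₂ π alive h ≤ B * E := by
    refine hsum.trans (le_of_eq ?_)
    rw [hE, Finset.mul_sum]
    refine Finset.sum_congr rfl fun τ _ => ?_
    simp only [halive, if_true]
    rw [hB]
    ring
  have hpos : ∀ h, 0 ≤ aliveError m H θ₁ θ₂ π alive h := fun h =>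
    Finset.sum_nonneg fun σ _ => mul_nonneg (π.pathWeight_nonneg σ) (by
      split_ifs
      · exact stepError_nonneg _ _ _ _ _ (π.prob_nonneg h σ) _
      · exact le_rfl)
  have hpart : ∀ h ≤ H, ∑ j ∈ Finset.range h, aliveError m H θ₁ θ₂ π alive j ≤ B * E :=
    fun h hh => (Finset.sum_le_sum_of_subset_of_nonneg (Finset.range_subset_range.mpr hh)
      fun j _ _ => hpos j).trans hsum'
  refine ⟨fun h hh => ?_, fun h hh => ?_⟩
  · have := (potential_le (π := π) ha h₂ hψ hmono hh).trans (hpart h hh.le)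
    simpa only [potential, halive, if_true] using this
  · rcases h with _ | h
    · have h0 : (0 : ℝ) ≤ B * E := by simpa using hpart 0 hh
      simpa only [POMDP.prob_zero, sub_self, abs_zero, mul_zero, Finset.sum_const_zero] using h0
    · have := (sum_prob_sub_le_sum (π := π) ha h₂ hψ hmono hh).trans (hpart (h + 1) hh)
      simpa only [halive, if_true] using this

lemma sum_transfer_belief_sub_le {B E : ℝ} {π : Policy O A} {h : ℕ}
    (h1 : ∑ σ : Fin h → O × A, π.pathWeight σ *
        ∑ s, |(transfer m H θ₁ θ₂ h *ᵥ θ₁.forward h σ) s - θ₂.forward h σ s| ≤ B * E)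
    (h2 : ∑ σ : Fin h → O × A, π.pathWeight σ * |θ₁.prob σ - θ₂.prob σ| ≤ B * E) :
    ∑ σ : Fin h → O × A, θ₁.prob σ * π.pathWeight σ *
      ∑ s, |(θ₂.belief σ - transfer m H θ₁ θ₂ h *ᵥ θ₁.belief σ) s| ≤ 2 * (B * E) := by
  have h3 : ∀ σ : Fin h → O × A, θ₁.prob σ * π.pathWeight σ *
      ∑ s, |(θ₂.belief σ - transfer m H θ₁ θ₂ h *ᵥ θ₁.belief σ) s|
      ≤ π.pathWeight σ * (∑ s, |(transfer m H θ₁ θ₂ h *ᵥ θ₁.forward h σ) s - θ₂.forward h σ s|)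
        + π.pathWeight σ * |θ₁.prob σ - θ₂.prob σ| := by
    intro σ
    rw [← mul_add, mul_comm (θ₁.prob σ), mul_assoc]
    refine mul_le_mul_of_nonneg_left ?_ (π.pathWeight_nonneg σ)
    have e1 : ∀ s, θ₁.prob σ * |(θ₂.belief σ - transfer m H θ₁ θ₂ h *ᵥ θ₁.belief σ) s|
        ≤ |(transfer m H θ₁ θ₂ h *ᵥ θ₁.forward h σ) s - θ₂.forward h σ s|
          + |θ₁.prob σ - θ₂.prob σ| * |θ₂.belief σ s| := by
      intro s
      rw [← abs_of_nonneg (θ₁.prob_nonneg σ), ← abs_mul, ← abs_mul, abs_of_nonneg (θ₁.prob_nonneg σ),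
        ← θ₁.smul_belief σ, ← θ₂.smul_belief σ, Matrix.mulVec_smul]
      refine le_trans (le_of_eq ?_) ((abs_sub _ _).trans (add_comm _ _).le)
      congr 1
      simp only [Pi.sub_apply, Pi.smul_apply, smul_eq_mul]
      ring
    rw [Finset.mul_sum]
    refine (Finset.sum_le_sum fun s _ => e1 s).trans ?_
    rw [Finset.sum_add_distrib, ← Finset.mul_sum]
    have := mul_le_mul_of_nonneg_left (θ₂.sum_abs_belief_le σ) (abs_nonneg (θ₁.prob σ - θ₂.prob σ))
    linarith
  refine (Finset.sum_le_sum fun σ _ => h3 σ).trans ?_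
  rw [Finset.sum_add_distrib]
  linarith

/-- The comparison of the belief norms of two models, through the reading of the latent states of
the first by the second. -/
lemma sqrt_beliefNormSq_le (ha : 0 < a) (hm : 1 ≤ m) (h₂ : θ₂.IsDecodable m H a)
    (hg : √(Fintype.card S) / a ≤ g) (hlam : 0 < lam)
    (ρ : Policy O A) {k : ℕ} {D : Data O A H k} (hD : CloseOnData m ρ θ₁ θ₂ D β) (h : Fin H)
    (σ : Fin h → O × A) :
    √(beliefNormSq lam θ₂ D h σ)
      ≤ √(2 + (g * coreActsMax A m H) ^ 2 * Fintype.card S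
          + 2 * ((2 * g * Fintype.card A * coreActsMax A m H) ^ 2 * (64 * β)) / lam)
        * √(beliefNormSq lam θ₁ D h σ)
        + (∑ s, |(θ₂.belief σ - transfer m H θ₁ θ₂ h *ᵥ θ₁.belief σ) s|) / √lam := by
  set W := transfer m H θ₁ θ₂ h with hW
  have hg0 : 0 ≤ g := (by positivity : 0 ≤ √(Fintype.card S) / a).trans hg
  have h1 : ∀ v, (W *ᵥ v) ⬝ᵥ (W *ᵥ v)
      ≤ (g * coreActsMax A m H) ^ 2 * Fintype.card S * (v ⬝ᵥ v) := by
    intro v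
    refine (dotProduct_self_le_sq_sum_abs _).trans ?_
    have b1 := sum_abs_transfer_le (θ₁ := θ₁) ha h₂ hg h.isLt v
    have b2 := sum_abs_le_sqrt v
    have b3 : ∑ s, |(W *ᵥ v) s| ≤ g * coreActsMax A m H * (√(Fintype.card S) * √(v ⬝ᵥ v)) := by
      refine b1.trans ?_
      rw [mul_assoc]
      gcongr
    refine (pow_le_pow_left₀ (Finset.sum_nonneg fun _ _ => abs_nonneg _) b3 2).trans (le_of_eq ?_)
    rw [mul_pow, mul_pow (√_), Real.sq_sqrt (Nat.cast_nonneg _),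
      Real.sq_sqrt (dotProduct_self_nonneg' v)]
    ring
  have h2 : ∑ i, (θ₂.belief (past (D i h) h) - W *ᵥ θ₁.belief (past (D i h) h)) ⬝ᵥ
      (θ₂.belief (past (D i h) h) - W *ᵥ θ₁.belief (past (D i h) h))
      ≤ (2 * g * Fintype.card A * coreActsMax A m H) ^ 2 * (64 * β) := by
    have b1 : ∀ i, (θ₂.belief (past (D i h) h) - W *ᵥ θ₁.belief (past (D i h) h)) ⬝ᵥ
        (θ₂.belief (past (D i h) h) - W *ᵥ θ₁.belief (past (D i h) h))
        ≤ (2 * g * Fintype.card A * coreActsMax A m H) ^ 2 *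
          condTV m ρ θ₁ θ₂ h.isLt.le (past (D i h) h) ^ 2 := by
      intro i
      refine (dotProduct_self_le_sq_sum_abs _).trans ?_
      have b2 := sum_abs_transfer_belief_sub_le (θ₁ := θ₁) ha hm h₂ hg ρ h.isLt (past (D i h) h)
      have b3 : ∑ s, |(θ₂.belief (past (D i h) h) - W *ᵥ θ₁.belief (past (D i h) h)) s|
          = ∑ s, |(W *ᵥ θ₁.belief (past (D i h) h) - θ₂.belief (past (D i h) h)) s| :=
        Finset.sum_congr rfl fun s _ => by rw [Pi.sub_apply, Pi.sub_apply, abs_sub_comm]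
      rw [b3, ← mul_pow]
      refine pow_le_pow_left₀ (Finset.sum_nonneg fun _ _ => abs_nonneg _) (b2.trans (le_of_eq ?_)) 2
      ring
    refine (Finset.sum_le_sum fun i _ => b1 i).trans ?_
    rw [← Finset.mul_sum]
    refine mul_le_mul_of_nonneg_left (le_trans ?_ hD) (sq_nonneg _)
    exact Finset.single_le_sum (f := fun h : Fin H =>
      ∑ i, condTV m ρ θ₁ θ₂ h.isLt.le (past (D i h) h) ^ 2)
      (fun h _ => Finset.sum_nonneg fun i _ => sq_nonneg _) (Finset.mem_univ h)
  have h3 := invNormSq_mulVec_le (s := Finset.univ)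
    (x := fun i => θ₁.belief (past (D i h) h)) (x' := fun i => θ₂.belief (past (D i h) h))
    hlam W (by positivity) h1 h2 (θ₁.belief σ)
  have h4 := sqrt_invNormSq_add_le (s := Finset.univ)
    (x := fun i => θ₂.belief (past (D i h) h)) hlam (W *ᵥ θ₁.belief σ)
    (θ₂.belief σ - W *ᵥ θ₁.belief σ)
  rw [add_sub_cancel] at h4
  refine h4.trans (add_le_add ?_ ?_)
  · rw [← Real.sqrt_mul' _ (beliefNormSq_nonneg hlam θ₁ D h σ)]
    exact Real.sqrt_le_sqrt h3
  · have h5 := invNormSq_le_div (s := Finset.univ) (x := fun i => θ₂.belief (past (D i h) h)) hlam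
      (θ₂.belief σ - W *ᵥ θ₁.belief σ)
    refine (Real.sqrt_le_sqrt h5).trans ?_
    rw [Real.sqrt_div' _ hlam.le]
    refine div_le_div_of_nonneg_right ?_ (Real.sqrt_nonneg _)
    exact Real.sqrt_le_iff.mpr ⟨Finset.sum_nonneg fun _ _ => abs_nonneg _,
      dotProduct_self_le_sq_sum_abs _⟩

/-- The value of the bonus of the estimated model `θ₂` is bounded by the mean belief norms of the
true model `θ₁`. -/
lemma value_bonus_le {α : ℝ} (ha : 0 < a) (hm : 1 ≤ m) (h₂ : θ₂.IsDecodable m H a)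
    (hψ : ∀ τ : Fin 0 → O × A, θ₁.psi m H 0 τ = θ₂.psi m H 0 τ)
    (hg : √(Fintype.card S) / a ≤ g) (hg1 : 1 ≤ g) (hlam : 0 < lam) (hβ : 0 ≤ β) (hα : 0 ≤ α)
    (ρ π : Policy O A) {k : ℕ} {D : Data O A H k} (hD : CloseOnData m ρ θ₁ θ₂ D β) {B κ : ℝ}
    (hB : B = 64 * bonusScale (Fintype.card A) (Fintype.card S) (coreActsMax A m H) g H lam β)
    (hκ : κ = 2 + (g * coreActsMax A m H) ^ 2 * Fintype.card S
          + 2 * ((2 * g * Fintype.card A * coreActsMax A m H) ^ 2 * (64 * β)) / lam) :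
    θ₂.value π (bonus m lam α θ₂ D) ≤ (α * √κ + 2 * α * H * B / √lam + B) *
      ∑ h : Fin H, √(∑ σ : Fin h → O × A,
        θ₁.prob σ * π.pathWeight σ * beliefNormSq lam θ₁ D h σ) := by
  set P : Traj O A H → ℝ := fun τ => θ₁.prob τ * π.pathWeight τ with hP
  have hP0 : ∀ τ, 0 ≤ P τ := fun τ => mul_nonneg (θ₁.prob_nonneg τ) (π.pathWeight_nonneg τ)
  set y : Fin H → Traj O A H → ℝ := fun h τ => beliefNormSq lam θ₁ D h (past τ h) with hy
  have hy0 : ∀ h τ, 0 ≤ y h τ := fun h τ => beliefNormSq_nonneg hlam θ₁ D h _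
  set e : Fin H → Traj O A H → ℝ := fun h τ =>
    ∑ s, |(θ₂.belief (past τ h) - transfer m H θ₁ θ₂ h *ᵥ θ₁.belief (past τ h)) s| with he
  set E := ∑ τ : Traj O A H, P τ * √(∑ h, y h τ) with hE
  set Z := ∑ h : Fin H, √(∑ σ : Fin h → O × A,
        θ₁.prob σ * π.pathWeight σ * beliefNormSq lam θ₁ D h σ) with hZ
  obtain ⟨hX, hT⟩ := potential_le_and_sum_prob_sub_le (π := π) ha hm h₂ hψ hg hg1 hlam hβ ρ hD hB hE
  have hB0 : 0 ≤ B := by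
    rw [hB, bonusScale]
    positivity
  have hsqrt : ∀ (n : ℕ) (z : Fin n → ℝ), (∀ i, 0 ≤ z i) → √(∑ i, z i) ≤ ∑ i, √(z i) := by
    intro n z hz
    refine Real.sqrt_le_iff.mpr ⟨Finset.sum_nonneg fun _ _ => Real.sqrt_nonneg _, ?_⟩
    refine le_trans (le_of_eq (Finset.sum_congr rfl fun i _ => (Real.sq_sqrt (hz i)).symm)) ?_
    exact Finset.sum_sq_le_sq_sum_of_nonneg fun i _ => Real.sqrt_nonneg _
  -- Jensen's inequality
  have hjen : ∑ h, ∑ τ, P τ * √(y h τ) ≤ Z := by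
    refine Finset.sum_le_sum fun h _ => ?_
    have j1 : ∀ τ, P τ * √(y h τ) = √(P τ) * √(P τ * y h τ) := fun τ => by
      rw [Real.sqrt_mul (hP0 τ), ← mul_assoc, Real.mul_self_sqrt (hP0 τ)]
    simp only [j1]
    refine (Real.sum_sqrt_mul_sqrt_le Finset.univ hP0
      fun τ => mul_nonneg (hP0 τ) (hy0 h τ)).trans (le_of_eq ?_)
    have j2 : ∑ τ, P τ = 1 := sum_prob_mul_pathWeight θ₁ π H
    rw [j2, Real.sqrt_one, one_mul]
    congr 1
    exact sum_prob_mul_initial θ₁ π h.isLt.le fun σ => beliefNormSq lam θ₁ D h σ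
  have hEZ : E ≤ Z := by
    refine le_trans ?_ hjen
    rw [Finset.sum_comm]
    refine Finset.sum_le_sum fun τ _ => ?_
    rw [← Finset.mul_sum]
    exact mul_le_mul_of_nonneg_left (hsqrt H _ fun h => hy0 h τ) (hP0 τ)
  have hBE : B * E ≤ B * Z := mul_le_mul_of_nonneg_left hEZ hB0
  have herr : ∀ h : Fin H, ∑ τ, P τ * e h τ ≤ 2 * (B * Z) := by
    intro h
    have := sum_transfer_belief_sub_le (hX h h.isLt) (hT h h.isLt.le)
    rw [← sum_prob_mul_initial θ₁ π h.isLt.le fun σ : Fin h → O × A =>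
      ∑ s, |(θ₂.belief σ - transfer m H θ₁ θ₂ h *ᵥ θ₁.belief σ) s|] at this
    exact this.trans (by linarith)
  have hbon : ∀ τ, bonus m lam α θ₂ D τ ≤ α * ∑ h, (√κ * √(y h τ) + e h τ / √lam) := by
    intro τ
    rw [bonus_eq ha θ₂ h₂]
    refine (min_le_left _ _).trans (mul_le_mul_of_nonneg_left ?_ hα)
    refine (hsqrt H _ fun h => beliefNormSq_nonneg hlam θ₂ D h _).trans ?_
    refine Finset.sum_le_sum fun h _ => ?_
    rw [hκ]
    exact sqrt_beliefNormSq_le ha hm h₂ hg hlam ρ hD h (past τ h)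
  have hval : ∑ τ, P τ * bonus m lam α θ₂ D τ ≤ (α * √κ + 2 * α * H * B / √lam) * Z := by
    refine (Finset.sum_le_sum fun τ _ => mul_le_mul_of_nonneg_left (hbon τ) (hP0 τ)).trans ?_
    have e1 : ∑ τ, P τ * (α * ∑ h, (√κ * √(y h τ) + e h τ / √lam))
        = α * (√κ * ∑ h, ∑ τ, P τ * √(y h τ) + (∑ h, ∑ τ, P τ * e h τ) / √lam) := by
      rw [Finset.mul_sum, Finset.sum_div, ← Finset.sum_add_distrib, Finset.mul_sum]
      simp only [Finset.mul_sum, Finset.sum_div, mul_add]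
      rw [Finset.sum_comm]
      refine Finset.sum_congr rfl fun h _ => ?_
      rw [← Finset.sum_add_distrib]
      exact Finset.sum_congr rfl fun τ _ => by ring
    rw [e1]
    have e2 : ∑ h, ∑ τ, P τ * e h τ ≤ H * (2 * (B * Z)) := by
      refine (Finset.sum_le_sum fun h _ => herr h).trans (le_of_eq ?_)
      simp
    have e3 : (∑ h, ∑ τ, P τ * e h τ) / √lam ≤ H * (2 * (B * Z)) / √lam :=
      div_le_div_of_nonneg_right e2 (Real.sqrt_nonneg _)
    have e4 : √κ * ∑ h, ∑ τ, P τ * √(y h τ) ≤ √κ * Z :=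
      mul_le_mul_of_nonneg_left hjen (Real.sqrt_nonneg _)
    refine (mul_le_mul_of_nonneg_left (add_le_add e4 e3) hα).trans (le_of_eq ?_)
    ring
  have hchange : θ₂.value π (bonus m lam α θ₂ D)
      ≤ ∑ τ, P τ * bonus m lam α θ₂ D τ + B * Z := by
    refine le_trans ?_ (add_le_add le_rfl ((hT H le_rfl).trans hBE))
    rw [θ₂.value_eq, ← Finset.sum_add_distrib]
    refine Finset.sum_le_sum fun τ _ => ?_
    have c1 : bonus m lam α θ₂ D τ ≤ 1 := min_le_right _ _
    have c0 := bonus_nonneg (m := m) (lam := lam) hα θ₂ D τ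
    have c2 : (θ₂.prob τ - θ₁.prob τ) * bonus m lam α θ₂ D τ ≤ |θ₁.prob τ - θ₂.prob τ| := by
      rw [abs_sub_comm]
      refine (mul_le_mul_of_nonneg_right (le_abs_self _) c0).trans ?_
      exact mul_le_of_le_one_right (abs_nonneg _) c1
    have c3 := mul_le_mul_of_nonneg_left c2 (π.pathWeight_nonneg τ)
    simp only [hP]
    linarith
  refine hchange.trans ?_
  refine (add_le_add hval le_rfl).trans (le_of_eq ?_)
  ring

end Regret

/-! ### The sum over the iterations -/

section Iterations

variable {O A S : Type*} [Fintype O] [Fintype A] [Fintype S] [DecidableEq S] [DecidableEq A]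
  [Nonempty A] [Nonempty S] {H m : ℕ}

/-- The elliptical potential argument for the sampled beliefs. -/
lemma sum_beliefNormSq_le {lam : ℝ} (hlam : 0 < lam) (θ : POMDP O A S) {K : ℕ} (D : Data O A H K)
    (h : Fin H) :
    ∑ i : Fin K, beliefNormSq lam θ (past D i) h (past (D i h) h)
      ≤ (1 + 1 / lam) * (Fintype.card S * Real.log (Fintype.card S + K / lam)) := by
  set y : ℕ → S → ℝ := fun k => if hk : k < K then θ.belief (past (D ⟨k, hk⟩ h) h) else 0 with hy
  have hyi : ∀ (k : ℕ) (hk : k < K), y k = θ.belief (past (D ⟨k, hk⟩ h) h) := fun k hk => by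
    simp only [hy, dif_pos hk]
  have h1 := sum_invNormSq_le hlam y (fun k => by
    by_cases hk : k < K
    · rw [hyi k hk]; exact θ.belief_dotProduct_self_le _
    · simp [hy, hk]) K
  rw [Finset.sum_range] at h1
  refine le_trans (le_of_eq (Finset.sum_congr rfl fun i _ => ?_)) h1
  rw [beliefNormSq, invNormSq, invNormSq, momentMatrix, momentMatrix, Finset.sum_range,
    hyi i i.isLt]
  have e : ∀ j : Fin i, y j = θ.belief (past (past D i j h) h) := fun j =>
    hyi j (j.isLt.trans i.isLt)
  simp only [e]

/-- The conditional means of the belief norms are summable at the rate of the sampled norms. -/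
lemma Learner.sum_meanNormSq_le (L : Learner O A S H) {lam t : ℝ} (hlam : 0 < lam)
    (θ : POMDP O A S) {K : ℕ} {D : Data O A H K}
    (hD : ∏ i : Fin K, ∏ h : Fin H, Real.exp (lam * (L.meanNormSq θ lam (past D i) h / 2
        - beliefNormSq lam θ (past D i) h (past (D i h) h))) ≤ t) :
    ∑ i : Fin K, ∑ h : Fin H, L.meanNormSq θ lam (past D i) h
      ≤ 2 * (H * ((1 + 1 / lam) * (Fintype.card S * Real.log (Fintype.card S + K / lam)))
        + Real.log t / lam) := by
  simp only [← Real.exp_sum] at hD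
  have h1 := (Real.le_log_iff_exp_le (lt_of_lt_of_le (Real.exp_pos _) hD)).mpr hD
  have e1 : ∑ i : Fin K, ∑ h : Fin H, lam * (L.meanNormSq θ lam (past D i) h / 2
        - beliefNormSq lam θ (past D i) h (past (D i h) h))
      = lam * ((∑ i : Fin K, ∑ h : Fin H, L.meanNormSq θ lam (past D i) h) / 2
        - ∑ h : Fin H, ∑ i : Fin K, beliefNormSq lam θ (past D i) h (past (D i h) h)) := by
    rw [Finset.sum_comm (γ := Fin H)]
    simp only [← Finset.mul_sum, Finset.sum_sub_distrib, Finset.sum_div]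
  rw [e1, ← le_div_iff₀' hlam] at h1
  have h2 : ∑ h : Fin H, ∑ i : Fin K, beliefNormSq lam θ (past D i) h (past (D i h) h)
      ≤ H * ((1 + 1 / lam) * (Fintype.card S * Real.log (Fintype.card S + K / lam))) := by
    refine (Finset.sum_le_sum fun h _ => sum_beliefNormSq_le hlam θ D h).trans (le_of_eq ?_)
    simp
  linarith

/-- If a quantity exceeds `v` in the iterations `1, …, n - 1` although it is controlled by square
roots of a summable quantity, then `n` is small. -/
lemma sq_mul_le_of_lt_sum_sqrt {K H n : ℕ} (hn : n ≤ K) {μ : Fin K → Fin H → ℝ}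
    (hμ : ∀ i h, 0 ≤ μ i h) {M R v : ℝ} (hM : ∑ i, ∑ h, μ i h ≤ M) (hv : 0 ≤ v)
    (h : ∀ i : Fin K, 1 ≤ i.val → i.val < n → v ≤ R * ∑ h, √(μ i h)) :
    (((n - 1 : ℕ) : ℝ) * v) ^ 2 ≤ R ^ 2 * (((n - 1 : ℕ) : ℝ) * H * M) := by
  set e : Fin (n - 1) ↪ Fin K := ⟨fun j => ⟨j.val + 1, by omega⟩, fun i j hij => by
    simpa [Fin.ext_iff] using hij⟩ with he
  have h1 : ((n - 1 : ℕ) : ℝ) * v ≤ R * ∑ p : Fin (n - 1) × Fin H, √(μ (e p.1) p.2) := by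
    rw [Fintype.sum_prod_type, Finset.mul_sum]
    refine le_trans (le_of_eq ?_) (Finset.sum_le_sum fun j _ => h (e j)
      (Nat.le_add_left 1 j.val) (by have := j.isLt; simp only [he]; change j.val + 1 < n; omega))
    simp
  have h2 := sq_sum_le_card_mul_sum_sq (s := (Finset.univ : Finset (Fin (n - 1) × Fin H)))
    (f := fun p => √(μ (e p.1) p.2))
  have h3 : ∑ p : Fin (n - 1) × Fin H, √(μ (e p.1) p.2) ^ 2 ≤ M := by
    simp only [Real.sq_sqrt (hμ _ _)]
    rw [Fintype.sum_prod_type]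
    refine le_trans ?_ hM
    rw [← Finset.sum_map Finset.univ e fun i => ∑ h, μ i h]
    exact Finset.sum_le_sum_of_subset_of_nonneg (Finset.subset_univ _)
      fun i _ _ => Finset.sum_nonneg fun h _ => hμ i h
  have h4 : ((Finset.univ : Finset (Fin (n - 1) × Fin H)).card : ℝ) = ((n - 1 : ℕ) : ℝ) * H := by
    simp
  rw [h4] at h2
  calc (((n - 1 : ℕ) : ℝ) * v) ^ 2 ≤ (R * ∑ p : Fin (n - 1) × Fin H, √(μ (e p.1) p.2)) ^ 2 :=
        pow_le_pow_left₀ (by positivity) h1 2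
    _ = R ^ 2 * (∑ p : Fin (n - 1) × Fin H, √(μ (e p.1) p.2)) ^ 2 := mul_pow _ _ _
    _ ≤ R ^ 2 * (((n - 1 : ℕ) : ℝ) * H * M) :=
        mul_le_mul_of_nonneg_left (h2.trans (mul_le_mul_of_nonneg_left h3 (by positivity)))
          (sq_nonneg _)

/-! ### The constants -/

lemma le_coreActsMax_of_isDecodable {a : ℝ} (ha : 0 < a) (hH : 1 ≤ H) {θ : POMDP O A S}
    (hθ : θ.IsDecodable m H a) : a ≤ coreActsMax A m H := by
  obtain ⟨s⟩ := ‹Nonempty S›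
  have h1 := sq_mul_dotProduct_le_of_sigmaMin ha.le (hθ ⟨0, hH⟩) (Pi.single s 1)
  have h2 := dotProduct_self_le_sq_sum_abs (θ.emissionAction m H 0 *ᵥ Pi.single s 1)
  have h3 := θ.sum_abs_emissionAction_mulVec_le (m := m) hH (Nat.zero_le H) (Pi.single s 1)
  have h4 : ∑ s', |(Pi.single s 1 : S → ℝ) s'| = 1 := by
    rw [Finset.sum_eq_single s] <;> simp +contextual
  rw [h4, mul_one] at h3
  have h5 : (Pi.single s 1 : S → ℝ) ⬝ᵥ Pi.single s 1 = 1 := by simp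
  rw [h5, mul_one] at h1
  have h6 := h1.trans h2
  exact ((le_abs_self a).trans (abs_le_of_sq_le_sq h6
    (Finset.sum_nonneg fun _ _ => abs_nonneg _))).trans h3

/-- The regularization of the second-moment matrices is neither too small nor too large. -/
lemma regularization_bounds {γ A' q β r Hr lam : ℝ} (hγ : 0 < γ) (hγ1 : γ ≤ 1) (hA : 1 ≤ A')
    (hq : 1 ≤ q) (hβ : 1 ≤ β) (hr : 1 ≤ r) (hH : 1 ≤ Hr)
    (hlam : lam = γ * A' ^ 2 * q * β * max (√r) (q * √Hr / γ) / √(r * Hr)) :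
    0 < lam ∧ 1 / lam ≤ r ∧ lam ≤ (A' * q * β) ^ 2 := by
  have hr1 : 1 ≤ √r := Real.one_le_sqrt.mpr hr
  have hH1 : 1 ≤ √Hr := Real.one_le_sqrt.mpr hH
  have hrr : √r * √r = r := Real.mul_self_sqrt (by linarith)
  have e0 : √(r * Hr) = √r * √Hr := Real.sqrt_mul (by linarith) _
  set M := max (√r) (q * √Hr / γ) with hM
  have m1 : q * √Hr ≤ γ * M := by
    have := le_max_right (√r) (q * √Hr / γ)
    rw [div_le_iff₀ hγ] at this
    linarith
  have m2 : γ * M ≤ q * √Hr * √r := by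
    rw [hM, mul_max_of_nonneg _ _ hγ.le]
    refine max_le ?_ ?_
    · have : 1 ≤ q * √Hr := one_le_mul_of_one_le_of_one_le hq hH1
      nlinarith
    · rw [mul_div_cancel₀ _ hγ.ne']
      exact le_mul_of_one_le_right (by positivity) hr1
  have e1 : lam = A' ^ 2 * q * β * (γ * M) / (√r * √Hr) := by rw [hlam, e0]; ring
  have hden : 0 < √r * √Hr := by positivity
  have l1 : A' ^ 2 * q ^ 2 * β / √r ≤ lam := by
    rw [e1, div_le_div_iff₀ (by positivity) hden]
    have : A' ^ 2 * q * β * (q * √Hr) * √r ≤ A' ^ 2 * q * β * (γ * M) * √r := by gcongr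
    nlinarith
  have l2 : lam ≤ A' ^ 2 * q ^ 2 * β := by
    rw [e1, div_le_iff₀ hden]
    have : A' ^ 2 * q * β * (γ * M) ≤ A' ^ 2 * q * β * (q * √Hr * √r) := by gcongr
    nlinarith
  have l0 : 1 ≤ A' ^ 2 * q ^ 2 * β :=
    one_le_mul_of_one_le_of_one_le (one_le_mul_of_one_le_of_one_le (one_le_pow₀ hA)
      (one_le_pow₀ hq)) hβ
  have hpos : 0 < lam := lt_of_lt_of_le (by positivity) l1
  refine ⟨hpos, ?_, ?_⟩
  · rw [div_le_iff₀ hpos]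
    have : 1 ≤ √r * lam := by
      rw [div_le_iff₀ (by positivity)] at l1
      linarith
    nlinarith
  · refine l2.trans ?_
    have : β ≤ β ^ 2 := by nlinarith
    calc A' ^ 2 * q ^ 2 * β ≤ A' ^ 2 * q ^ 2 * β ^ 2 := by gcongr
      _ = _ := by ring

/-- The coefficient of the belief norms in the bound on the value of the bonus is polynomial in the
parameters. -/
lemma regretCoeff_le {A' q g β r Hr lam c T : ℝ} (hg : 1 ≤ g) (hA : 1 ≤ A') (hq : 1 ≤ q)
    (hβ : 1 ≤ β) (hr : 1 ≤ r) (hH : 1 ≤ Hr) (hc : 1 ≤ c) (hlam : 0 < lam) (hlam1 : 1 / lam ≤ r)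
    (hlam2 : lam ≤ (A' * q * β) ^ 2) (hT : T = 1 + r * g * q * Hr * A' * β) :
    c * bonusScale A' r q g Hr lam β * √(2 + (g * q) ^ 2 * r
          + 2 * ((2 * g * A' * q) ^ 2 * (64 * β)) / lam)
        + 2 * (c * bonusScale A' r q g Hr lam β) * Hr * (64 * bonusScale A' r q g Hr lam β) / √lam
        + 64 * bonusScale A' r q g Hr lam β ≤ 700 * c * T ^ 9 := by
  have hsub : ∀ x y : ℝ, 0 ≤ x → 1 ≤ y → x * y = r * g * q * Hr * A' * β → x ≤ T := by
    intro x y hx hy hxy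
    have := le_mul_of_one_le_right hx hy
    linarith
  have one : ∀ {x y : ℝ}, 1 ≤ x → 1 ≤ y → 1 ≤ x * y := fun h1 h2 =>
    one_le_mul_of_one_le_of_one_le h1 h2
  have sqrt_le : ∀ {x : ℝ}, 1 ≤ x → √x ≤ x := fun h =>
    Real.sqrt_le_iff.mpr ⟨by linarith, by nlinarith⟩
  have t1 : q * (Hr * r) ≤ T := hsub _ (g * A' * β) (by positivity) (one (one hg hA) hβ) (by ring)
  have t2 : g ≤ T := hsub _ (r * q * Hr * A' * β) (by positivity)
    (one (one (one (one hr hq) hH) hA) hβ) (by ring)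
  have t3 : A' * q * β ≤ T := hsub _ (r * g * Hr) (by positivity) (one (one hr hg) hH) (by ring)
  have t4 : A' * q * β * g ≤ T := hsub _ (r * Hr) (by positivity) (one hr hH) (by ring)
  have t5 : g * q * r ≤ T := hsub _ (Hr * A' * β) (by positivity) (one (one hH hA) hβ) (by ring)
  have t6 : g * A' * q * β * r ≤ T := hsub _ Hr (by positivity) hH (by ring)
  have t7 : Hr * r ≤ T := hsub _ (q * g * A' * β) (by positivity)
    (one (one (one hq hg) hA) hβ) (by ring)
  have hT1 : 1 ≤ T := (one hH hr).trans t7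
  have hTpow : ∀ {i j : ℕ}, i ≤ j → T ^ i ≤ T ^ j := fun h => pow_le_pow_right₀ hT1 h
  set b := bonusScale A' r q g Hr lam β with hb
  have hb0 : 0 ≤ b := by rw [hb, bonusScale]; positivity
  have b1 : b ≤ 2 * T ^ 4 := by
    have e1 : q * √(Hr * r) ≤ T :=
      (mul_le_mul_of_nonneg_left (sqrt_le (one hH hr)) (by positivity)).trans t1
    have e2 : √lam ≤ T := (Real.sqrt_le_iff.mpr ⟨by positivity, hlam2⟩).trans t3
    have e3 : A' * q * √β * g ≤ T := by
      refine le_trans ?_ t4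
      gcongr
      exact sqrt_le hβ
    have e4 : q * √(Hr * r) * g ^ 2 * √lam ≤ T * T ^ 2 * T := by gcongr
    have e5 := hTpow (show 1 ≤ 4 by norm_num)
    rw [hb, bonusScale]
    nlinarith
  have b2 : √(2 + (g * q) ^ 2 * r + 2 * ((2 * g * A' * q) ^ 2 * (64 * β)) / lam) ≤ 23 * T := by
    refine Real.sqrt_le_iff.mpr ⟨by positivity, ?_⟩
    have e1 : (g * q) ^ 2 * r ≤ T ^ 2 := by
      refine le_trans ?_ (pow_le_pow_left₀ (by positivity) t5 2)
      rw [mul_pow (g * q)]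
      gcongr
      nlinarith
    have e2 : 2 * ((2 * g * A' * q) ^ 2 * (64 * β)) / lam ≤ 512 * T ^ 2 := by
      calc 2 * ((2 * g * A' * q) ^ 2 * (64 * β)) / lam
          = 512 * ((g * A' * q) ^ 2 * β * (1 / lam)) := by ring
        _ ≤ 512 * ((g * A' * q) ^ 2 * β ^ 2 * r ^ 2) := by
            have : 1 / lam ≤ r ^ 2 := hlam1.trans (by nlinarith)
            have : β ≤ β ^ 2 := by nlinarith
            gcongr
        _ = 512 * (g * A' * q * β * r) ^ 2 := by ring
        _ ≤ 512 * T ^ 2 := by gcongr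
    nlinarith
  have b3 : Hr / √lam ≤ T := by
    refine le_trans ?_ t7
    rw [div_eq_mul_one_div]
    refine mul_le_mul_of_nonneg_left ?_ (by positivity)
    rw [← Real.sqrt_one, ← Real.sqrt_div' _ hlam.le]
    exact (Real.sqrt_le_sqrt hlam1).trans (sqrt_le hr)
  have p1 : c * b * √(2 + (g * q) ^ 2 * r + 2 * ((2 * g * A' * q) ^ 2 * (64 * β)) / lam)
      ≤ c * (2 * T ^ 4) * (23 * T) := by gcongr
  have p2 : 2 * (c * b) * Hr * (64 * b) / √lam ≤ 2 * (c * (2 * T ^ 4)) * (64 * (2 * T ^ 4)) * T := by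
    calc 2 * (c * b) * Hr * (64 * b) / √lam = 2 * (c * b) * (64 * b) * (Hr / √lam) := by ring
      _ ≤ _ := by gcongr
  have p3 : c * T ^ 5 ≤ c * T ^ 9 :=
    mul_le_mul_of_nonneg_left (hTpow (by norm_num)) (by positivity)
  have p4 : T ^ 4 ≤ c * T ^ 9 := by
    have := hTpow (show 4 ≤ 9 by norm_num)
    nlinarith [pow_pos (zero_lt_one.trans_le hT1) 9]
  have p5 : 0 ≤ c * T ^ 9 := by positivity
  calc _ ≤ c * (2 * T ^ 4) * (23 * T) + 2 * (c * (2 * T ^ 4)) * (64 * (2 * T ^ 4)) * T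
        + 64 * (2 * T ^ 4) := by linarith
    _ = 46 * (c * T ^ 5) + 512 * (c * T ^ 9) + 128 * T ^ 4 := by ring
    _ ≤ _ := by linarith

/-- The total of the conditional means is polynomial in the parameters. -/
lemma potentialBound_le {A' q g β r Hr lam K t T : ℝ} (hg : 1 ≤ g) (hA : 1 ≤ A') (hq : 1 ≤ q)
    (hβ : 1 ≤ β) (hr : 1 ≤ r) (hH : 1 ≤ Hr) (hlam : 0 < lam) (hlam1 : 1 / lam ≤ r) (hK : 1 ≤ K)
    (hK' : Real.log K ≤ β) (ht : Real.log t ≤ β) (hT : T = 1 + r * g * q * Hr * A' * β) :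
    2 * (Hr * ((1 + 1 / lam) * (r * Real.log (r + K / lam))) + Real.log t / lam) ≤ 14 * T ^ 3 := by
  have hsub : ∀ x y : ℝ, 0 ≤ x → 1 ≤ y → x * y = r * g * q * Hr * A' * β → x ≤ T := by
    intro x y hx hy hxy
    have := le_mul_of_one_le_right hx hy
    linarith
  have one : ∀ {x y : ℝ}, 1 ≤ x → 1 ≤ y → 1 ≤ x * y := fun h1 h2 =>
    one_le_mul_of_one_le_of_one_le h1 h2
  have t1 : Hr * r ≤ T := hsub _ (q * g * A' * β) (by positivity)
    (one (one (one hq hg) hA) hβ) (by ring)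
  have t2 : β * r ≤ T := hsub _ (q * g * A' * Hr) (by positivity)
    (one (one (one hq hg) hA) hH) (by ring)
  have hT1 : 1 ≤ T := (one hH hr).trans t1
  have hrT : r ≤ T := le_trans (by nlinarith) t1
  have hβT : β ≤ T := le_trans (by nlinarith) t2
  have hlog : Real.log (r + K / lam) ≤ 3 * T := by
    have e1 : r + K / lam ≤ 2 * r * K := by
      have : K / lam ≤ K * r := by
        rw [div_eq_mul_one_div]
        gcongr
      nlinarith
    refine (Real.log_le_log (by positivity) e1).trans ?_
    rw [Real.log_mul (by positivity) (by positivity)]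
    have := Real.log_le_sub_one_of_pos (show 0 < 2 * r by positivity)
    linarith
  have hlog0 : 0 ≤ Real.log (r + K / lam) :=
    Real.log_nonneg (by have : 0 ≤ K / lam := by positivity
                        linarith)
  have h1 : Hr * ((1 + 1 / lam) * (r * Real.log (r + K / lam))) ≤ 6 * T ^ 3 := by
    calc Hr * ((1 + 1 / lam) * (r * Real.log (r + K / lam)))
        = (Hr * r) * (1 + 1 / lam) * Real.log (r + K / lam) := by ring
      _ ≤ T * (2 * T) * (3 * T) := by
          have : 1 + 1 / lam ≤ 2 * T := by linarith
          gcongr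
      _ = _ := by ring
  have h2 : Real.log t / lam ≤ T := by
    rw [div_eq_mul_one_div]
    refine (mul_le_mul_of_nonneg_right ht (by positivity)).trans (le_trans ?_ t2)
    gcongr
  have h3 : T ≤ T ^ 3 := le_self_pow₀ hT1 (by norm_num)
  linarith

/-- The width of the confidence set dominates the logarithmic terms. -/
lemma log_bounds {c K N δ β : ℝ} (hc : 1 ≤ c) (hK : 3 ≤ K) (hN : 1 ≤ N) (hδ : 0 < δ)
    (hδ1 : δ ≤ 1) (hβ : c * Real.log (K * N / δ) ≤ β) :
    1 ≤ β ∧ Real.log K ≤ β ∧ Real.log (3 / δ) ≤ β ∧ Real.log (3 * (K * N / δ)) ≤ 2 * β := by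
  have hK0 : 0 < K := by linarith
  have hKN : K ≤ K * N := le_mul_of_one_le_right hK0.le hN
  have h1 : 3 / δ ≤ K * N / δ := div_le_div_of_nonneg_right (hK.trans hKN) hδ.le
  have h2 : K * N ≤ K * N / δ := by
    rw [le_div_iff₀ hδ]
    exact mul_le_of_le_one_right (hK0.le.trans hKN) hδ1
  have hlog3 : 1 ≤ Real.log 3 := by
    rw [Real.le_log_iff_exp_le (by norm_num)]
    linarith [Real.exp_one_lt_d9]
  have l1 : Real.log 3 ≤ Real.log (K * N / δ) :=
    Real.log_le_log (by norm_num) (hK.trans (hKN.trans h2))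
  have l2 : Real.log (K * N / δ) ≤ β :=
    (le_mul_of_one_le_left (by linarith) hc).trans hβ
  have l3 := Real.log_le_log hK0 (hKN.trans h2)
  have l4 := Real.log_le_log (by positivity) h1
  have l5 : Real.log (3 * (K * N / δ)) = Real.log 3 + Real.log (K * N / δ) :=
    Real.log_mul (by norm_num) (by positivity)
  refine ⟨?_, ?_, ?_, ?_⟩ <;> linarith

/-- The net is fine relative to the least probability of a sampled history. -/
lemma net_bounds {c K Hr p e : ℝ} (hc : 1 ≤ c) (hK : 1 ≤ K) (hH : 1 ≤ Hr) (hp : 0 < p)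
    (hp1 : p ≤ 1) (he : 0 < e) (h : e ≤ p / (c * K * Hr)) :
    K * Hr * e ≤ 1 ∧ K * Hr * (e / p) ^ 2 ≤ 1 := by
  have hKH : 1 ≤ K * Hr := one_le_mul_of_one_le_of_one_le hK hH
  have h1 : K * Hr * (e / p) ≤ 1 := by
    rw [le_div_iff₀ (by positivity)] at h
    rw [mul_div_assoc', div_le_one hp]
    have : K * Hr * e ≤ c * (K * Hr * e) := le_mul_of_one_le_left (by positivity) hc
    linarith
  have h2 : e / p ≤ 1 := (le_mul_of_one_le_left (by positivity) hKH).trans h1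
  refine ⟨le_trans ?_ h1, le_trans ?_ h1⟩
  · refine mul_le_mul_of_nonneg_left ?_ (by positivity)
    rw [le_div_iff₀ hp]
    exact mul_le_of_le_one_right he.le hp1
  · exact mul_le_mul_of_nonneg_left (pow_le_of_le_one (by positivity) h2 two_ne_zero)
      (by positivity)

end Iterations

/-! ### Termination -/

section Termination

variable {O A S : Type*} [Fintype O] [Fintype A] [Fintype S] [DecidableEq S] [DecidableEq A]
  [Nonempty A] [Nonempty S] {H m : ℕ} {L : Learner O A S H} {Θ : Set (POMDP O A S)}
  {θ : POMDP O A S}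

lemma likelihood_initial_pos {K k : ℕ} (hk : k ≤ K) {D : Data O A H K}
    (hD : 0 < L.likelihood m θ D) : 0 < L.likelihood m θ (initial k hk D) :=
  Finset.prod_pos fun i _ => Finset.prod_pos fun h _ =>
    have hpos := likelihood_pos_iff L m θ hD (Fin.castLE hk i) h
    mul_pos hpos.1 hpos.2

/-- When no sampled history is unlikely and the likelihood ratios of the net are small, the
estimated models are close to the true model on the data. -/
lemma Learner.closeOnData {pmin β lam α ε t : ℝ} (hL : L.IsPSRUCB m Θ pmin β lam α) (hθ : θ ∈ Θ)
    (hpmin : 0 < pmin) (hβ : 1 ≤ β) (hε : 0 ≤ ε) (ht : Real.log t ≤ 2 * β)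
    {N : Finset (Traj O A H → ℝ)} (hN : IsOptimisticNet Θ ε N) {K : ℕ}
    (hK1 : K * H * ε ≤ 1) (hK2 : K * H * (ε / pmin) ^ 2 ≤ 1) {D : Data O A H K}
    (hD : 0 < L.likelihood m θ D)
    (hstable : ¬ ∃ (i : Fin K) (h : Fin H),
      θ.prob (past (D i h) h) * (L.policy i (past D i)).weight 0 h (D i h) < pmin)
    (hratio : ¬ ∃ (k : ℕ) (hk : k ≤ K), 1 ≤ k ∧ ∃ f ∈ N,
        (∀ τ, 0 ≤ f τ) ∧ (∀ π : Policy O A, ∑ τ, f τ * π.weight 0 H τ ≤ 1 + ε) ∧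
        t < L.ratioProd m θ ε f (initial k hk D))
    {k : ℕ} (hk : k ≤ K) (hk1 : 1 ≤ k) :
    CloseOnData m L.completion (L.model k (initial k hk D)) θ (initial k hk D) β := by
  push Not at hstable
  have hDk := likelihood_initial_pos hk hD
  have hθk : θ ∈ L.stableModels Θ pmin (initial k hk D) :=
    ⟨hθ, fun i h => hstable (Fin.castLE hk i) h⟩
  obtain ⟨hmem, hconf, -⟩ := hL k (initial k hk D) hk1
  obtain ⟨⟨-, hmin⟩, hlik⟩ := hconf (L.confidenceSet_nonempty m θ (by linarith) hDk hθk)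
  obtain ⟨f, hfN, hf, hfε⟩ := hN _ hmem
  set θ' := L.model k (initial k hk D)
  have hf0 : ∀ τ, 0 ≤ f τ := fun τ => (θ'.prob_nonneg τ).trans (hf τ)
  have hfε' : ∀ π : Policy O A, ∑ τ, (f τ - θ'.prob τ) * π.weight 0 H τ ≤ ε := by
    intro π
    refine le_trans (le_of_eq (Finset.sum_congr rfl fun τ _ => ?_)) (hfε π)
    rw [abs_of_nonneg (sub_nonneg.mpr (hf τ))]
  have hmass : ∀ π : Policy O A, ∑ τ, f τ * π.weight 0 H τ ≤ 1 + ε := by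
    intro π
    have h1 : ∑ τ : Traj O A H, θ'.prob τ * π.weight 0 H τ = 1 := by
      simp only [π.weight_zero_eq le_rfl, initial_self]
      exact sum_prob_mul_pathWeight θ' π H
    have h2 := hfε' π
    simp only [sub_mul, Finset.sum_sub_distrib, h1] at h2
    linarith
  have hY : L.ratioProd m θ ε f (initial k hk D) ≤ t := by
    by_contra hlt
    exact hratio ⟨k, hk, hk1, f, hfN, hf0, hmass, not_le.mp hlt⟩
  refine (L.sum_sq_condTV_le hpmin hf hfε' hDk hmin (hlik θ hθk) hY).trans ?_
  have hkK : (k : ℝ) ≤ K := by exact_mod_cast hk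
  have n1 : k * H * (ε / 2) ≤ 1 := by
    have : (k : ℝ) * H * ε ≤ K * H * ε := by gcongr
    have h0 : 0 ≤ (k : ℝ) * H * ε := by positivity
    linarith
  have n2 : k * H * (ε / pmin) ^ 2 ≤ 1 := by
    have : (k : ℝ) * H * (ε / pmin) ^ 2 ≤ K * H * (ε / pmin) ^ 2 := by gcongr
    linarith
  linarith

/-- If the estimated models are close to the true model on the data and the belief norms are close
to their conditional means, then the termination test passes early. -/
lemma Learner.exists_testPasses {a g c β lam α pmin ε t T : ℝ}
    (hL : L.IsPSRUCB m Θ pmin β lam α) (ha : 0 < a) (hH : 1 ≤ H) (hm : 1 ≤ m)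
    (hdec : ∀ θ ∈ Θ, θ.IsDecodable m H a)
    (hψ : ∀ θ' ∈ Θ, ∀ τ : Fin 0 → O × A, θ'.psi m H 0 τ = θ.psi m H 0 τ)
    (hg : √(Fintype.card S) / a ≤ g) (hg1 : 1 ≤ g) (hc : 1 ≤ c) (hβ : 1 ≤ β) (hlam : 0 < lam)
    (hlam1 : 1 / lam ≤ Fintype.card S)
    (hlam2 : lam ≤ (Fintype.card A * coreActsMax A m H * β) ^ 2)
    (hα : α = c * bonusScale (Fintype.card A) (Fintype.card S) (coreActsMax A m H) g H lam β)
    (hε : 0 < ε) (hε1 : ε ≤ 1)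
    (hT : T = 1 + Fintype.card S * g * coreActsMax A m H * H * Fintype.card A * β) {K : ℕ}
    (hK1 : 1 ≤ K) (hK : Real.log K ≤ β) (ht : Real.log t ≤ β)
    (hKT : 100000000 * c ^ 2 * T ^ 23 / ε ^ 2 ≤ K) {D : Data O A H K}
    (hclose : ∀ (k : ℕ) (hk : k ≤ K), 1 ≤ k →
      CloseOnData m L.completion (L.model k (initial k hk D)) θ (initial k hk D) β)
    (hmean : ∏ i : Fin K, ∏ h : Fin H, Real.exp (lam * (L.meanNormSq θ lam (past D i) h / 2
        - beliefNormSq lam θ (past D i) h (past (D i h) h))) ≤ t) :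
    ∃ (k : ℕ) (hk : k ≤ K), 1 ≤ k ∧ L.TestPasses m lam α ε (initial k hk D) ∧
      (k * H : ℝ) ≤ 100000000 * c ^ 2 * T ^ 23 / ε ^ 2 := by
  have hS1 : (1 : ℝ) ≤ Fintype.card S := by exact_mod_cast Fintype.card_pos
  have hA1 : (1 : ℝ) ≤ Fintype.card A := by exact_mod_cast Fintype.card_pos
  have hq1 : (1 : ℝ) ≤ coreActsMax A m H := by
    exact_mod_cast one_le_coreActsMax (A := A) (m := m) hH
  have hH1 : (1 : ℝ) ≤ H := by exact_mod_cast hH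
  set b := bonusScale (Fintype.card A) (Fintype.card S) (coreActsMax A m H) g H lam β with hb
  have hb0 : 0 ≤ b := by rw [hb, bonusScale]; positivity
  have hα0 : 0 ≤ α := by rw [hα]; positivity
  set κ : ℝ := 2 + (g * coreActsMax A m H) ^ 2 * Fintype.card S
          + 2 * ((2 * g * Fintype.card A * coreActsMax A m H) ^ 2 * (64 * β)) / lam with hκ
  set R := α * √κ + 2 * α * H * (64 * b) / √lam + 64 * b with hR
  have hR0 : 0 ≤ R := by rw [hR]; positivity
  have hRT : R ≤ 700 * c * T ^ 9 := by
    rw [hR, hα, hκ]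
    exact regretCoeff_le hg1 hA1 hq1 hβ hS1 hH1 hc hlam hlam1 hlam2 hT
  have hM := (L.sum_meanNormSq_le hlam θ hmean).trans (potentialBound_le hg1 hA1 hq1 hβ hS1 hH1
    hlam hlam1 (by exact_mod_cast hK1) hK ht hT)
  have hHT : (H : ℝ) ≤ T := by
    have : 1 ≤ Fintype.card S * g * coreActsMax A m H * Fintype.card A * β := by
      refine one_le_mul_of_one_le_of_one_le (one_le_mul_of_one_le_of_one_le
        (one_le_mul_of_one_le_of_one_le (one_le_mul_of_one_le_of_one_le hS1 hg1) hq1) hA1) hβ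
    have := le_mul_of_one_le_right (zero_le_one.trans hH1) this
    rw [hT]
    linarith
  have hT1 : 1 ≤ T := hH1.trans hHT
  set V := 100000000 * c ^ 2 * T ^ 23 / ε ^ 2 with hV
  -- the largest number of iterations with at most `V` episodes
  set n := ⌊V / H⌋₊ with hn
  have hV0 : 0 ≤ V := by positivity
  have hnV : (n : ℝ) ≤ V / H := Nat.floor_le (by positivity)
  have hnV' : V / H < n + 1 := Nat.lt_floor_add_one _
  have hnH : (n * H : ℝ) ≤ V := by rwa [le_div_iff₀ (by positivity)] at hnV
  have hnK : n ≤ K := by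
    have : (n : ℝ) ≤ K := by
      refine le_trans ?_ hKT
      exact (le_mul_of_one_le_right (Nat.cast_nonneg n) hH1).trans hnH
    exact_mod_cast this
  by_contra hno
  push Not at hno
  have hfail : ∀ i : Fin K, 1 ≤ i.val → i.val < n → ε / 2 ≤
      R * ∑ h, √(L.meanNormSq θ lam (past D i) h) := by
    intro i hi hin
    have h1 : ¬ L.TestPasses m lam α ε (initial i i.isLt.le D) := by
      intro h
      refine absurd (hno i i.isLt.le hi h) (not_lt.mpr (le_trans ?_ hnH))
      have : (i.val : ℝ) ≤ n := by exact_mod_cast hin.le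
      gcongr
    have hmem := (hL i (initial i i.isLt.le D) hi).1
    refine (not_le.mp h1).le.trans ?_
    exact value_bonus_le ha hm (hdec _ hmem) (fun τ => (hψ _ hmem τ).symm) hg hg1 hlam
      (zero_le_one.trans hβ) hα0 L.completion _ (hclose i i.isLt.le hi).symm rfl rfl
  have key := sq_mul_le_of_lt_sum_sqrt hnK (fun i h => L.meanNormSq_nonneg θ hlam _ h) hM
    (by positivity) hfail
  set x : ℝ := ((n - 1 : ℕ) : ℝ) with hx
  have hx1 : V / H - 2 ≤ x := by
    have : (n : ℝ) ≤ x + 1 := by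
      have : n ≤ (n - 1) + 1 := by omega
      rw [hx]
      exact_mod_cast this
    linarith
  have hVH : 100000000 * c ^ 2 * T ^ 22 ≤ V / H * ε ^ 2 := by
    have e1 : V / H * ε ^ 2 = 100000000 * c ^ 2 * T ^ 22 * (T / H) := by
      rw [hV]; field_simp
    rw [e1]
    refine le_mul_of_one_le_right (by positivity) ?_
    rwa [one_le_div (by positivity)]
  have hcT : 1 ≤ c ^ 2 * T ^ 22 :=
    one_le_mul_of_one_le_of_one_le (one_le_pow₀ hc) (one_le_pow₀ hT1)
  have hxε : 90000000 * (c ^ 2 * T ^ 22) ≤ x * ε ^ 2 := by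
    have h1 : (V / H - 2) * ε ^ 2 ≤ x * ε ^ 2 := by gcongr
    have h2 : ε ^ 2 ≤ 1 := pow_le_one₀ hε.le hε1
    nlinarith
  have hx0 : 0 < x := by
    have : 0 < x * ε ^ 2 := lt_of_lt_of_le (by positivity) hxε
    exact pos_of_mul_pos_left this (by positivity)
  have hbound : R ^ 2 * (x * H * (14 * T ^ 3)) ≤ x * (6860000 * (c ^ 2 * T ^ 22)) := by
    calc R ^ 2 * (x * H * (14 * T ^ 3)) ≤ (700 * c * T ^ 9) ^ 2 * (x * T * (14 * T ^ 3)) := by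
          gcongr
      _ = _ := by ring
  have hfinal : x * (x * ε ^ 2) ≤ x * (27440000 * (c ^ 2 * T ^ 22)) := by
    have := key.trans hbound
    linarith
  have := le_of_mul_le_mul_left hfinal hx0
  linarith

/-- A success that happens outside three exceptional events of small probability. -/
lemma Learner.one_sub_le_runProb {δ : ℝ} {K : ℕ} {E : Set (Data O A H K)}
    {p₁ p₂ p₃ : Data O A H K → Prop} [DecidablePred p₁] [DecidablePred p₂] [DecidablePred p₃]
    (h₁ : ∑ D : Data O A H K, L.likelihood m θ D * (if p₁ D then 1 else 0) ≤ δ / 3)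
    (h₂ : ∑ D : Data O A H K, L.likelihood m θ D * (if p₂ D then 1 else 0) ≤ δ / 3)
    (h₃ : ∑ D : Data O A H K, L.likelihood m θ D * (if p₃ D then 1 else 0) ≤ δ / 3)
    (h : ∀ D, 0 < L.likelihood m θ D → ¬ p₁ D → ¬ p₂ D → ¬ p₃ D → D ∈ E) :
    1 - δ ≤ L.runProb m θ E := by
  have h4 : ∑ D : Data O A H K, L.likelihood m θ D ≤ L.runProb m θ E +
      ((∑ D : Data O A H K, L.likelihood m θ D * (if p₁ D then 1 else 0)) +
        (∑ D : Data O A H K, L.likelihood m θ D * (if p₂ D then 1 else 0)) +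
        ∑ D : Data O A H K, L.likelihood m θ D * (if p₃ D then 1 else 0)) := by
    rw [Learner.runProb]
    simp only [← Finset.sum_add_distrib]
    refine Finset.sum_le_sum fun D _ => ?_
    have h0 := L.likelihood_nonneg m θ D
    have hind : 0 ≤ E.indicator (L.likelihood m θ) D :=
      Set.indicator_nonneg (fun D _ => L.likelihood_nonneg m θ D) D
    rcases h0.eq_or_lt with hD | hD
    · rw [← hD]; simpa using hind
    by_cases hp : p₁ D ∨ p₂ D ∨ p₃ D
    · rcases hp with hp | hp | hp <;> rw [if_pos hp] <;> split_ifs <;> linarith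
    · push Not at hp
      rw [Set.indicator_of_mem (h D hD hp.1 hp.2.1 hp.2.2)]
      simp [hp]
  rw [L.sum_likelihood m θ K] at h4
  linarith

end Termination

open PSRUCB
theorem corollary1 (η : ℝ) (hη : 0 < η) :
    ∃ (c : ℝ) (P : MvPolynomial (Fin 6) ℝ), 1 ≤ c ∧
      ∀ (O A S : Type*) [Fintype O] [Nonempty O] [Fintype A] [Nonempty A] [DecidableEq A]
        [Fintype S] [Nonempty S] [DecidableEq S]
        (H m K : ℕ) (_ : 1 ≤ H) (_ : 1 ≤ m)
        -- the model class, with the true model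
        (Θ : Set (POMDP O A S)) (θstar : POMDP O A S) (_ : θstar ∈ Θ)
        -- decodability, and the conditioning constant that comes with it
        (a γ : ℝ) (_ : 0 < a) (_ : ∀ θ ∈ Θ, θ.IsDecodable m H a)
        (_ : γ = a / ((Fintype.card S : ℝ) + coreActsMax A m H))
        -- the initial feature is known
        (_ : ∀ θ ∈ Θ, ∀ τ : Fin 0 → O × A, θ.psi m H 0 τ = θstar.psi m H 0 τ)
        -- accuracy, confidence, and the inputs of the algorithm
        (ε δ pmin εnet β lam α : ℝ) (_ : 0 < ε) (_ : ε ≤ 1) (_ : 0 < δ) (_ : δ < 1)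
        (_ : 0 < pmin)
        (_ : pmin ≤ δ / (c * K * H * (Fintype.card O : ℝ) ^ H * (Fintype.card A : ℝ) ^ H))
        (_ : 0 < εnet) (_ : εnet ≤ pmin / (c * K * H))
        (net : Finset (Traj O A H → ℝ)) (_ : IsOptimisticNet Θ εnet net)
        (_ : c * Real.log (K * net.card / δ) ≤ β)
        (_ : lam = γ * (Fintype.card A : ℝ) ^ 2 * coreActsMax A m H * β *
            max (√(Fintype.card S)) (coreActsMax A m H * √H / γ) / √(Fintype.card S * H))
        (_ : α = c * (coreActsMax A m H * √(H * Fintype.card S) / γ ^ 2 * √lam +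
            Fintype.card A * coreActsMax A m H * √β / γ))
        -- the iteration limit is large enough
        (_ : MvPolynomial.eval ![(Fintype.card S : ℝ), 1 / γ, coreActsMax A m H, H,
            Fintype.card A, β] P / ε ^ 2 ≤ K)
        -- every execution
        (L : Learner O A S H) (_ : L.IsPSRUCB m Θ pmin β lam α),
        1 - δ ≤ L.runProb m θstar {D : Data O A H K |
          ∃ (k : ℕ) (hk : k ≤ K), L.TerminatesAt m lam α ε D k hk ∧
            -- the number of episodes played
            (k * H : ℝ) ≤ MvPolynomial.eval ![(Fintype.card S : ℝ), 1 / γ, coreActsMax A m H, H,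
              Fintype.card A, β] P / ε ^ 2 ∧
            -- the accuracy of the model and of the policy that are returned
            (∀ π : Policy O A,
              tvDist H (L.model k (initial k hk D)) θstar π ≤ (1 + η) * ε) ∧
            ∀ R : Traj O A H → ℝ, (∀ τ, 0 ≤ R τ ∧ R τ ≤ 1) →
              ∀ πbar : Policy O A, (L.model k (initial k hk D)).IsGreedy R πbar →
                ∀ π : Policy O A, θstar.value π R - θstar.value πbar R ≤ (1 + η) * ε} := by
  classical
  -- `2 + 64 / c` is at most `2 (1 + η)`, the accuracy for a bonus of value `ε / 2`
  set c : ℝ := 3 + 32 / η with hc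
  have hc3 : 3 ≤ c := by
    have : 0 < 32 / η := by positivity
    linarith
  have hc1 : 1 ≤ c := by linarith
  have hcη : 2 + 64 / c ≤ 2 * (1 + η) := by
    have h1 : 32 / η ≤ c := by linarith
    rw [div_le_iff₀ hη] at h1
    have h2 : 64 / c ≤ 2 * η := by
      rw [div_le_iff₀ (by linarith)]
      linarith
    linarith
  refine ⟨c, MvPolynomial.C (100000000 * c ^ 2) * (1 + ∏ i, MvPolynomial.X i) ^ 23, hc1, ?_⟩
  intro O A S _ _ _ _ _ _ _ _ H m K hH hm Θ θstar hθ a γ ha hdec hγ hψ ε δ pmin εnet β lam α hε hε1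
    hδ hδ1 hpmin hpmin' hεnet hεnet' net hnet hβ' hlam hα hK L hL
  have hS1 : (1 : ℝ) ≤ Fintype.card S := by exact_mod_cast Fintype.card_pos
  have hA1 : (1 : ℝ) ≤ Fintype.card A := by exact_mod_cast Fintype.card_pos
  have hO1 : (1 : ℝ) ≤ Fintype.card O := by exact_mod_cast Fintype.card_pos
  have hq1 : (1 : ℝ) ≤ coreActsMax A m H := by
    exact_mod_cast one_le_coreActsMax (A := A) (m := m) hH
  have hH1 : (1 : ℝ) ≤ H := by exact_mod_cast hH
  -- the conditioning constant
  have haq := le_coreActsMax_of_isDecodable ha hH (hdec _ hθ)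
  have hγ0 : 0 < γ := by rw [hγ]; positivity
  have hγ1 : γ ≤ 1 := by
    rw [hγ, div_le_one (by positivity)]
    linarith
  set g := 1 / γ with hg
  have hg1 : 1 ≤ g := by rwa [hg, one_le_div hγ0]
  have hga : √(Fintype.card S) / a ≤ g := by
    rw [hg, hγ, one_div_div]
    refine div_le_div_of_nonneg_right ?_ ha.le
    have : √(Fintype.card S : ℝ) ≤ Fintype.card S :=
      Real.sqrt_le_iff.mpr ⟨by positivity, by nlinarith⟩
    linarith
  set T : ℝ := 1 + Fintype.card S * g * coreActsMax A m H * H * Fintype.card A * β with hT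
  have hPT : MvPolynomial.eval ![(Fintype.card S : ℝ), g, coreActsMax A m H, H,
      Fintype.card A, β] (MvPolynomial.C (100000000 * c ^ 2) *
        (1 + ∏ i : Fin 6, MvPolynomial.X i) ^ 23) = 100000000 * c ^ 2 * T ^ 23 := by
    rw [hT, Fin.prod_univ_six]
    simp
  rw [hPT] at hK ⊢
  -- the iteration limit and the width of the confidence set
  have hN1 : (1 : ℝ) ≤ net.card := by
    obtain ⟨f, hf, -⟩ := hnet _ hθ
    exact_mod_cast Finset.card_pos.mpr ⟨f, hf⟩
  have hKpos : 0 < K := by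
    rcases Nat.eq_zero_or_pos K with h | h
    · rw [h] at hpmin'
      simp at hpmin'
      linarith
    · exact h
  have hKpos' : (1 : ℝ) ≤ K := by exact_mod_cast hKpos
  set ℓ := Real.log (K * net.card / δ) with hℓ
  have hKN : (1 : ℝ) ≤ K * net.card := one_le_mul_of_one_le_of_one_le hKpos' hN1
  have hℓ0 : 0 ≤ ℓ := Real.log_nonneg (by
    rw [one_le_div hδ]
    linarith)
  have hβ0 : 0 ≤ β := (mul_nonneg (by linarith) hℓ0).trans hβ'
  have hT0 : 1 ≤ T := by
    have : 0 ≤ Fintype.card S * g * coreActsMax A m H * H * Fintype.card A * β := by positivity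
    linarith
  have hK3 : (3 : ℝ) ≤ K := by
    refine le_trans ?_ hK
    rw [le_div_iff₀ (by positivity)]
    have h1 : 1 ≤ c ^ 2 * T ^ 23 :=
      one_le_mul_of_one_le_of_one_le (one_le_pow₀ hc1) (one_le_pow₀ hT0)
    have h2 : ε ^ 2 ≤ 1 := pow_le_one₀ hε.le hε1
    linarith
  obtain ⟨hβ1, hlogK, hlogδ, hlogt⟩ := log_bounds hc1 hK3 hN1 hδ hδ1.le hβ'
  obtain ⟨hlam0, hlam1, hlam2⟩ := regularization_bounds hγ0 hγ1 hA1 hq1 hβ1 hS1 hH1 hlam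
  have hαb : α = c * bonusScale (Fintype.card A) (Fintype.card S) (coreActsMax A m H) g H lam β := by
    rw [hα, bonusScale, hg]
    ring
  -- the net is fine relative to the least probability of a sampled history
  have hcKH : 1 ≤ c * K * H :=
    one_le_mul_of_one_le_of_one_le (one_le_mul_of_one_le_of_one_le hc1 hKpos') hH1
  have hp1 : pmin ≤ 1 := by
    refine hpmin'.trans ((div_le_one (by positivity)).mpr (hδ1.le.trans ?_))
    exact one_le_mul_of_one_le_of_one_le (one_le_mul_of_one_le_of_one_le hcKH (one_le_pow₀ hO1))
      (one_le_pow₀ hA1)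
  obtain ⟨hnet1, hnet2⟩ := net_bounds hc1 hKpos' hH1 hpmin hp1 hεnet hεnet'
  -- the three exceptional events
  have hA := L.sum_likelihood_ratioProd_large_le m θstar (ε := εnet)
    (t := 3 * (K * net.card / δ)) (by positivity) net K
  have hB := L.markov m θstar (K := K) (fun D => Finset.prod_nonneg fun i _ =>
    Finset.prod_nonneg fun h _ => (Real.exp_pos _).le)
    (L.sum_likelihood_mul_exp_le m θstar hlam0 K) (t := 3 / δ) (by positivity)
  have hC := L.sum_likelihood_unlikely_le m θstar hpmin K
  have hA' : (K : ℝ) * net.card / (3 * (K * net.card / δ)) = δ / 3 := by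
    field_simp
  have hB' : 1 / (3 / δ) = δ / 3 := one_div_div _ _
  have hC' : K * (H * ((Fintype.card O : ℝ) ^ H * (Fintype.card A : ℝ) ^ H * pmin)) ≤ δ / 3 := by
    rw [le_div_iff₀ (by positivity)] at hpmin'
    rw [le_div_iff₀ (by norm_num)]
    have h0 : 0 ≤ pmin * K * H * (Fintype.card O : ℝ) ^ H * (Fintype.card A : ℝ) ^ H := by positivity
    have h1 := mul_le_mul_of_nonneg_right hc3 h0
    linarith
  refine Learner.one_sub_le_runProb (hA.trans_eq hA') (hB.trans_eq hB') (hC.trans hC')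
    fun D hD hgA hgB hgC => ?_
  have hclose := fun (k : ℕ) (hk : k ≤ K) (hk1 : 1 ≤ k) => Learner.closeOnData hL hθ hpmin hβ1
    hεnet.le hlogt hnet hnet1 hnet2 hD hgC hgA hk hk1
  have hex := Learner.exists_testPasses hL ha hH hm hdec hψ hga hg1 hc1 hβ1 hlam0 hlam1 hlam2 hαb
    hε hε1 hT hKpos hlogK hlogδ hK hclose (not_lt.mp hgB)
  have hex' : ∃ k, ∃ hk : k ≤ K, 1 ≤ k ∧ L.TestPasses m lam α ε (initial k hk D) := by
    obtain ⟨k, hk, h1, h2, -⟩ := hex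
    exact ⟨k, hk, h1, h2⟩
  obtain ⟨hk, hk1, hpass⟩ := Nat.find_spec hex'
  have hmin : ∀ j, j < Nat.find hex' → ¬ ∃ hk : j ≤ K, 1 ≤ j ∧
      L.TestPasses m lam α ε (initial j hk D) := fun j hj => Nat.find_min hex' hj
  have hle : ((Nat.find hex' : ℕ) * H : ℝ) ≤ 100000000 * c ^ 2 * T ^ 23 / ε ^ 2 := by
    obtain ⟨k, hk, h1, h2, h3⟩ := hex
    refine le_trans ?_ h3
    have : ((Nat.find hex' : ℕ) : ℝ) ≤ k := by
      exact_mod_cast Nat.find_min' hex' ⟨hk, h1, h2⟩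
    gcongr
  set k := Nat.find hex'
  obtain ⟨hmem, -, hgreedy⟩ := hL k (initial k hk D) hk1
  have hacc : ∀ π : Policy O A, tvDist H (L.model k (initial k hk D)) θstar π ≤ (1 + η) * ε := by
    intro π
    have h1 := tvDist_le_value_bonus (c := c) ha hm hH (hdec _ hmem) (hdec _ hθ) (hψ _ hmem) hga hg1
      hlam0 (zero_lt_one.trans_le hβ1) (zero_lt_one.trans_le hc1) L.completion π (initial k hk D)
      (hclose k hk hk1)
    rw [← hαb] at h1
    have h2 := (hgreedy π).trans hpass
    have h3 : 0 ≤ 2 + 64 / c := by positivity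
    calc _ ≤ (2 + 64 / c) * (ε / 2) := h1.trans (mul_le_mul_of_nonneg_left h2 h3)
      _ ≤ 2 * (1 + η) * (ε / 2) := by gcongr
      _ = (1 + η) * ε := by ring
  exact ⟨k, hk, ⟨hk1, hpass, fun j hj hj1 h => hmin j hj ⟨_, hj1, h⟩⟩, hle, hacc,
    fun R hR πbar hπbar π => value_sub_value_le hacc hR hπbar π⟩

end

end PSRUCB

theorem corollary1 (η : ℝ) (hη : 0 < η) :
    ∃ (c : ℝ) (P : MvPolynomial (Fin 6) ℝ), 1 ≤ c ∧
      ∀ (O A S : Type*) [Fintype O] [Nonempty O] [Fintype A] [Nonempty A] [DecidableEq A]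
        [Fintype S] [Nonempty S] [DecidableEq S]
        (H m K : ℕ) (_ : 1 ≤ H) (_ : 1 ≤ m)
        -- the model class, with the true model
        (Θ : Set (POMDP O A S)) (θstar : POMDP O A S) (_ : θstar ∈ Θ)
        -- decodability, and the conditioning constant that comes with it
        (a γ : ℝ) (_ : 0 < a) (_ : ∀ θ ∈ Θ, θ.IsDecodable m H a)
        (_ : γ = a / ((Fintype.card S : ℝ) + coreActsMax A m H))
        -- the initial feature is known
        (_ : ∀ θ ∈ Θ, ∀ τ : Fin 0 → O × A, θ.psi m H 0 τ = θstar.psi m H 0 τ)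
        -- accuracy, confidence, and the inputs of the algorithm
        (ε δ pmin εnet β lam α : ℝ) (_ : 0 < ε) (_ : ε ≤ 1) (_ : 0 < δ) (_ : δ < 1)
        (_ : 0 < pmin)
        (_ : pmin ≤ δ / (c * K * H * (Fintype.card O : ℝ) ^ H * (Fintype.card A : ℝ) ^ H))
        (_ : 0 < εnet) (_ : εnet ≤ pmin / (c * K * H))
        (net : Finset (Traj O A H → ℝ)) (_ : IsOptimisticNet Θ εnet net)
        (_ : c * Real.log (K * net.card / δ) ≤ β)
        (_ : lam = γ * (Fintype.card A : ℝ) ^ 2 * coreActsMax A m H * β *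
            max (√(Fintype.card S)) (coreActsMax A m H * √H / γ) / √(Fintype.card S * H))
        (_ : α = c * (coreActsMax A m H * √(H * Fintype.card S) / γ ^ 2 * √lam +
            Fintype.card A * coreActsMax A m H * √β / γ))
        -- the iteration limit is large enough
        (_ : MvPolynomial.eval ![(Fintype.card S : ℝ), 1 / γ, coreActsMax A m H, H,
            Fintype.card A, β] P / ε ^ 2 ≤ K)
        -- every execution
        (L : Learner O A S H) (_ : L.IsPSRUCB m Θ pmin β lam α),
        1 - δ ≤ L.runProb m θstar {D : Data O A H K |
          ∃ (k : ℕ) (hk : k ≤ K), L.TerminatesAt m lam α ε D k hk ∧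
            -- the number of episodes played
            (k * H : ℝ) ≤ MvPolynomial.eval ![(Fintype.card S : ℝ), 1 / γ, coreActsMax A m H, H,
              Fintype.card A, β] P / ε ^ 2 ∧
            -- the accuracy of the model and of the policy that are returned
            (∀ π : Policy O A,
              tvDist H (L.model k (initial k hk D)) θstar π ≤ (1 + η) * ε) ∧
            ∀ R : Traj O A H → ℝ, (∀ τ, 0 ≤ R τ ∧ R τ ≤ 1) →
              ∀ πbar : Policy O A, (L.model k (initial k hk D)).IsGreedy R πbar →
                ∀ π : Policy O A, θstar.value π R - θstar.value πbar R ≤ (1 + η) * ε} := by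
  classical
  -- a bonus of value `ε / 2` gives the accuracy `(2 + 64 / c) * (ε / 2)`
  set c : ℝ := 3 + 32 / η with hc
  have hc3 : 3 ≤ c := by
    have : 0 < 32 / η := by positivity
    linarith
  have hc1 : 1 ≤ c := by linarith
  have hcη : 2 + 64 / c ≤ 2 * (1 + η) := by
    have h1 : 32 / η ≤ c := by linarith
    rw [div_le_iff₀ hη] at h1
    have h2 : 64 / c ≤ 2 * η := by
      rw [div_le_iff₀ (by linarith)]
      linarith
    linarith
  refine ⟨c, MvPolynomial.C (100000000 * c ^ 2) * (1 + ∏ i, MvPolynomial.X i) ^ 23, hc1, ?_⟩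
  intro O A S _ _ _ _ _ _ _ _ H m K hH hm Θ θstar hθ a γ ha hdec hγ hψ ε δ pmin εnet β lam α hε hε1
    hδ hδ1 hpmin hpmin' hεnet hεnet' net hnet hβ' hlam hα hK L hL
  have hS1 : (1 : ℝ) ≤ Fintype.card S := by exact_mod_cast Fintype.card_pos
  have hA1 : (1 : ℝ) ≤ Fintype.card A := by exact_mod_cast Fintype.card_pos
  have hO1 : (1 : ℝ) ≤ Fintype.card O := by exact_mod_cast Fintype.card_pos
  have hq1 : (1 : ℝ) ≤ coreActsMax A m H := by
    exact_mod_cast one_le_coreActsMax (A := A) (m := m) hH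
  have hH1 : (1 : ℝ) ≤ H := by exact_mod_cast hH
  -- the conditioning constant
  have haq := le_coreActsMax_of_isDecodable ha hH (hdec _ hθ)
  have hγ0 : 0 < γ := by rw [hγ]; positivity
  have hγ1 : γ ≤ 1 := by
    rw [hγ, div_le_one (by positivity)]
    linarith
  set g := 1 / γ with hg
  have hg1 : 1 ≤ g := by rwa [hg, one_le_div hγ0]
  have hga : √(Fintype.card S) / a ≤ g := by
    rw [hg, hγ, one_div_div]
    refine div_le_div_of_nonneg_right ?_ ha.le
    have : √(Fintype.card S : ℝ) ≤ Fintype.card S :=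
      Real.sqrt_le_iff.mpr ⟨by positivity, by nlinarith⟩
    linarith
  set T : ℝ := 1 + Fintype.card S * g * coreActsMax A m H * H * Fintype.card A * β with hT
  have hPT : MvPolynomial.eval ![(Fintype.card S : ℝ), g, coreActsMax A m H, H,
      Fintype.card A, β] (MvPolynomial.C (100000000 * c ^ 2) *
        (1 + ∏ i : Fin 6, MvPolynomial.X i) ^ 23) = 100000000 * c ^ 2 * T ^ 23 := by
    rw [hT, Fin.prod_univ_six]
    simp
  rw [hPT] at hK ⊢
  -- the iteration limit and the width of the confidence set
  have hN1 : (1 : ℝ) ≤ net.card := by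
    obtain ⟨f, hf, -⟩ := hnet _ hθ
    exact_mod_cast Finset.card_pos.mpr ⟨f, hf⟩
  -- for `K = 0` the division by zero in the bound on `pmin` would give `pmin ≤ 0`
  have hKpos : 0 < K := by
    rcases Nat.eq_zero_or_pos K with h | h
    · rw [h] at hpmin'
      simp at hpmin'
      linarith
    · exact h
  have hKpos' : (1 : ℝ) ≤ K := by exact_mod_cast hKpos
  set ℓ := Real.log (K * net.card / δ) with hℓ
  have hKN : (1 : ℝ) ≤ K * net.card := one_le_mul_of_one_le_of_one_le hKpos' hN1
  have hℓ0 : 0 ≤ ℓ := Real.log_nonneg (by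
    rw [one_le_div hδ]
    linarith)
  have hβ0 : 0 ≤ β := (mul_nonneg (by linarith) hℓ0).trans hβ'
  have hT0 : 1 ≤ T := by
    have : 0 ≤ Fintype.card S * g * coreActsMax A m H * H * Fintype.card A * β := by positivity
    linarith
  -- this uses the summand `1` of `T`, as `β` may be small so far
  have hK3 : (3 : ℝ) ≤ K := by
    refine le_trans ?_ hK
    rw [le_div_iff₀ (by positivity)]
    have h1 : 1 ≤ c ^ 2 * T ^ 23 :=
      one_le_mul_of_one_le_of_one_le (one_le_pow₀ hc1) (one_le_pow₀ hT0)
    have h2 : ε ^ 2 ≤ 1 := pow_le_one₀ hε.le hε1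
    linarith
  obtain ⟨hβ1, hlogK, hlogδ, hlogt⟩ := log_bounds hc1 hK3 hN1 hδ hδ1.le hβ'
  obtain ⟨hlam0, hlam1, hlam2⟩ := regularization_bounds hγ0 hγ1 hA1 hq1 hβ1 hS1 hH1 hlam
  have hαb : α = c * bonusScale (Fintype.card A) (Fintype.card S) (coreActsMax A m H) g H lam β := by
    rw [hα, bonusScale, hg]
    ring
  -- the net is fine relative to the least probability of a sampled history
  have hcKH : 1 ≤ c * K * H :=
    one_le_mul_of_one_le_of_one_le (one_le_mul_of_one_le_of_one_le hc1 hKpos') hH1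
  have hp1 : pmin ≤ 1 := by
    refine hpmin'.trans ((div_le_one (by positivity)).mpr (hδ1.le.trans ?_))
    exact one_le_mul_of_one_le_of_one_le (one_le_mul_of_one_le_of_one_le hcKH (one_le_pow₀ hO1))
      (one_le_pow₀ hA1)
  obtain ⟨hnet1, hnet2⟩ := net_bounds hc1 hKpos' hH1 hpmin hp1 hεnet hεnet'
  -- the three exceptional events
  have hA := L.sum_likelihood_ratioProd_large_le m θstar (ε := εnet)
    (t := 3 * (K * net.card / δ)) (by positivity) net K
  have hB := L.markov m θstar (K := K) (fun D => Finset.prod_nonneg fun i _ =>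
    Finset.prod_nonneg fun h _ => (Real.exp_pos _).le)
    (L.sum_likelihood_mul_exp_le m θstar hlam0 K) (t := 3 / δ) (by positivity)
  have hC := L.sum_likelihood_unlikely_le m θstar hpmin K
  have hA' : (K : ℝ) * net.card / (3 * (K * net.card / δ)) = δ / 3 := by
    field_simp
  have hB' : 1 / (3 / δ) = δ / 3 := one_div_div _ _
  have hC' : K * (H * ((Fintype.card O : ℝ) ^ H * (Fintype.card A : ℝ) ^ H * pmin)) ≤ δ / 3 := by
    rw [le_div_iff₀ (by positivity)] at hpmin'
    rw [le_div_iff₀ (by norm_num)]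
    have h0 : 0 ≤ pmin * K * H * (Fintype.card O : ℝ) ^ H * (Fintype.card A : ℝ) ^ H := by positivity
    have h1 := mul_le_mul_of_nonneg_right hc3 h0
    linarith
  refine Learner.one_sub_le_runProb (hA.trans_eq hA') (hB.trans_eq hB') (hC.trans hC')
    fun D hD hgA hgB hgC => ?_
  have hclose := fun (k : ℕ) (hk : k ≤ K) (hk1 : 1 ≤ k) => Learner.closeOnData hL hθ hpmin hβ1
    hεnet.le hlogt hnet hnet1 hnet2 hD hgC hgA hk hk1
  have hex := Learner.exists_testPasses hL ha hH hm hdec hψ hga hg1 hc1 hβ1 hlam0 hlam1 hlam2 hαb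
    hε hε1 hT hKpos hlogK hlogδ hK hclose (not_lt.mp hgB)
  have hex' : ∃ k, ∃ hk : k ≤ K, 1 ≤ k ∧ L.TestPasses m lam α ε (initial k hk D) := by
    obtain ⟨k, hk, h1, h2, -⟩ := hex
    exact ⟨k, hk, h1, h2⟩
  obtain ⟨hk, hk1, hpass⟩ := Nat.find_spec hex'
  have hmin : ∀ j, j < Nat.find hex' → ¬ ∃ hk : j ≤ K, 1 ≤ j ∧
      L.TestPasses m lam α ε (initial j hk D) := fun j hj => Nat.find_min hex' hj
  have hle : ((Nat.find hex' : ℕ) * H : ℝ) ≤ 100000000 * c ^ 2 * T ^ 23 / ε ^ 2 := by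
    obtain ⟨k, hk, h1, h2, h3⟩ := hex
    refine le_trans ?_ h3
    have : ((Nat.find hex' : ℕ) : ℝ) ≤ k := by
      exact_mod_cast Nat.find_min' hex' ⟨hk, h1, h2⟩
    gcongr
  set k := Nat.find hex'
  obtain ⟨hmem, -, hgreedy⟩ := hL k (initial k hk D) hk1
  have hacc : ∀ π : Policy O A, tvDist H (L.model k (initial k hk D)) θstar π ≤ (1 + η) * ε := by
    intro π
    have h1 := tvDist_le_value_bonus (c := c) ha hm hH (hdec _ hmem) (hdec _ hθ) (hψ _ hmem) hga hg1
      hlam0 (zero_lt_one.trans_le hβ1) (zero_lt_one.trans_le hc1) L.completion π (initial k hk D)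
      (hclose k hk hk1)
    rw [← hαb] at h1
    have h2 := (hgreedy π).trans hpass
    have h3 : 0 ≤ 2 + 64 / c := by positivity
    calc _ ≤ (2 + 64 / c) * (ε / 2) := h1.trans (mul_le_mul_of_nonneg_left h2 h3)
      _ ≤ 2 * (1 + η) * (ε / 2) := by gcongr
      _ = (1 + η) * ε := by ring
  exact ⟨k, hk, ⟨hk1, hpass, fun j hj hj1 h => hmin j hj ⟨_, hj1, h⟩⟩, hle, hacc,
    fun R hR πbar hπbar π => value_sub_value_le hacc hR hπbar π⟩
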